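/- **Lemma (Identification of $\mathtt K_W$ in terms of $\mathtt R$).** Let $d\ge 3$, $\beta\in(0,\infty)$, $u\in(0,\infty)$, and let $W\subset\mathbb R^d$ be bounded and measurable with positive Lebesgue measure (for example a non-degenerate box). Brownian motion means Brownian motion in $\mathbb R^d$ with generator $\Delta$ (increments over $[s,t]$ are $\mathcal N(0,2(t-s)\,\mathrm{Id})$), and $\mathbb P_x$ is its law (and that of the Gaussian random walk $X_n=B_{n\beta}$) when started at $x$. *The process $\mathtt R$.* For a box $V$ let $e_V(x)=\mathbf 1_V(x)\,\mathbb P_x(X_n\notin V\ \forall n\ge1)$ and let $Q_V$ be the measure on two-sided sequences $(X_n)_{n\in\mathbb Z}$ given by $$Q_V\big((X_{-n})_{n\ge0}\in A,\,X_0\in \mathrm dx,\,(X_n)_{n\ge0}\in B\big)=\mathbb P_x\big(A\,\big|\,X_n\notin V\ \forall n\ge1\big)\,e_V(x)\,\mathbb P_x(B)\,\mathrm dx .$$ Let $\Upsilon$ be the $\sigma$-finite measure on two-sided trajectories modulo time shift whose restriction to the trajectories visiting $V$ is the image of $Q_V$, for every box $V$. Interpolating a trajectory $(X_n)_n$ by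 independent Brownian bridges from $X_n$ to $X_{n+1}$ on the time intervals $[n\beta,(n+1)\beta]$, $n\in\mathbb Z$, turns $\Upsilon$ into a $\sigma$-finite measure $\Upsilon_K$ on continuous paths $g\colon\mathbb R\to\mathbb R^d$ modulo time shifts in $\beta\mathbb Z$ (interlacements). The law of the Brownian interlacement Poisson point process with spacing $\beta$, $\mathtt R=\mathtt R^{(u,\beta)}$, is the law of the Poisson point process $\varpi=\sum_g\delta_g$ of interlacements with intensity measure $v_u\Upsilon_K$, where $v_u\in[0,\infty)$ is such that the expected number of particles $\sum_g\#\{k\in\mathbb Z\colon g(k\beta)\in[-\frac12,\frac12]^d\}$ in the unit box is $u$. *Shreds.* A $W$-shred of $g$ with $l\in\mathbb N=\{1,2,\dots\}$ legs is a piece $g|_{[k\beta,(k+l)\beta]}$, $k\in\mathbb Z$, shifted to the time interval $[0,l\beta]$, such that $g((k-1)\beta)\notin W$, $g(k\beta),\dots,g((k+l-1)\beta)\in W$ and $g((k+l)\beta)\notin W$. Let $\Pi_W(\varpi)$ be the point measure of all $W$-shreds of all points of $\varpi$, and $\partial\Pi_W(\varpi)=\sum_f\delta_{(f(0),\,l,\,f(l\beta))}$,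 the sum being over these shreds $f$, with $l$ the number of legs of $f$. *The kernel $\mathtt K_W$.* For $x\in W$, $l\in\mathbb N$, $y\in W^{\rm c}$ let $$q^{(W,l)}_{x,y}(\mathrm df)=\mathbb P_x\big((B_t)_{t\in[0,l\beta]}\in\mathrm df\,\big|\,B_\beta,B_{2\beta},\dots,B_{(l-1)\beta}\in W,\ B_{l\beta}=y\big),$$ i.e. the law of the Brownian bridge from $x$ to $y$ on $[0,l\beta]$ conditioned on being in $W$ at the times $\beta,\dots,(l-1)\beta$. For a finite point measure $\mu=\sum_{i\in I}\delta_{(x_i,l_i,y_i)}$ on $W\times\mathbb N\times W^{\rm c}$ let $\mathtt K_W(\mu,\cdot)$ be the law of $\sum_{i\in I}\delta_{f_i}$, where the $f_i$ are independent with laws $q^{(W,l_i)}_{x_i,y_i}$. *Claim.* For $\mathtt R$-almost every $\varpi$, $\partial\Pi_W(\varpi)$ is a finite point measure on $W\times\mathbb N\times W^{\rm c}$; $\mathtt K_W$ is (extends to) a Markov kernel from the measures on $\mathbb R^d\times\mathbb N_0\times\mathbb R^d$ to the measures on finite paths; and $\mathtt K_W$ is a regular version of the conditional distribution of $\Pi_W(\varpi)$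 given $\partial\Pi_W(\varpi)$ under $\mathtt R$, i.e. the law of $(\partial\Pi_W(\varpi),\Pi_W(\varpi))$ under $\mathtt R$ is $(\mathtt R\circ\partial\Pi_W^{-1})(\mathrm d\mu)\,\mathtt K_W(\mu,\mathrm d\nu)$. -/

import Mathlib

open MeasureTheory ProbabilityTheory Set Filter Topology
open scoped NNReal ENNReal

namespace BrownianShreds

/-! ### Paths, their measurable structure, and particles

`β : ℝ≥0` is the time between two particles, the state space is Euclidean `ℝ^d`. -/

/-- Euclidean space `ℝ^d`. -/
abbrev E (d : ℕ) : Type := EuclideanSpace ℝ (Fin d)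

/-- The `σ`-algebra on a space of continuous paths that is generated by the evaluations. -/
instance pathMeasurableSpace {X : Type*} [TopologicalSpace X] {d : ℕ} :
    MeasurableSpace C(X, E d) :=
  MeasurableSpace.comap (fun (f : C(X, E d)) (t : X) => f t) MeasurableSpace.pi

/-- The closed cube `[-r, r]^d`. -/
def box (d : ℕ) (r : ℝ) : Set (E d) := {x | ∀ i, |x i| ≤ r}

/-! ### Brownian motion, Brownian bridges, Gaussian random walk -/

/-- The centred Gaussian law on `ℝ^d` with covariance matrix `2 t Id`: the law at time `t` of
Brownian motion with generator `Δ` (not `Δ / 2`) started at the origin. -/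
noncomputable def gaussianStep (d : ℕ) (t : ℝ≥0) : Measure (E d) :=
  multivariateGaussian 0 ((2 * (t : ℝ)) • (1 : Matrix (Fin d) (Fin d) ℝ))

/-- `P₀` is the law, on the space of continuous paths `[0, ∞) → ℝ^d`, of Brownian motion with
generator `Δ` started at the origin: independent increments, the increment over `[s, t]` being
centred Gaussian with covariance matrix `2 (t - s) Id`. -/
structure IsBrownianLaw {d : ℕ} (P₀ : Measure C(ℝ≥0, E d)) : Prop where
  isProbabilityMeasure : IsProbabilityMeasure P₀
  start : ∀ᵐ w ∂P₀, w 0 = 0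
  indep : HasIndepIncrements (fun (t : ℝ≥0) (w : C(ℝ≥0, E d)) => w t) P₀
  increment : ∀ s t : ℝ≥0, s ≤ t →
    P₀.map (fun w : C(ℝ≥0, E d) => w t - w s) = gaussianStep d (t - s)

/-- The path `s ↦ x + (w s - w 0) - (s / T) (x + (w T - w 0) - y)`. If `w` is a Brownian path, then
its restriction to `[0, T]` is a Brownian bridge from `x` to `y` with time interval `[0, T]`. -/
noncomputable def bridgePath {d : ℕ} (T : ℝ≥0) (x y : E d) (w : C(ℝ≥0, E d)) : C(ℝ≥0, E d) where
  toFun s := x + (w s - w 0) - ((s : ℝ) / (T : ℝ)) • (x + (w T - w 0) - y)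
  continuous_toFun := by fun_prop

/-- The law `P_x` of the random walk `(X_n)_{n ≥ 0}` started at `x` with independent centred
Gaussian steps with covariance matrix `2 β Id`. -/
noncomputable def walkLaw {d : ℕ} (β : ℝ≥0) (x : E d) : Measure (ℕ → E d) :=
  (Measure.infinitePi fun _ : ℕ => gaussianStep d β).map
    fun ξ n => x + ∑ i ∈ Finset.range n, ξ i

/-- The event that the walk is never in `W` at a time `n ≥ 1`. -/
def neverReturns {d : ℕ} (W : Set (E d)) : Set (ℕ → E d) := {X | ∀ n, 1 ≤ n → X n ∉ W}

/-- The density `e_W` of the equilibrium measure of the walk on `W`. -/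
noncomputable def equilibriumDensity {d : ℕ} (β : ℝ≥0) (W : Set (E d)) (x : E d) : ℝ≥0∞ :=
  W.indicator (fun x => walkLaw β x (neverReturns W)) x

/-- Glue two one-sided sequences (backward and forward) to a two-sided one. -/
def glue {d : ℕ} (p : (ℕ → E d) × (ℕ → E d)) : ℤ → E d :=
  fun n => if 0 ≤ n then p.2 n.toNat else p.1 (-n).toNat

/-- The measure `Q_W` on two-sided trajectories: `X_0` has density `e_W`, and given `X_0 = x` the
backward part is a walk from `x` conditioned on never returning to `W`, independent of the forward
part, which is a walk from `x`. -/
noncomputable def Q {d : ℕ} (β : ℝ≥0) (W : Set (E d)) : Measure (ℤ → E d) :=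
  (volume.withDensity (equilibriumDensity β W)).bind fun x =>
    (((walkLaw β x)[|neverReturns W]).prod (walkLaw β x)).map glue

/-! ### Trajectories modulo time shift and the intensity measure -/

/-- Two-sided sequences are identified if they are time shifts of each other. -/
def trajSetoid (d : ℕ) : Setoid (ℤ → E d) where
  r X Y := ∃ m : ℤ, ∀ n, Y n = X (n + m)
  iseqv := ⟨fun _ => ⟨0, by simp⟩,
    fun ⟨m, h⟩ => ⟨-m, fun n => by rw [h]; simp⟩,
    fun ⟨m, h⟩ ⟨m', h'⟩ => ⟨m' + m, fun n => by rw [h', h, add_assoc]⟩⟩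

/-- Two-sided trajectories modulo time shift (with the quotient `σ`-algebra). -/
abbrev Traj (d : ℕ) : Type := Quotient (trajSetoid d)

/-- The trajectories modulo time shift that visit `W`. -/
def visiting {d : ℕ} (W : Set (E d)) : Set (Traj d) :=
  (Quotient.mk (trajSetoid d)) '' {X | ∃ n, X n ∈ W}

/-- The intensity measure `Υ` of the Gaussian interlacements: on the trajectories that visit the
cube `[-(n+1), n+1]^d` but none of the smaller cubes of this form it is the image of `Q_W` for the
cube `W = [-(n+1), n+1]^d` under the projection modulo time shift. By the consistency of these
images it is the unique `σ`-finite measure whose restriction to the trajectories visiting `W` is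
the image of `Q_W`, for every box `W`. -/
noncomputable def Upsilon (d : ℕ) (β : ℝ≥0) : Measure (Traj d) :=
  Measure.sum fun n : ℕ =>
    ((Q β (box d (n + 1))).map (Quotient.mk (trajSetoid d))).restrict
      (disjointed (fun k : ℕ => visiting (box d (k + 1))) n)

/-! ### Interpolation by independent Brownian bridges -/

lemma locallyFinite_legs {b : ℝ} (hb : 0 < b) :
    LocallyFinite fun n : ℤ => Icc ((n : ℝ) * b) (((n : ℝ) + 1) * b) := by
  intro t
  refine ⟨Ioo (t - b) (t + b), Ioo_mem_nhds (by linarith) (by linarith), ?_⟩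
  refine (Set.finite_Icc (⌊t / b⌋ - 2) (⌊t / b⌋ + 2)).subset ?_
  rintro n ⟨s, ⟨h1, h2⟩, h3, h4⟩
  have e1 : t < (⌊t / b⌋ + 1) * b := by
    rw [← div_lt_iff₀ hb]; exact Int.lt_floor_add_one _
  have e2 : ⌊t / b⌋ * b ≤ t := by
    rw [← le_div_iff₀ hb]; exact Int.floor_le _
  constructor
  · have : ((⌊t / b⌋ : ℝ) - 2) * b < (n : ℝ) * b := by nlinarith
    have := lt_of_mul_lt_mul_right this hb.le
    exact_mod_cast this.le
  · have : (n : ℝ) * b < ((⌊t / b⌋ : ℝ) + 2) * b := by nlinarith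
    have := lt_of_mul_lt_mul_right this hb.le
    exact_mod_cast this.le

/-- The two-sided path that is at `X n` at time `n β` and that follows, on the time interval
`[n β, (n+1) β]`, the bridge from `X n` to `X (n+1)` built from the path `w n`. -/
noncomputable def interpolateFun {d : ℕ} (β : ℝ≥0) (X : ℤ → E d) (w : ℤ → C(ℝ≥0, E d)) (t : ℝ) :
    E d :=
  bridgePath β (X ⌊t / β⌋) (X (⌊t / β⌋ + 1)) (w ⌊t / β⌋) (t - ⌊t / β⌋ * β).toNNReal

lemma continuous_interpolateFun {d : ℕ} (β : ℝ≥0) (X : ℤ → E d) (w : ℤ → C(ℝ≥0, E d)) :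
    Continuous (interpolateFun β X w) := by
  rcases eq_or_ne β 0 with rfl | hβ
  · have : interpolateFun 0 X w = fun t : ℝ => bridgePath 0 (X 0) (X 1) (w 0) t.toNNReal := by
      funext t; simp [interpolateFun]
    rw [this]
    exact (map_continuous _).comp continuous_real_toNNReal
  have hb : (0 : ℝ) < β := by positivity
  refine (locallyFinite_legs hb).continuous ?_ (fun _ => isClosed_Icc) ?_
  · refine eq_univ_of_forall fun t => mem_iUnion.2 ⟨⌊t / β⌋, ?_, ?_⟩
    · rw [← le_div_iff₀ hb]; exact Int.floor_le _
    · rw [← div_le_iff₀ hb]; exact (Int.lt_floor_add_one _).le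
  · intro n
    have hc : Continuous fun t : ℝ =>
        bridgePath β (X n) (X (n + 1)) (w n) (t - n * β).toNNReal :=
      (map_continuous _).comp (continuous_real_toNNReal.comp (by fun_prop))
    refine hc.continuousOn.congr ?_
    rintro t ⟨h1, h2⟩
    rcases h2.lt_or_eq with h2 | h2
    · have : ⌊t / (β : ℝ)⌋ = n := by
        rw [Int.floor_eq_iff]
        exact ⟨by rwa [le_div_iff₀ hb], by rwa [div_lt_iff₀ hb]⟩
      simp only [interpolateFun, this]
    · have : ⌊t / (β : ℝ)⌋ = n + 1 := by
        rw [Int.floor_eq_iff, h2, mul_div_assoc, div_self hb.ne']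
        push_cast
        constructor <;> linarith
      have e : ((n : ℝ) + 1) * β - n * β = β := by ring
      simp only [interpolateFun, this]
      rw [h2, e]
      simp [bridgePath, hb.ne']

/-- `interpolateFun` as a continuous path. -/
noncomputable def interpolate {d : ℕ} (β : ℝ≥0) (X : ℤ → E d) (w : ℤ → C(ℝ≥0, E d)) :
    C(ℝ, E d) :=
  ⟨interpolateFun β X w, continuous_interpolateFun β X w⟩

/-- Two-sided continuous paths are identified if they are time shifts of each other by an integer
multiple of `β`. -/
def pathSetoid (d : ℕ) (β : ℝ≥0) : Setoid C(ℝ, E d) where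
  r f g := ∃ m : ℤ, ∀ t, g t = f (t + m * β)
  iseqv := ⟨fun _ => ⟨0, by simp⟩,
    fun ⟨m, h⟩ => ⟨-m, fun t => by rw [h]; simp⟩,
    fun ⟨m, h⟩ ⟨m', h'⟩ => ⟨m' + m, fun t => by rw [h', h]; push_cast; ring_nf⟩⟩

/-- The space of interlacements: two-sided continuous paths modulo time shifts in `β ℤ`. -/
abbrev Interlacement (d : ℕ) (β : ℝ≥0) : Type := Quotient (pathSetoid d β)

/-- The marking kernel: interpolate a trajectory by independent Brownian bridges. The law of the
resulting interlacement does not depend on the representative of the trajectory. -/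
noncomputable def bridgeKernel {d : ℕ} (P₀ : Measure C(ℝ≥0, E d)) (β : ℝ≥0) (X : Traj d) :
    Measure (Interlacement d β) :=
  (Measure.infinitePi fun _ : ℤ => P₀).map
    fun w => Quotient.mk (pathSetoid d β) (interpolate β X.out w)

/-- The intensity measure of the Brownian interlacements (for density parameter `1`): the law of
the interpolated trajectories under `Υ`. -/
noncomputable def pathIntensity {d : ℕ} (P₀ : Measure C(ℝ≥0, E d)) (β : ℝ≥0) :
    Measure (Interlacement d β) :=
  (Upsilon d β).bind (bridgeKernel P₀ β)

/-- The number of particles (positions at times in `β ℤ`) that an interlacement has in `W`. -/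
noncomputable def particleCount {d : ℕ} {β : ℝ≥0} (W : Set (E d)) : Interlacement d β → ℝ≥0∞ :=
  Quotient.lift (fun g : C(ℝ, E d) => ∑' k : ℤ, W.indicator (fun _ => (1 : ℝ≥0∞)) (g (k * β))) (by
    rintro f g ⟨m, h⟩
    rw [← (Equiv.addRight m).tsum_eq]
    refine tsum_congr fun k => ?_
    rw [h, ← add_mul, ← Int.cast_add]
    rfl)

/-! ### Poisson point processes -/

/-- `ℛ` is the law of a Poisson point process with (`σ`-finite) intensity measure `Λ`: a random
countable sum of Dirac measures, whose numbers of points in pairwise disjoint sets are independent,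
the number of points in a set of finite intensity being Poisson distributed. -/
structure IsPoissonPointProcess {X : Type*} [MeasurableSpace X] (ℛ : Measure (Measure X))
    (Λ : Measure X) : Prop where
  isProbabilityMeasure : IsProbabilityMeasure ℛ
  points : ∀ᵐ η ∂ℛ, ∃ (I : Set ℕ) (g : I → X), η = Measure.sum fun i => Measure.dirac (g i)
  poisson : ∀ B : Set X, MeasurableSet B → Λ B ≠ ∞ →
    ℛ.map (fun η => η B) = (poissonMeasure (Λ B).toNNReal).map (fun n : ℕ => (n : ℝ≥0∞))
  indep : ∀ (n : ℕ) (B : Fin n → Set X), (∀ i, MeasurableSet (B i)) →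
    Pairwise (fun i j => Disjoint (B i) (B j)) → iIndepFun (fun i η => η (B i)) ℛ

/-- `ℛ` is the law of the Brownian interlacement Poisson point process with spacing `β` and particle
density `u`: the Poisson point process on the interlacements whose intensity is the multiple of
`pathIntensity` for which the expected number of particles in `[-1/2, 1/2]^d` is `u`. -/
structure IsBrownianInterlacementLaw {d : ℕ} (P₀ : Measure C(ℝ≥0, E d)) (β : ℝ≥0) (u : ℝ≥0)
    (ℛ : Measure (Measure (Interlacement d β))) : Prop where
  poisson : ∃ v : ℝ≥0, IsPoissonPointProcess ℛ (v • pathIntensity P₀ β)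
  density : ∫⁻ ϖ, ∫⁻ g, particleCount (box d (1 / 2)) g ∂ϖ ∂ℛ = u

/-! ### Shreds -/

/-- Finite paths: a number `l` of legs together with a continuous path `[0, l β] → ℝ^d`. -/
abbrev FinPath (d : ℕ) (β : ℝ≥0) : Type := Σ l : ℕ, C(Icc (0 : ℝ≥0) (l * β), E d)

/-- The piece with `l` legs of a two-sided path that starts at time `k β`. -/
noncomputable def piece {d : ℕ} (β : ℝ≥0) (g : C(ℝ, E d)) (k : ℤ) (l : ℕ) : FinPath d β :=
  ⟨l, ⟨fun s => g (k * β + ((s : ℝ≥0) : ℝ)), by fun_prop⟩⟩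

/-- The piece of `g` with `l` legs that starts at time `k β` is a `W`-shred: its `l` particles
before its end are in `W`, and it is maximal, i.e. the particle of `g` before it and its final site
are outside `W`. -/
def IsShred {d : ℕ} (β : ℝ≥0) (W : Set (E d)) (g : C(ℝ, E d)) (p : ℤ × ℕ) : Prop :=
  1 ≤ p.2 ∧ g ((p.1 - 1 : ℤ) * β) ∉ W ∧ (∀ j : ℕ, j < p.2 → g ((p.1 + j : ℤ) * β) ∈ W) ∧
    g ((p.1 + p.2 : ℤ) * β) ∉ W

open Classical in
/-- The point measure of all `W`-shreds of an interlacement. -/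
noncomputable def shredsOf {d : ℕ} {β : ℝ≥0} (W : Set (E d)) :
    Interlacement d β → Measure (FinPath d β) :=
  Quotient.lift (fun g : C(ℝ, E d) => Measure.sum fun p : ℤ × ℕ =>
    if IsShred β W g p then Measure.dirac (piece β g p.1 p.2) else 0) (by
    rintro f g ⟨m, h⟩
    rw [← Measure.sum_comp_equiv ((Equiv.addRight m).prodCongr (Equiv.refl ℕ))]
    congr 1
    funext p
    have e : ∀ k : ℤ, g (k * β) = f ((k + m : ℤ) * β) := fun k => by
      rw [h]; push_cast; ring_nf
    have hs : IsShred β W g p ↔ IsShred β W f (p.1 + m, p.2) := by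
      simp only [IsShred, e]
      rw [show p.1 - 1 + m = p.1 + m - 1 by ring, show p.1 + (p.2 : ℤ) + m = p.1 + m + p.2 by ring]
      simp only [show ∀ j : ℕ, p.1 + (j : ℤ) + m = p.1 + m + j from fun j => by ring]
    have hp : piece β g p.1 p.2 = piece β f (p.1 + m) p.2 := by
      unfold piece
      congr 1
      ext1 s
      simp only [ContinuousMap.coe_mk, h]
      push_cast
      ring_nf
    simp only [Function.comp, Equiv.prodCongr_apply, Prod.map, Equiv.coe_addRight,
      Equiv.refl_apply, hs, hp])

/-- The shredding operator `Π_W`: the superposition of the `W`-shreds of all the points of an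
interlacement point measure. -/
noncomputable def shredding {d : ℕ} {β : ℝ≥0} (W : Set (E d))
    (ϖ : Measure (Interlacement d β)) : Measure (FinPath d β) :=
  ϖ.bind (shredsOf W)

/-- Initial site, number of legs, and terminal site of a finite path. -/
noncomputable def endpoints {d : ℕ} {β : ℝ≥0} (f : FinPath d β) : E d × ℕ × E d :=
  (f.2 ⟨0, by simp⟩, f.1, f.2 ⟨f.1 * β, by simp⟩)

/-- The boundary-shred operator `∂Π_W`: the point measure of the initial sites, lengths and terminal
sites of the `W`-shreds. -/
noncomputable def boundaryShredding {d : ℕ} {β : ℝ≥0} (W : Set (E d))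
    (ϖ : Measure (Interlacement d β)) : Measure (E d × ℕ × E d) :=
  (shredding W ϖ).map endpoints

/-- The set `W × ℕ × Wᶜ` of possible boundary data of a `W`-shred (with `ℕ = {1, 2, ...}`). -/
def boundaryData {d : ℕ} (W : Set (E d)) : Set (E d × ℕ × E d) :=
  {t | t.1 ∈ W ∧ 1 ≤ t.2.1 ∧ t.2.2 ∉ W}

/-! ### The Brownian shred kernel -/

/-- The law `q_{x,y}^{(W,l)}` of a Brownian `W`-shred with boundary data `t = (x, l, y)`: Brownian
motion on `[0, l β]` started at `x`, conditioned on being at `y` at time `l β` (Brownian bridge) and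
on being in `W` at the times `β, 2 β, ..., (l - 1) β`. -/
noncomputable def shredLaw {d : ℕ} (P₀ : Measure C(ℝ≥0, E d)) (β : ℝ≥0) (W : Set (E d))
    (t : E d × ℕ × E d) : Measure (FinPath d β) :=
  (P₀[|{w | ∀ j : ℕ, 1 ≤ j → j < t.2.1 → bridgePath (t.2.1 * β) t.1 t.2.2 w (j * β) ∈ W}]).map
    fun w => ⟨t.2.1, (bridgePath (t.2.1 * β) t.1 t.2.2 w).restrict (Icc 0 (t.2.1 * β))⟩

/-- The measure `K_W(μ, ·)` for `μ = ∑ i, δ_{t i}`, where `t i = (x_i, l_i, y_i)`: the law of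
`∑ i, δ_{g i}`, where the `g i` are independent Brownian `W`-shreds with boundary data `t i`. -/
noncomputable def shredKernel {d : ℕ} (P₀ : Measure C(ℝ≥0, E d)) (β : ℝ≥0) (W : Set (E d))
    {n : ℕ} (t : Fin n → E d × ℕ × E d) : Measure (Measure (FinPath d β)) :=
  (Measure.pi fun i => shredLaw P₀ β W (t i)).map fun g => ∑ i, Measure.dirac (g i)

end BrownianShreds

/-! A Laplace functional argument reduces the claim to a Markov property of a single interpolated
walk. The law of a random measure `ν` is determined by the expectations of `exp(-∫ f dν)`
(`ext_of_laplace`). Under `K_W(μ, ·)` this expectation is a product over the points `t` of `μ`,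
namely `exp(-∫ f̃ dμ)` with `f̃ t = -log ∫ exp(-f) dq_t` (`resample`). So the law of the shreds is
the mixture of `K_W` over the boundary data as soon as replacing `f` by `f̃ ∘ endpoints` leaves the
Laplace functional of the shreds unchanged (`laplace_shredding`). The joint law follows, because the
boundary data are a function of the shreds and `K_W` preserves them almost surely.

For a Poisson process with intensity `Λ` the Laplace functional is `exp(-∫ (1 - exp(-S)) dΛ)`, where
`S g` sums `f` over the shreds of `g` (`IsPoissonPointProcess.laplace`), so only the intensity
measure matters. Let `V` be a cube that contains `W`. Every `Q_V` is the restriction of one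
stationary measure, the two-sided walk started from Lebesgue measure, to the event that `V` is first
visited at time `0` (`Q_eq_restrict`); stationarity makes the descriptions for different cubes agree
(`setLIntegral_firstVisit_congr`). With time counted from the first visit to `V`, all `W`-shreds lie
in the future, and the past enters only through the probability of never returning to `V`. What
remains is `E_x exp(-S)` for a one-sided interpolated walk (`lintegral_pathIntensity_forward`).

This quantity is invariant under `f ↦ f̃ ∘ endpoints` (`shredLaplace_resample`), by induction on a
time horizon and splitting at the first exit from `W`. The first shred interacts with the rest only
through its terminal site. Given its length and endpoints it has law `q`: a chain of bridges with
independent Gaussian increments has the covariance of Brownian motion, hence is one long bridge with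
a Gaussian endpoint (`IsBrownianLaw.map_concatLegs`), and the only further information is that the
inner grid points are in `W`.

Dimension at least three gives transience (`walkLaw_transient`): a first visit to `V` exists, and
almost every interlacement has finitely many shreds. The interlacements that meet `V` have finite
intensity, so the boundary data are almost surely finite. The positive volume of `W` keeps the
conditioning in `q` non-degenerate (`bridgeStays_ne_zero`), and a measurable enumeration of the
points of a measure turns `K_W` into a kernel on all measures (`superpositionKernel`). -/

namespace BrownianShreds

/-! ### The exponential `x ↦ e^{-x}` on `[0, ∞]` -/

/-- The function `x ↦ e^{-x}` on `[0, ∞]`. -/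
noncomputable def expNeg (x : ℝ≥0∞) : ℝ≥0∞ := EReal.exp (-(x : EReal))

/-- The inverse `p ↦ -log p` of `expNeg`, truncated to `[0, ∞]`. -/
noncomputable def negLog (p : ℝ≥0∞) : ℝ≥0∞ := (-(ENNReal.log p)).toENNReal

@[simp] lemma expNeg_zero : expNeg 0 = 1 := by simp [expNeg]

lemma expNeg_add (x y : ℝ≥0∞) : expNeg (x + y) = expNeg x * expNeg y := by
  rw [expNeg, EReal.coe_ennreal_add, EReal.neg_add (by simp) (by simp), sub_eq_add_neg,
    EReal.exp_add]
  rfl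

lemma expNeg_le_one (x : ℝ≥0∞) : expNeg x ≤ 1 := by
  simp [expNeg, EReal.coe_ennreal_nonneg]

lemma expNeg_ne_top (x : ℝ≥0∞) : expNeg x ≠ ∞ := ne_top_of_le_ne_top ENNReal.one_ne_top (expNeg_le_one x)

lemma continuous_expNeg : Continuous expNeg :=
  ENNReal.continuous_exp.comp (continuous_neg.comp continuous_coe_ennreal_ereal)

lemma measurable_expNeg : Measurable expNeg := continuous_expNeg.measurable

lemma expNeg_antitone : Antitone expNeg := fun x y h => by
  simpa [expNeg] using h

lemma measurable_negLog : Measurable negLog :=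
  measurable_ereal_toENNReal.comp (ENNReal.measurable_log.neg)

lemma negLog_expNeg (x : ℝ≥0∞) : negLog (expNeg x) = x := by simp [negLog, expNeg]

lemma expNeg_negLog {p : ℝ≥0∞} (hp : p ≤ 1) : expNeg (negLog p) = p := by
  have : ENNReal.log p ≤ 0 := by rw [← ENNReal.log_one]; exact ENNReal.log_monotone hp
  rw [expNeg, negLog, EReal.coe_toENNReal (by simpa using this)]
  simp

lemma expNeg_sum {ι : Type*} (s : Finset ι) (f : ι → ℝ≥0∞) :
    expNeg (∑ i ∈ s, f i) = ∏ i ∈ s, expNeg (f i) := by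
  classical
  induction s using Finset.induction_on with
  | empty => simp
  | insert a s ha ih => rw [Finset.sum_insert ha, Finset.prod_insert ha, expNeg_add, ih]

lemma expNeg_nat_mul (n : ℕ) (x : ℝ≥0∞) : expNeg (n * x) = expNeg x ^ n := by
  rw [← nsmul_eq_mul, ← Finset.card_range n, ← Finset.sum_const, expNeg_sum, Finset.prod_const]

lemma expNeg_ofReal {r : ℝ} (hr : 0 ≤ r) :
    expNeg (ENNReal.ofReal r) = ENNReal.ofReal (Real.exp (-r)) := by
  rw [expNeg, EReal.coe_ennreal_ofReal, max_eq_left hr, ← EReal.coe_neg, EReal.exp_coe]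

/-! ### Laplace functionals determine the law of a random measure -/

section Laplace

variable {α : Type*} [MeasurableSpace α]

/-- Two finite measures on a finite-dimensional cube with the same moments agree. -/
lemma ext_of_moments {ι : Type*} [Fintype ι] (P P' : Measure (ι → unitInterval))
    [IsFiniteMeasure P] [IsFiniteMeasure P']
    (h : ∀ u : ι → ℕ, ∫ x, ∏ i, (x i : ℝ) ^ u i ∂P = ∫ x, ∏ i, (x i : ℝ) ^ u i ∂P') : P = P' := by
  let X : ι → BoundedContinuousFunction (ι → unitInterval) ℝ := fun i =>
    BoundedContinuousFunction.mkOfCompact ⟨fun x => (x i : ℝ), by fun_prop⟩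
  -- The polynomials in the coordinates separate the points of the cube, so their integrals
  -- determine a finite measure; by linearity monomials suffice. The star operation is trivial over
  -- `ℝ`.
  let A : StarSubalgebra ℝ (BoundedContinuousFunction (ι → unitInterval) ℝ) :=
    { (MvPolynomial.aeval (R := ℝ) X).range with
      star_mem' := fun {a} ha => by
        have : star a = a := by ext; simp
        rwa [this] }
  refine ext_of_forall_mem_subalgebra_integral_eq_of_polish (A := A) ?_ ?_
  · intro x y hxy
    obtain ⟨i, hi⟩ := Function.ne_iff.1 hxy
    refine ⟨_, ⟨_, ⟨X i, ⟨MvPolynomial.X i, by simp⟩, rfl⟩, rfl⟩, ?_⟩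
    change ((x i : unitInterval) : ℝ) ≠ y i
    simpa [Subtype.ext_iff] using hi
  · rintro g ⟨p, rfl⟩
    induction p using MvPolynomial.induction_on' with
    | monomial u a =>
      have key : ∀ x : ι → unitInterval,
          (MvPolynomial.aeval X (MvPolynomial.monomial u a)) x = a * ∏ i, (x i : ℝ) ^ u i := by
        intro x
        rw [MvPolynomial.aeval_monomial, Finsupp.prod_fintype _ _ (by simp)]
        simp only [BoundedContinuousFunction.coe_mul, Pi.mul_apply]
        congr 1
        have := map_prod (BoundedContinuousFunction.toContinuousMapₐ ℝ (α := ι → unitInterval) (γ := ℝ)) (fun i => X i ^ u i) Finset.univ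
        have := congrArg (fun f => f x) this
        simp only [ContinuousMap.prod_apply] at this
        exact this
      simp only [RingHom.coe_coe, AlgHom.toRingHom_eq_coe]
      simp only [key, integral_const_mul, h]
    | add p q hp hq =>
      simp only [RingHom.coe_coe, AlgHom.toRingHom_eq_coe, map_add, BoundedContinuousFunction.coe_add,
        Pi.add_apply] at *
      rw [integral_add (BoundedContinuousFunction.integrable _ _)
        (BoundedContinuousFunction.integrable _ _),
        integral_add (BoundedContinuousFunction.integrable _ _)
        (BoundedContinuousFunction.integrable _ _), hp, hq]

/-- The transforms `e^{-ν B}` of the values of a measure on the measurable sets. -/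
noncomputable def expValues (ν : Measure α) (s : {s : Set α // MeasurableSet s}) : unitInterval :=
  ⟨(expNeg (ν s)).toReal, ENNReal.toReal_nonneg,
    ENNReal.toReal_mono ENNReal.one_ne_top (expNeg_le_one _)⟩

lemma measurable_expValues : Measurable (expValues (α := α)) := by
  refine measurable_pi_iff.2 fun s => Measurable.subtype_mk ?_
  exact (measurable_expNeg.comp (Measure.measurable_coe s.2)).ennreal_toReal

/-- The `σ`-algebra on measures is generated by the evaluations, and `negLog` recovers each
evaluation from its transform, also where the value is `∞`. Hence the embedding into a product of
unit intervals loses no measurable set. -/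
lemma comap_expValues_ge :
    (Measure.instMeasurableSpace : MeasurableSpace (Measure α)) ≤
      MeasurableSpace.comap (expValues (α := α)) MeasurableSpace.pi := by
  refine iSup₂_le fun s hs => ?_
  rw [← measurable_iff_comap_le]
  have : (fun μ : Measure α => μ s) =
      (fun r : unitInterval => negLog (ENNReal.ofReal r)) ∘ (fun x => x ⟨s, hs⟩) ∘ expValues := by
    funext μ
    simp [expValues, ENNReal.ofReal_toReal (expNeg_ne_top _), negLog_expNeg]
  rw [this]
  change @Measurable _ _ (MeasurableSpace.comap _ _) ENNReal.measurableSpace _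
  exact (measurable_negLog.comp (ENNReal.measurable_ofReal.comp measurable_subtype_coe)).comp
    ((measurable_pi_apply _).comp (comap_measurable _))

/-- Finite measures on the space of measures with the same Laplace functional agree. -/
theorem ext_of_laplace (ρ₁ ρ₂ : Measure (Measure α)) [IsFiniteMeasure ρ₁] [IsFiniteMeasure ρ₂]
    (h : ∀ f : α → ℝ≥0∞, Measurable f →
      ∫⁻ ν, expNeg (∫⁻ a, f a ∂ν) ∂ρ₁ = ∫⁻ ν, expNeg (∫⁻ a, f a ∂ν) ∂ρ₂) : ρ₁ = ρ₂ := by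
  have hmap : ρ₁.map expValues = ρ₂.map expValues := by
    -- The index set of the product is uncountable in general; equality is checked on
    -- finite-dimensional marginals.
    refine IsProjectiveLimit.unique
      (P := fun I => (ρ₁.map expValues).map I.restrict) (fun I => rfl) fun I => ?_
    refine (ext_of_moments _ _ fun u => ?_).symm
    have hc : Measurable fun x : I → unitInterval => ∏ i, (x i : ℝ) ^ u i := by fun_prop
    rw [integral_map (by fun_prop) hc.aestronglyMeasurable,
      integral_map (by fun_prop) hc.aestronglyMeasurable,
      integral_map measurable_expValues.aemeasurable (by fun_prop),
      integral_map measurable_expValues.aemeasurable (by fun_prop)]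
    -- A mixed moment of the transforms `exp(-ν s_i)` with exponents `u_i` is a value of the Laplace
    -- functional, at the step function `∑ u_i 1_{s_i}`.
    have key : ∀ ν : Measure α, (∏ i, ((I.restrict (expValues ν)) i : ℝ) ^ u i) =
        (expNeg (∫⁻ a, ∑ i, (u i : ℝ≥0∞) * (i.1.1).indicator 1 a ∂ν)).toReal := by
      intro ν
      rw [lintegral_finsetSum _ (fun i _ => (measurable_one.indicator i.1.2).const_mul _),
        expNeg_sum, ENNReal.toReal_prod]
      refine Finset.prod_congr rfl fun i _ => ?_
      rw [lintegral_const_mul _ (measurable_one.indicator i.1.2), lintegral_indicator_one i.1.2,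
        expNeg_nat_mul, ENNReal.toReal_pow]
      rfl
    have hf : Measurable fun a : α => ∑ i, (u i : ℝ≥0∞) * (i.1.1).indicator 1 a :=
      Finset.measurable_sum _ fun i _ => (measurable_one.indicator i.1.2).const_mul _
    have hm := measurable_expNeg.comp (Measure.measurable_lintegral hf)
    simp only [key]
    refine (integral_toReal hm.aemeasurable (ae_of_all _ fun _ => (expNeg_ne_top _).lt_top)).trans
      (Eq.trans (congrArg _ (h _ hf)) (integral_toReal hm.aemeasurable
        (ae_of_all _ fun _ => (expNeg_ne_top _).lt_top)).symm)
  ext s hs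
  obtain ⟨t, ht, rfl⟩ := comap_expValues_ge s hs
  rw [← Measure.map_apply measurable_expValues ht, hmap, Measure.map_apply measurable_expValues ht]

end Laplace

/-! ### The Laplace functional of a Poisson point process -/

/-- The generating function of the Poisson law at `q = exp(-c)`, that is `exp(-r) ∑ (r q)^n / n! =
exp(-r (1 - q))`. The case `c = ∞` is the point `q = 0`. -/
lemma lintegral_expNeg_poissonMeasure (r : ℝ≥0) (c : ℝ≥0∞) :
    ∫⁻ n : ℕ, expNeg (c * n) ∂(poissonMeasure r) = expNeg ((1 - expNeg c) * r) := by
  set q := (expNeg c).toReal with hq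
  have hq0 : 0 ≤ q := ENNReal.toReal_nonneg
  have hq1 : q ≤ 1 := ENNReal.toReal_mono ENNReal.one_ne_top (expNeg_le_one _)
  have hqe : expNeg c = ENNReal.ofReal q := (ENNReal.ofReal_toReal (expNeg_ne_top _)).symm
  have hs : HasSum (fun n : ℕ => Real.exp (-r) * r ^ n / n.factorial * q ^ n)
      (Real.exp (-(r * (1 - q)))) := by
    have := (NormedSpace.expSeries_div_hasSum_exp (𝔸 := ℝ) (r * q)).mul_left (Real.exp (-r))
    rw [← Real.exp_eq_exp_ℝ, ← Real.exp_add] at this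
    have e : -(r : ℝ) + r * q = -(r * (1 - q)) := by ring
    rw [e] at this
    refine this.congr_fun fun n => ?_
    rw [mul_pow]; ring
  rw [poissonMeasure, lintegral_sum_measure]
  simp only [lintegral_smul_measure, lintegral_dirac, smul_eq_mul]
  have e : ∀ n : ℕ, ENNReal.ofReal (Real.exp (-r) * r ^ n / n.factorial) * expNeg (c * n) =
      ENNReal.ofReal (Real.exp (-r) * r ^ n / n.factorial * q ^ n) := by
    intro n
    rw [mul_comm c, expNeg_nat_mul, hqe, ENNReal.ofReal_mul (by positivity), ENNReal.ofReal_pow hq0]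
  simp only [e]
  rw [← ENNReal.ofReal_tsum_of_nonneg (fun n => by positivity) hs.summable, hs.tsum_eq,
    ← expNeg_ofReal (mul_nonneg r.coe_nonneg (by linarith)), hqe, ← ENNReal.ofReal_one,
    ← ENNReal.ofReal_sub _ hq0, ENNReal.ofReal_mul r.coe_nonneg, mul_comm, ENNReal.ofReal_coe_nnreal]

section PPP

variable {X : Type*} [MeasurableSpace X] {ℛ : Measure (Measure X)} {Λ : Measure X}

/-- The fibres of `F` are disjoint, so the numbers of points in them are independent Poisson
variables and the expectation factorises. -/
lemma IsPoissonPointProcess.laplace_simpleFunc (h : IsPoissonPointProcess ℛ Λ)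
    (F : SimpleFunc X ℝ≥0∞) (hF : ∀ c ≠ 0, Λ (F ⁻¹' {c}) ≠ ∞) :
    ∫⁻ η, expNeg (∫⁻ g, F g ∂η) ∂ℛ = expNeg (∫⁻ g, (1 - expNeg (F g)) ∂Λ) := by
  have := h.isProbabilityMeasure
  let n := F.range.card
  let c : Fin n → ℝ≥0∞ := fun i => (F.range.equivFin.symm i : ℝ≥0∞)
  have hcinj : Function.Injective c := fun i j hij => by
    simpa [c, Subtype.ext_iff.symm] using hij
  have hsum : ∀ φ : ℝ≥0∞ → ℝ≥0∞, ∑ x ∈ F.range, φ x = ∑ i, φ (c i) := fun φ => by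
    rw [← Finset.sum_coe_sort, ← F.range.equivFin.symm.sum_comp]
  let B : Fin n → Set X := fun i => F ⁻¹' {c i}
  have hB : ∀ i, MeasurableSet (B i) := fun i => F.measurableSet_fiber _
  have hd : Pairwise fun i j => Disjoint (B i) (B j) := fun i j hij =>
    Disjoint.preimage _ (by simpa using hcinj.ne hij)
  have hi := h.indep n B hB hd
  have h1 : ∀ η : Measure X, expNeg (∫⁻ g, F g ∂η) = ∏ i, expNeg (c i * η (B i)) := by
    intro η
    rw [SimpleFunc.lintegral_eq_lintegral, SimpleFunc.lintegral,
      hsum fun x => x * η (F ⁻¹' {x}), expNeg_sum]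
  have hm : ∀ i, Measurable fun x : ℝ≥0∞ => expNeg (c i * x) := fun i =>
    measurable_expNeg.comp (measurable_const_mul _)
  have h2 : ∀ i, ∫⁻ η, expNeg (c i * η (B i)) ∂ℛ = expNeg ((1 - expNeg (c i)) * Λ (B i)) := by
    intro i
    -- The fibre of the value `0` may have infinite intensity, where no Poisson law is prescribed;
    -- it contributes the factor `1` on both sides.
    rcases eq_or_ne (c i) 0 with h0 | h0
    · simp [h0]
    have hfin := hF _ h0
    have e := h.poisson (B i) (hB i) hfin
    rw [← lintegral_map (μ := ℛ) (f := fun x => expNeg (c i * x)) (hm i)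
      (Measure.measurable_coe (hB i)), e, lintegral_map (hm i) (measurable_of_countable _),
      lintegral_expNeg_poissonMeasure, ENNReal.coe_toNNReal hfin]
  simp only [h1]
  have hi' := hi.comp (fun i x => expNeg (c i * x)) hm
  have := lintegral_prod_eq_prod_lintegral_of_indepFun Finset.univ _ hi'
    fun i => (hm i).comp (Measure.measurable_coe (hB i))
  simp only [Function.comp] at this
  rw [this]
  simp only [h2]
  rw [← expNeg_sum]
  congr 1
  have e : (fun g => 1 - expNeg (F g)) = F.map (fun x => 1 - expNeg x) := rfl
  rw [e, SimpleFunc.lintegral_eq_lintegral, SimpleFunc.map_lintegral,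
    hsum fun x => (1 - expNeg x) * Λ (F ⁻¹' {x})]

/-- The Laplace functional of a Poisson point process, for functions that vanish outside of a set
of finite intensity. -/
theorem IsPoissonPointProcess.laplace (h : IsPoissonPointProcess ℛ Λ) {F : X → ℝ≥0∞}
    (hF : Measurable F) {B : Set X} (hBfin : Λ B ≠ ∞) (hFB : ∀ g ∉ B, F g = 0) :
    ∫⁻ η, expNeg (∫⁻ g, F g ∂η) ∂ℛ = expNeg (∫⁻ g, (1 - expNeg (F g)) ∂Λ) := by
  have := h.isProbabilityMeasure
  let S := fun n => SimpleFunc.eapprox F n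
  have hmono : Monotone fun n (g : X) => S n g := fun i j hij g => SimpleFunc.monotone_eapprox F hij g
  have hS : ∀ n, ∫⁻ η, expNeg (∫⁻ g, S n g ∂η) ∂ℛ = expNeg (∫⁻ g, (1 - expNeg (S n g)) ∂Λ) := by
    intro n
    -- The approximations lie below `F` and so vanish off `B`; their fibres over non-zero values are
    -- contained in `B`.
    refine h.laplace_simpleFunc _ fun c hc => ne_top_of_le_ne_top hBfin (measure_mono ?_)
    intro g hg
    by_contra hgB
    refine hc ?_
    rw [mem_preimage, mem_singleton_iff] at hg
    rw [← hg]
    refine le_antisymm ?_ bot_le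
    rw [← hFB g hgB, ← SimpleFunc.iSup_eapprox_apply hF]
    exact le_iSup (fun n => SimpleFunc.eapprox F n g) n
  have hlim : ∀ g, Tendsto (fun n => S n g) atTop (𝓝 (F g)) := fun g => by
    have := tendsto_atTop_iSup (fun i j hij => hmono hij g : Monotone fun n => S n g)
    rwa [SimpleFunc.iSup_eapprox_apply hF] at this
  have hlimint : ∀ η : Measure X, Tendsto (fun n => ∫⁻ g, S n g ∂η) atTop (𝓝 (∫⁻ g, F g ∂η)) :=
    fun η => lintegral_tendsto_of_tendsto_of_monotone (fun n => (S n).measurable.aemeasurable)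
      (ae_of_all _ fun g i j hij => hmono hij g) (ae_of_all _ hlim)
  have hleft : Tendsto (fun n => ∫⁻ η, expNeg (∫⁻ g, S n g ∂η) ∂ℛ) atTop
      (𝓝 (∫⁻ η, expNeg (∫⁻ g, F g ∂η) ∂ℛ)) :=
    tendsto_lintegral_of_dominated_convergence (fun _ => 1)
      (fun n => measurable_expNeg.comp (Measure.measurable_lintegral (S n).measurable))
      (fun n => ae_of_all _ fun η => expNeg_le_one _) (by simp)
      (ae_of_all _ fun η => (continuous_expNeg.tendsto _).comp (hlimint η))
  -- The intensity may be infinite, so here convergence is monotone, `1 - exp(-x)` being increasing;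
  -- on the left the integrands are bounded by `1` under a probability measure.
  have hright : Tendsto (fun n => ∫⁻ g, (1 - expNeg (S n g)) ∂Λ) atTop
      (𝓝 (∫⁻ g, (1 - expNeg (F g)) ∂Λ)) :=
    lintegral_tendsto_of_tendsto_of_monotone
      (fun n => (measurable_const.sub (measurable_expNeg.comp (S n).measurable)).aemeasurable)
      (ae_of_all _ fun g i j hij => tsub_le_tsub_left (expNeg_antitone (hmono hij g)) _)
      (ae_of_all _ fun g => ENNReal.Tendsto.sub tendsto_const_nhds
        ((continuous_expNeg.tendsto _).comp (hlim g)) (Or.inl ENNReal.one_ne_top))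
  simp only [hS] at hleft
  exact tendsto_nhds_unique hleft ((continuous_expNeg.tendsto _).comp hright)

end PPP

/-! ### The Gaussian step law -/

section GaussianStep

/-- For `bridgeStays_ne_zero`: a set of increments with positive Lebesgue measure must have positive
probability under a product of Gaussian laws. -/
lemma absolutelyContinuous_pi {α : Type*} [MeasurableSpace α] {μ ν : Measure α} [SigmaFinite μ]
    [SigmaFinite ν] (h : μ ≪ ν) (n : ℕ) :
    (Measure.pi fun _ : Fin n => μ) ≪ Measure.pi fun _ : Fin n => ν := by
  induction n with
  | zero => rw [Measure.pi_of_empty, Measure.pi_of_empty]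
  | succ n ih =>
    rw [← (measurePreserving_piFinSuccAbove (fun _ : Fin (n + 1) => μ) 0).symm.map_eq,
      ← (measurePreserving_piFinSuccAbove (fun _ : Fin (n + 1) => ν) 0).symm.map_eq]
    exact (h.prod ih).map (MeasurableEquiv.measurable _)

variable {d : ℕ}

instance (t : ℝ≥0) : IsGaussian (gaussianStep d t) := by
  unfold gaussianStep; infer_instance

lemma posSemidef_smul_one {ι : Type*} [Fintype ι] [DecidableEq ι] (t : ℝ≥0) :
    ((2 * (t : ℝ)) • (1 : Matrix ι ι ℝ)).PosSemidef :=
  Matrix.PosSemidef.one.smul (by positivity)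

lemma covarianceBilin_gaussianStep (t : ℝ≥0) (a b : E d) :
    covarianceBilin (gaussianStep d t) a b = 2 * t * inner ℝ a b := by
  rw [gaussianStep, covarianceBilin_multivariateGaussian (posSemidef_smul_one t),
    Matrix.smul_mulVec, Matrix.one_mulVec, dotProduct_smul, smul_eq_mul]
  congr 1
  simp [PiLp.inner_apply, dotProduct, mul_comm]

lemma integral_id_gaussianStep (t : ℝ≥0) : ∫ x, x ∂(gaussianStep d t) = 0 := by
  simp [gaussianStep]

lemma charFun_gaussianStep (t : ℝ≥0) (x : E d) :
    charFun (gaussianStep d t) x = Complex.exp (-((t * ‖x‖ ^ 2 : ℝ) : ℂ)) := by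
  rw [IsGaussian.charFun_eq', covarianceBilin_gaussianStep, real_inner_self_eq_norm_sq]
  simp only [id, integral_id_gaussianStep, inner_zero_right]
  congr 1
  push_cast
  ring

/-- The coordinates are independent one-dimensional Gaussians, by comparison of characteristic
functions. This reduces the comparison with Lebesgue measure and the bound on cubes to dimension
one. -/
lemma gaussianStep_eq_map_pi (t : ℝ≥0) :
    gaussianStep d t = (Measure.pi fun _ : Fin d => gaussianReal 0 (2 * t)).map (WithLp.toLp 2) := by
  apply Measure.ext_of_charFun
  ext x
  rw [charFun_gaussianStep, charFun_pi]
  simp only [charFun_gaussianReal]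
  rw [← Complex.exp_sum, EuclideanSpace.real_norm_sq_eq]
  congr 1
  push_cast
  rw [Finset.mul_sum, ← Finset.sum_neg_distrib]
  refine Finset.sum_congr rfl fun i _ => ?_
  ring

/-- The symmetry that makes the past of the two-sided walk a walk with the same step law. -/
lemma map_neg_gaussianStep (t : ℝ≥0) : (gaussianStep d t).map (fun x => -x) = gaussianStep d t := by
  apply Measure.ext_of_charFun
  ext x
  have := charFun_map_smul (μ := gaussianStep d t) (-1 : ℝ) x
  simp only [neg_smul, one_smul] at this
  rw [this, charFun_gaussianStep, charFun_gaussianStep, norm_neg]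

lemma volume_absolutelyContinuous_gaussianStep {t : ℝ≥0} (ht : t ≠ 0) :
    (volume : Measure (E d)) ≪ gaussianStep d t := by
  have h1 : (Measure.pi fun _ : Fin d => (volume : Measure ℝ)) ≪
      Measure.pi fun _ : Fin d => gaussianReal 0 (2 * t) :=
    absolutelyContinuous_pi (gaussianReal_absolutelyContinuous' _ (by simpa using ht)) d
  rw [gaussianStep_eq_map_pi, ← (EuclideanSpace.volume_preserving_symm_measurableEquiv_toLp (Fin d)).symm.map_eq]
  exact h1.map (by fun_prop)

lemma gaussianReal_Icc_le {v : ℝ≥0} (hv : v ≠ 0) (a b : ℝ) :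
    gaussianReal 0 v (Icc a b) ≤ ENNReal.ofReal ((√(2 * Real.pi * v))⁻¹ * (b - a)) := by
  rw [gaussianReal_apply _ hv]
  calc ∫⁻ x in Icc a b, gaussianPDF 0 v x
      ≤ ∫⁻ x in Icc a b, ENNReal.ofReal (√(2 * Real.pi * v))⁻¹ := by
        refine lintegral_mono fun x => ENNReal.ofReal_le_ofReal ?_
        rw [gaussianPDFReal]
        refine mul_le_of_le_one_right (by positivity) (Real.exp_le_one_iff.2 ?_)
        rw [neg_div]
        exact neg_nonpos.2 (by positivity)
    _ = _ := by
        rw [setLIntegral_const, Real.volume_Icc, ENNReal.ofReal_mul (by positivity)]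

/-- Each coordinate density is bounded by its maximum. The bound is uniform in `x` and decays like
`t ^ (-d / 2)`, which is what transience needs. -/
lemma gaussianStep_box_le {t : ℝ≥0} (ht : t ≠ 0) (x : E d) (r : ℝ) :
    gaussianStep d t {y | x + y ∈ box d r} ≤
      ENNReal.ofReal ((√(2 * Real.pi * (2 * t)))⁻¹ * (2 * r)) ^ d := by
  have hset : MeasurableSet {y | x + y ∈ box d r} := by
    have : {y | x + y ∈ box d r} = ⋂ i, {y : E d | |x i + y i| ≤ r} := by
      ext y; simp [box]
    rw [this]
    exact MeasurableSet.iInter fun i => measurableSet_le (by fun_prop) measurable_const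
  have hpre : WithLp.toLp 2 ⁻¹' {y | x + y ∈ box d r} =
      Set.pi univ fun i => Icc (-r - x i) (r - x i) := by
    ext y
    simp only [box, mem_preimage, mem_ofPred_eq, Set.mem_pi, mem_univ, true_imp_iff, mem_Icc,
      abs_le, PiLp.add_apply]
    refine forall_congr' fun i => ?_
    constructor <;> rintro ⟨h1, h2⟩ <;> constructor <;> linarith
  rw [gaussianStep_eq_map_pi, Measure.map_apply (by fun_prop) hset, hpre, Measure.pi_pi]
  calc ∏ i, gaussianReal 0 (2 * t) (Icc (-r - x i) (r - x i))
      ≤ ∏ i : Fin d, ENNReal.ofReal ((√(2 * Real.pi * (2 * t)))⁻¹ * (2 * r)) := by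
        refine Finset.prod_le_prod' fun i _ => (gaussianReal_Icc_le (by simpa using ht) _ _).trans ?_
        refine ENNReal.ofReal_le_ofReal (le_of_eq ?_)
        push_cast
        ring
    _ = _ := by simp

end GaussianStep

/-! ### Centred Gaussian processes with a scalar covariance function -/

/-- `X` is a centred Gaussian process with covariance `Cov(⟨a, X s⟩, ⟨b, X t⟩) = K s t ⟨a, b⟩`. -/
structure IsCentredGaussian {d : ℕ} {T Ω : Type*} [MeasurableSpace Ω] (X : T → Ω → E d)
    (P : Measure Ω) (K : T → T → ℝ) : Prop where
  measurable : ∀ t, Measurable (X t)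
  gaussian : IsGaussianProcess X P
  mean : ∀ t, ∫ ω, X t ω ∂P = 0
  cov : ∀ s t a b, cov[fun ω => inner ℝ a (X s ω), fun ω => inner ℝ b (X t ω); P] =
    K s t * inner ℝ a b

namespace IsCentredGaussian

variable {d : ℕ} {T Ω Ω' : Type*} [MeasurableSpace Ω] [MeasurableSpace Ω'] {X Y : T → Ω → E d}
  {P : Measure Ω} {P' : Measure Ω'} {K K' : T → T → ℝ}

lemma isProbabilityMeasure (h : IsCentredGaussian X P K) : IsProbabilityMeasure P :=
  h.gaussian.isProbabilityMeasure

lemma measurable_process (h : IsCentredGaussian X P K) : Measurable fun ω t => X t ω :=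
  measurable_pi_iff.2 h.measurable

lemma memLp (h : IsCentredGaussian X P K) (t : T) (a : E d) :
    MemLp (fun ω => inner ℝ a (X t ω)) 2 P :=
  ((h.gaussian.hasGaussianLaw_eval t).map_fun (innerSL ℝ a)).memLp_two

lemma congr_cov (h : IsCentredGaussian X P K) (hK : ∀ s t, K s t = K' s t) :
    IsCentredGaussian X P K' :=
  ⟨h.measurable, h.gaussian, h.mean, fun s t a b => by rw [h.cov, hK]⟩

lemma comp_index {S : Type*} (h : IsCentredGaussian X P K) (c : S → T) :
    IsCentredGaussian (fun s => X (c s)) P (fun s t => K (c s) (c t)) :=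
  ⟨fun _ => h.measurable _, h.gaussian.comp_right c, fun _ => h.mean _, fun _ _ a b => h.cov _ _ a b⟩

lemma comp_measurePreserving (h : IsCentredGaussian X P K) {f : Ω' → Ω}
    (hf : MeasurePreserving f P' P) : IsCentredGaussian (fun t ω => X t (f ω)) P' K where
  measurable t := (h.measurable t).comp hf.measurable
  gaussian := ⟨fun I => ⟨by
    have := (h.gaussian.hasGaussianLaw I).isGaussian_map
    rw [← hf.map_eq, Measure.map_map ?_ hf.measurable] at this
    · exact this
    · exact measurable_pi_iff.2 fun i => h.measurable _⟩⟩
  mean t := by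
    rw [← h.mean t, ← hf.map_eq, integral_map hf.measurable.aemeasurable]
    exact (h.measurable t).aestronglyMeasurable
  cov s t a b := by
    rw [← h.cov s t a b, ← hf.map_eq, covariance_map_fun]
    · exact ((h.measurable s).const_inner).aestronglyMeasurable
    · exact ((h.measurable t).const_inner).aestronglyMeasurable
    · exact hf.measurable.aemeasurable

/-- Independence kills the mixed covariances, so the two covariance functions add up. -/
lemma add (hX : IsCentredGaussian X P K) (hY : IsCentredGaussian Y P K')
    (h : IndepFun (fun ω t => X t ω) (fun ω t => Y t ω) P) :
    IsCentredGaussian (fun t ω => X t ω + Y t ω) P (fun s t => K s t + K' s t) := by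
  have := hX.isProbabilityMeasure
  have hind : ∀ s t a b, cov[fun ω => inner ℝ a (X s ω), fun ω => inner ℝ b (Y t ω); P] = 0 := by
    intro s t a b
    refine IndepFun.covariance_eq_zero ?_ (hX.memLp s a) (hY.memLp t b)
    exact h.comp (φ := fun f : T → E d => inner ℝ a (f s)) (ψ := fun f : T → E d => inner ℝ b (f t))
      ((measurable_pi_apply s).const_inner) ((measurable_pi_apply t).const_inner)
  refine ⟨fun t => (hX.measurable t).add (hY.measurable t), ⟨fun I => ?_⟩, fun t => ?_, ?_⟩
  · have := iIndepFun.hasGaussianLaw_fun_add (hX.gaussian.hasGaussianLaw I)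
      (hY.gaussian.hasGaussianLaw I)
      (h.comp (Finset.measurable_restrict I) (Finset.measurable_restrict I))
    exact this
  · rw [integral_add (hX.gaussian.hasGaussianLaw_eval t).integrable
      (hY.gaussian.hasGaussianLaw_eval t).integrable, hX.mean, hY.mean, add_zero]
  · intro s t a b
    simp only [inner_add_right]
    have e := covariance_add_left (hX.memLp s a) (hY.memLp s a) ((hX.memLp t b).add (hY.memLp t b))
    have e1 := covariance_add_right (hX.memLp s a) (hX.memLp t b) (hY.memLp t b)
    have e2 := covariance_add_right (hY.memLp s a) (hX.memLp t b) (hY.memLp t b)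
    rw [covariance_comm (fun ω => inner ℝ a (Y s ω)) (fun ω => inner ℝ b (X t ω)),
      hind t s b a] at e2
    rw [hind] at e1
    refine e.trans ?_
    rw [e1, e2, hX.cov, hY.cov]
    ring

lemma zero [IsProbabilityMeasure P] :
    IsCentredGaussian (fun (_ : T) (_ : Ω) => (0 : E d)) P (fun _ _ => 0) where
  measurable _ := measurable_const
  gaussian := ⟨fun I => ⟨by
    have : (fun _ : Ω => I.restrict fun _ : T => (0 : E d)) = fun _ => 0 := rfl
    rw [this, Measure.map_const, measure_univ, one_smul]
    infer_instance⟩⟩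
  mean _ := by simp
  cov s t a b := by simp

lemma sum {X : ℕ → T → Ω → E d} {K : ℕ → T → T → ℝ} (h : ∀ i, IsCentredGaussian (X i) P (K i))
    (hi : iIndepFun (fun i ω t => X i t ω) P) (l : ℕ) :
    IsCentredGaussian (fun t ω => ∑ i ∈ Finset.range l, X i t ω) P
      (fun s t => ∑ i ∈ Finset.range l, K i s t) := by
  have := (h 0).isProbabilityMeasure
  induction l with
  | zero => simpa using zero
  | succ l ih =>
    simp only [Finset.sum_range_succ]
    refine ih.add (h l) ?_
    have := hi.indepFun_finsetSum_of_notMem (fun i => (h i).measurable_process)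
      (s := Finset.range l) (i := l) (by simp)
    convert this using 1
    funext ω t
    simp [Finset.sum_apply]

/-- The mean and variance of a finite linear functional are all that a Gaussian characteristic
function sees. -/
lemma integral_variance_sum_inner (h : IsCentredGaussian X P K) (I : Finset T) (a : I → E d) :
    (∫ ω, ∑ i : I, inner ℝ (a i) (X i ω) ∂P = 0) ∧
      Var[fun ω => ∑ i : I, inner ℝ (a i) (X i ω); P] =
        ∑ i : I, ∑ j : I, K i j * inner ℝ (a i) (a j) := by
  have := h.isProbabilityMeasure
  constructor
  · rw [integral_finsetSum Finset.univ
      (f := fun (i : I) ω => inner ℝ (a i) (X i ω)) fun i _ => (h.memLp i (a i)).integrable one_le_two]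
    refine Finset.sum_eq_zero fun i _ => ?_
    rw [integral_inner (h.gaussian.hasGaussianLaw_eval i).integrable, h.mean, inner_zero_right]
  · rw [← covariance_self
      (Finset.measurable_sum Finset.univ
        (f := fun (i : I) ω => inner ℝ (a i) (X i ω))
        fun i _ => (h.measurable i).const_inner).aemeasurable]
    refine (covariance_fun_sum_fun_sum (fun i : I => h.memLp i (a i))
      (fun i : I => h.memLp i (a i))).trans ?_
    simp only [h.cov]

/-- The law of a centred Gaussian process is determined by its covariance. -/
theorem map_eq {X' : T → Ω' → E d} (h : IsCentredGaussian X P K)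
    (h' : IsCentredGaussian X' P' K) :
    P.map (fun ω t => X t ω) = P'.map (fun ω t => X' t ω) := by
  have := h.isProbabilityMeasure
  have := h'.isProbabilityMeasure
  have hp := isProjectiveLimit_map (X := X) (P := P) h.measurable_process.aemeasurable
  have hp' := isProjectiveLimit_map (X := X') (P := P') h'.measurable_process.aemeasurable
  refine hp.unique ?_
  convert hp' using 1
  funext I
  have g := (h.gaussian.hasGaussianLaw I).isGaussian_map
  have g' := (h'.gaussian.hasGaussianLaw I).isGaussian_map
  have hm : Measurable fun ω => I.restrict fun t => X t ω :=
    measurable_pi_iff.2 fun i => h.measurable _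
  have hm' : Measurable fun ω => I.restrict fun t => X' t ω :=
    measurable_pi_iff.2 fun i => h'.measurable _
  classical
  apply Measure.ext_of_charFunDual
  ext L
  -- The Riesz representatives of the components of the functional `L`.
  let a : I → E d := fun i =>
    (InnerProductSpace.toDual ℝ (E d)).symm (L.comp (ContinuousLinearMap.single ℝ (fun _ => E d) i))
  have hL : ∀ v : I → E d, L v = ∑ i, inner ℝ (a i) (v i) := fun v => by
    rw [← ContinuousLinearMap.sum_comp_single]
    exact Finset.sum_congr rfl fun i _ => by simp [a]
  rw [IsGaussian.charFunDual_eq, IsGaussian.charFunDual_eq, integral_map hm.aemeasurable (by fun_prop),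
    integral_map hm'.aemeasurable (by fun_prop), variance_map (by fun_prop) hm.aemeasurable,
    variance_map (by fun_prop) hm'.aemeasurable]
  have k := h.integral_variance_sum_inner I a
  have k' := h'.integral_variance_sum_inner I a
  simp only [Function.comp_def, hL, Finset.restrict]
  rw [integral_complex_ofReal, integral_complex_ofReal, k.1, k'.1, k.2, k'.2]

end IsCentredGaussian

/-! ### Brownian motion, bridges with random endpoint, and their concatenation -/

section Brownian

variable {d : ℕ}

lemma measurable_eval_path {X : Type*} [TopologicalSpace X] (t : X) :
    Measurable fun f : C(X, E d) => f t :=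
  (measurable_pi_apply t).comp (comap_measurable _)

lemma measurable_path_iff {X Ω : Type*} [TopologicalSpace X] [MeasurableSpace Ω]
    {F : Ω → C(X, E d)} : Measurable F ↔ ∀ t, Measurable fun ω => F ω t := by
  refine ⟨fun h t => (measurable_eval_path t).comp h, fun h => ?_⟩
  exact measurable_comap_iff.2 (measurable_pi_iff.2 h)

lemma IsCentredGaussian.of_gaussianStep (t : ℝ≥0) :
    IsCentredGaussian (fun (_ : Unit) (x : E d) => x) (gaussianStep d t) (fun _ _ => 2 * t) where
  measurable _ := measurable_id
  gaussian := ⟨fun I => by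
    have h : HasGaussianLaw (id : E d → E d) (gaussianStep d t) := IsGaussian.hasGaussianLaw_id
    exact h.map_fun (ContinuousLinearMap.pi fun _ : I => ContinuousLinearMap.id ℝ (E d))⟩
  mean _ := integral_id_gaussianStep t
  cov _ _ a b := by
    rw [← covarianceBilin_apply_eq_cov IsGaussian.memLp_two_id, covarianceBilin_gaussianStep]

/-- For `s ≤ t` the increment up to `t` is split at `s`, and only the part up to `s` contributes to
the covariance. Subtracting `w 0` makes the process start at `0` surely, not just almost surely,
which matches the form of `bridgePath`. -/
lemma IsBrownianLaw.isCentredGaussian {P₀ : Measure C(ℝ≥0, E d)} (h : IsBrownianLaw P₀) :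
    IsCentredGaussian (fun (t : ℝ≥0) (w : C(ℝ≥0, E d)) => w t - w 0) P₀
      (fun s t => 2 * (min s t : ℝ≥0)) := by
  have := h.isProbabilityMeasure
  have hm : ∀ t : ℝ≥0, Measurable fun w : C(ℝ≥0, E d) => w t - w 0 := fun t =>
    (measurable_eval_path t).sub (measurable_eval_path 0)
  have hlaw : ∀ t : ℝ≥0, P₀.map (fun w : C(ℝ≥0, E d) => w t - w 0) = gaussianStep d t := fun t => by
    simpa using h.increment 0 t (zero_le)
  have hg : ∀ t : ℝ≥0, HasGaussianLaw (fun w : C(ℝ≥0, E d) => w t - w 0) P₀ := fun t =>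
    ⟨by rw [hlaw]; infer_instance⟩
  have hinc : HasIndepIncrements (fun (t : ℝ≥0) (w : C(ℝ≥0, E d)) => w t - w 0) P₀ := by
    intro n t ht
    simpa using h.indep n t ht
  have hmp : ∀ t : ℝ≥0, MeasurePreserving (fun w : C(ℝ≥0, E d) => w t - w 0) P₀ (gaussianStep d t) :=
    fun t => ⟨hm t, hlaw t⟩
  have hstep : ∀ t : ℝ≥0, IsCentredGaussian (fun (_ : Unit) (w : C(ℝ≥0, E d)) => w t - w 0) P₀
      (fun _ _ => 2 * t) := fun t =>
    (IsCentredGaussian.of_gaussianStep t).comp_measurePreserving (hmp t)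
  refine ⟨hm, hinc.isGaussianProcess hg (by simp), fun t => (hstep t).mean (), ?_⟩
  have hle : ∀ s t : ℝ≥0, s ≤ t → ∀ a b : E d,
      cov[fun w : C(ℝ≥0, E d) => inner ℝ a (w s - w 0), fun w => inner ℝ b (w t - w 0); P₀] =
        2 * s * inner ℝ a b := by
    intro s t hst a b
    have hind : IndepFun (fun w : C(ℝ≥0, E d) => w s - w 0) (fun w => w t - w s) P₀ :=
      h.indep.indepFun_sub_sub (zero_le) hst
    have hdiff : MemLp (fun w : C(ℝ≥0, E d) => inner ℝ b (w t - w s)) 2 P₀ := by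
      have := ((hstep t).memLp () b).sub ((hstep s).memLp () b)
      refine this.congr_norm ?_ ?_
      · exact (((measurable_eval_path t).sub (measurable_eval_path s)).const_inner).aestronglyMeasurable
      · exact ae_of_all _ fun w => by simp [← inner_sub_right]
    have e : (fun w : C(ℝ≥0, E d) => inner ℝ b (w t - w 0)) =
        (fun w => inner ℝ b (w s - w 0)) + fun w => inner ℝ b (w t - w s) := by
      funext w
      simp [← inner_add_right]
    rw [e, covariance_add_right ((hstep s).memLp () a) ((hstep s).memLp () b) hdiff,
      (hstep s).cov () () a b]
    have hz : cov[fun w : C(ℝ≥0, E d) => inner ℝ a (w s - w 0),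
        fun w => inner ℝ b (w t - w s); P₀] = 0 := by
      refine IndepFun.covariance_eq_zero ?_ ((hstep s).memLp () a) hdiff
      exact hind.comp (φ := fun x : E d => inner ℝ a x) (ψ := fun x : E d => inner ℝ b x)
        (measurable_id.const_inner) (measurable_id.const_inner)
    rw [hz, add_zero]
  intro s t a b
  rcases le_total s t with hst | hst
  · rw [hle s t hst a b, min_eq_left hst]
  · rw [covariance_comm, hle t s hst b a, min_eq_right hst, real_inner_comm]

/-- The law of one step of the walk together with the Brownian path that is used to interpolate
it. -/
noncomputable def stepLaw (P₀ : Measure C(ℝ≥0, E d)) (β : ℝ≥0) : Measure (E d × C(ℝ≥0, E d)) :=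
  (gaussianStep d β).prod P₀

/-- The bridge with duration `T` from `0` to `p.1` that is built from the path `p.2`, stopped at
time `T`. -/
noncomputable def leg (T s : ℝ≥0) (p : E d × C(ℝ≥0, E d)) : E d :=
  bridgePath T 0 p.1 p.2 (min s T)

lemma measurable_leg (T s : ℝ≥0) : Measurable (leg (d := d) T s) := by
  have h : ∀ t : ℝ≥0, Measurable fun p : E d × C(ℝ≥0, E d) => p.2 t := fun t =>
    (measurable_eval_path t).comp measurable_snd
  exact (measurable_const.add ((h _).sub (h _))).sub
    ((measurable_const_smul _).comp ((measurable_const.add ((h _).sub (h _))).sub measurable_fst))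

/-- The leg is a bridge from `0` to `0` plus `s / T` times an independent Gaussian endpoint. The
correction `- s t / T` in the bridge covariance cancels against the covariance `s t / T` of the
linear part: a bridge with Gaussian endpoint is Brownian motion stopped at `T`. -/
lemma IsBrownianLaw.isCentredGaussian_leg {P₀ : Measure C(ℝ≥0, E d)} (h : IsBrownianLaw P₀)
    {T : ℝ≥0} (hT : T ≠ 0) :
    IsCentredGaussian (leg T) (stepLaw P₀ T) (fun s t => 2 * (min (min s t) T : ℝ≥0)) := by
  have := h.isProbabilityMeasure
  have hw := h.isCentredGaussian
  have hT' : (T : ℝ) ≠ 0 := by simpa using hT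
  -- The bridge from `0` to `0`, a linear image of the Brownian path.
  have hU : IsCentredGaussian
      (fun (s : ℝ≥0) (w : C(ℝ≥0, E d)) =>
        (w (min s T) - w 0) - (((min s T : ℝ≥0) : ℝ) / T) • (w T - w 0)) P₀
      (fun s t => 2 * ((min (min s t) T : ℝ≥0) - (min s T : ℝ≥0) * (min t T : ℝ≥0) / (T : ℝ))) := by
    refine ⟨fun t => (hw.measurable _).sub ((measurable_const_smul _).comp (hw.measurable _)), ?_, fun t => ?_, ?_⟩
    · classical
      refine hw.gaussian.of_isGaussianProcess fun s => ⟨{min s T, T},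
        ContinuousLinearMap.proj ⟨min s T, by simp⟩ -
          (((min s T : ℝ≥0) : ℝ) / T) • ContinuousLinearMap.proj ⟨T, by simp⟩, fun w => ?_⟩
      simp [Finset.restrict]
    · rw [integral_sub (hw.gaussian.hasGaussianLaw_eval _).integrable
        ((hw.gaussian.hasGaussianLaw_eval T).integrable.fun_smul _), integral_smul, hw.mean, hw.mean]
      simp
    · intro s t a b
      simp only [inner_sub_right _ (_ - _) (_ • _), inner_smul_right _ (_ - _)]
      have m := hw.memLp
      have m' : ∀ (c : ℝ) t a, MemLp (fun w : C(ℝ≥0, E d) => c * inner ℝ a (w t - w 0)) 2 P₀ :=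
        fun c t a => (hw.memLp t a).const_mul c
      rw [covariance_fun_sub_fun_sub (m _ _) (m' _ _ _) (m _ _) (m' _ _ _)]
      simp only [covariance_const_mul_left, covariance_const_mul_right, hw.cov]
      have e1 : min (min s T) (min t T) = min (min s t) T := by
        rw [min_min_min_comm, min_self]
      have e2 : min (min s T) T = min s T := by simp
      have e3 : min T (min t T) = min t T := by simp
      rw [e1, e2, e3, min_self]
      field_simp
      ring
  -- The straight line to the Gaussian endpoint.
  have hV : IsCentredGaussian
      (fun (s : ℝ≥0) (x : E d) => (((min s T : ℝ≥0) : ℝ) / T) • x) (gaussianStep d T)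
      (fun s t => 2 * ((min s T : ℝ≥0) * (min t T : ℝ≥0) / (T : ℝ))) := by
    have h0 := IsCentredGaussian.of_gaussianStep (d := d) T
    have h1 : IsCentredGaussian (fun (_ : ℝ≥0) (x : E d) => x) (gaussianStep d T)
      (fun _ _ => 2 * T) := h0.comp_index fun _ => ()
    refine ⟨fun t => measurable_const_smul _, h1.gaussian.smul _, fun t => ?_, ?_⟩
    · rw [integral_smul, integral_id_gaussianStep, smul_zero]
    · intro s t a b
      simp only [inner_smul_right]
      rw [covariance_const_mul_left, covariance_const_mul_right, h0.cov () () a b]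
      field_simp
  have hU' := hU.comp_measurePreserving
    (measurePreserving_snd (μ := gaussianStep d T) (ν := P₀))
  have hV' := hV.comp_measurePreserving
    (measurePreserving_fst (μ := gaussianStep d T) (ν := P₀))
  have hind := indepFun_prod (μ := gaussianStep d T) (ν := P₀) (X := fun x t => (((min t T : ℝ≥0) : ℝ) / T) • x)
    (Y := fun w t => (w (min t T) - w 0) - (((min t T : ℝ≥0) : ℝ) / T) • (w T - w 0))
    hV.measurable_process hU.measurable_process
  have hsum := (hV'.add hU' hind).congr_cov (K' := fun s t => 2 * (min (min s t) T : ℝ≥0))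
    fun s t => by ring
  rw [stepLaw]
  convert hsum using 1
  funext s p
  simp only [leg, bridgePath, ContinuousMap.coe_mk]
  module

/-- The summand is the time spent in leg `i` before time `r`: the truncated subtraction gives `0`
before the leg starts, the minimum gives `β` after it ends. -/
lemma sum_clamp (β : ℝ≥0) (l : ℕ) (r : ℝ≥0) :
    ∑ i ∈ Finset.range l, min (r - i * β) β = min r (l * β) := by
  induction l with
  | zero => simp
  | succ l ih =>
    rw [Finset.sum_range_succ, ih]
    push_cast
    rcases le_total r (l * β) with h | h
    · rw [min_eq_left h, tsub_eq_zero_of_le h, min_eq_left (zero_le), add_zero, min_eq_left]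
      exact h.trans (by rw [add_mul, one_mul]; exact le_self_add)
    · rw [min_eq_right h, ← min_add_add_left, add_tsub_cancel_of_le h, add_mul, one_mul]

/-- The concatenation of `l` bridges of duration `β`. -/
noncomputable def concatLegs (β : ℝ≥0) (l : ℕ) (s : ℝ≥0) (ω : ℕ → E d × C(ℝ≥0, E d)) : E d :=
  ∑ i ∈ Finset.range l, leg β (s - i * β) (ω i)

/-- The concatenation of `l` bridges of duration `β` with independent Gaussian endpoints has the
law of one bridge with duration `l β` and Gaussian endpoint. -/
theorem IsBrownianLaw.map_concatLegs {P₀ : Measure C(ℝ≥0, E d)} (h : IsBrownianLaw P₀)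
    {β : ℝ≥0} (hβ : β ≠ 0) {l : ℕ} (hl : l ≠ 0) :
    (Measure.infinitePi fun _ : ℕ => stepLaw P₀ β).map (fun ω s => concatLegs β l s ω) =
      (stepLaw P₀ (l * β)).map fun p s => leg (l * β) s p := by
  have := h.isProbabilityMeasure
  have : IsProbabilityMeasure (stepLaw P₀ β) := by unfold stepLaw; infer_instance
  have hleg := h.isCentredGaussian_leg hβ
  have hi : ∀ i : ℕ, IsCentredGaussian
      (fun (s : ℝ≥0) (ω : ℕ → E d × C(ℝ≥0, E d)) => leg β (s - i * β) (ω i))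
      (Measure.infinitePi fun _ : ℕ => stepLaw P₀ β) _ := fun i =>
    (hleg.comp_index fun s => s - i * β).comp_measurePreserving
      (measurePreserving_eval_infinitePi (fun _ : ℕ => stepLaw P₀ β) i)
  have hind := iIndepFun_infinitePi (P := fun _ : ℕ => stepLaw P₀ β)
    (X := fun (i : ℕ) p (s : ℝ≥0) => leg β (s - i * β) p)
    (fun i => measurable_pi_iff.2 fun s => measurable_leg _ _)
  -- Both processes are centred Gaussian, so only the covariances have to agree. They do by
  -- `sum_clamp`, applied to the minimum of `s` and `t`, because truncated subtraction is monotone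
  -- and commutes with minima.
  refine ((IsCentredGaussian.sum hi hind l).congr_cov fun s t => ?_).map_eq
    (h.isCentredGaussian_leg (by simp [hβ, hl]))
  rw [← Finset.mul_sum, ← sum_clamp]
  push_cast
  congr 1
  refine Finset.sum_congr rfl fun i _ => ?_
  norm_cast
  congr 1
  exact (Monotone.map_min fun a b hab => tsub_le_tsub_right hab _).symm

end Brownian

/-! ### Infinite product measures -/

section InfinitePi

variable {α α' : Type*} [MeasurableSpace α] [MeasurableSpace α']

lemma map_sumElim_infinitePi (μ : Measure α) [IsProbabilityMeasure μ] (ι₁ ι₂ : Type*) :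
    ((Measure.infinitePi fun _ : ι₁ => μ).prod (Measure.infinitePi fun _ : ι₂ => μ)).map
      (fun p => Sum.elim p.1 p.2) = Measure.infinitePi fun _ : ι₁ ⊕ ι₂ => μ := by
  have hm : Measurable fun p : (ι₁ → α) × (ι₂ → α) => (Sum.elim p.1 p.2 : ι₁ ⊕ ι₂ → α) := by
    refine measurable_pi_iff.2 ?_
    rintro (i | i)
    · exact (measurable_pi_apply i).comp measurable_fst
    · exact (measurable_pi_apply i).comp measurable_snd
  refine Measure.eq_infinitePi _ fun s t ht => ?_
  rw [Measure.map_apply hm (MeasurableSet.pi s.countable_toSet fun i _ => ht i)]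
  have : (fun p : (ι₁ → α) × (ι₂ → α) => (Sum.elim p.1 p.2 : ι₁ ⊕ ι₂ → α)) ⁻¹' Set.pi s t =
      (Set.pi s.toLeft fun i => t (Sum.inl i)) ×ˢ (Set.pi s.toRight fun i => t (Sum.inr i)) := by
    ext p
    simp [Set.mem_pi]
  rw [this, Measure.prod_prod, Measure.infinitePi_pi _ fun i _ => ht _,
    Measure.infinitePi_pi _ fun i _ => ht _, Finset.prod_sum_eq_prod_toLeft_mul_prod_toRight]

lemma map_comp_infinitePi (μ : Measure α) [IsProbabilityMeasure μ] {ι κ : Type*} {e : ι → κ}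
    (he : Function.Injective e) :
    (Measure.infinitePi fun _ : κ => μ).map (fun x i => x (e i)) =
      Measure.infinitePi fun _ : ι => μ :=
  Measure.map_infinitePi_infinitePi_of_inj he

/-- Reindexing two independent i.i.d. families into one i.i.d. family. -/
lemma map_sumElim_comp_infinitePi (μ : Measure α) [IsProbabilityMeasure μ] {ι ι₁ ι₂ : Type*}
    {e : ι → ι₁ ⊕ ι₂} (he : Function.Injective e) :
    ((Measure.infinitePi fun _ : ι₁ => μ).prod (Measure.infinitePi fun _ : ι₂ => μ)).map
      (fun p i => Sum.elim p.1 p.2 (e i)) = Measure.infinitePi fun _ : ι => μ := by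
  rw [← map_comp_infinitePi μ he, ← map_sumElim_infinitePi μ ι₁ ι₂,
    Measure.map_map]
  · rfl
  · exact measurable_pi_iff.2 fun i => measurable_pi_apply _
  · refine measurable_pi_iff.2 ?_
    rintro (i | i)
    · exact (measurable_pi_apply i).comp measurable_fst
    · exact (measurable_pi_apply i).comp measurable_snd

/-- Pairing two independent i.i.d. families. -/
lemma map_zip_infinitePi (μ : Measure α) [IsProbabilityMeasure μ] (ν : Measure α')
    [IsProbabilityMeasure ν] (ι : Type*) :
    ((Measure.infinitePi fun _ : ι => μ).prod (Measure.infinitePi fun _ : ι => ν)).map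
      (fun p i => (p.1 i, p.2 i)) = Measure.infinitePi fun _ : ι => μ.prod ν := by
  have hm : Measurable fun (p : (ι → α) × (ι → α')) i => (p.1 i, p.2 i) :=
    measurable_pi_iff.2 fun i => ((measurable_pi_apply i).comp measurable_fst).prodMk
      ((measurable_pi_apply i).comp measurable_snd)
  refine IsProjectiveLimit.unique (P := fun I : Finset ι => Measure.pi fun _ : I => μ.prod ν) ?_
    (Measure.isProjectiveLimit_infinitePi _)
  intro I
  rw [Measure.map_map (Finset.measurable_restrict I) hm]
  refine (Measure.pi_eq_generateFrom (C := fun _ : I =>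
    image2 (· ×ˢ ·) {s : Set α | MeasurableSet s} {t : Set α' | MeasurableSet t})
    (fun _ => generateFrom_prod) (fun _ => isPiSystem_prod) (fun _ => ⟨fun _ => univ,
      fun _ => ⟨univ, MeasurableSet.univ, univ, MeasurableSet.univ, univ_prod_univ⟩,
      fun _ => measure_lt_top _ _, iUnion_const _⟩) fun s hs => ?_).symm
  choose a ha b hb hab using hs
  have hsm : ∀ i, MeasurableSet (s i) := fun i => by rw [← hab]; exact (ha i).prod (hb i)
  classical
  rw [Measure.map_apply ((Finset.measurable_restrict I).comp hm) (MeasurableSet.univ_pi hsm)]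
  let a' : ι → Set α := fun i => if h : i ∈ I then a ⟨i, h⟩ else univ
  let b' : ι → Set α' := fun i => if h : i ∈ I then b ⟨i, h⟩ else univ
  have ha' : ∀ i ∈ I, MeasurableSet (a' i) := fun i h => by simpa [a', h] using ha ⟨i, h⟩
  have hb' : ∀ i ∈ I, MeasurableSet (b' i) := fun i h => by simpa [b', h] using hb ⟨i, h⟩
  have hpre : (I.restrict ∘ fun (p : (ι → α) × (ι → α')) i => (p.1 i, p.2 i)) ⁻¹'
      Set.pi univ s = (Set.pi I a') ×ˢ (Set.pi I b') := by
    ext p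
    simp only [mem_preimage, Set.mem_pi, mem_univ, true_imp_iff, Function.comp, Finset.restrict,
      mem_prod, ← hab, ← forall_and, Subtype.forall, Finset.mem_coe, a', b']
    exact forall₂_congr fun i hi => by simp [hi]
  rw [hpre, Measure.prod_prod, Measure.infinitePi_pi _ ha', Measure.infinitePi_pi _ hb',
    ← Finset.prod_mul_distrib, ← Finset.prod_coe_sort]
  refine Finset.prod_congr rfl fun i _ => ?_
  rw [← hab i, Measure.prod_prod]
  simp [a', b']

end InfinitePi

/-! ### Transience of the walk -/

section Walk

variable {d : ℕ}

/-- The walk with steps `ξ` started at `x`. -/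
def walk (x : E d) (ξ : ℕ → E d) (n : ℕ) : E d := x + ∑ i ∈ Finset.range n, ξ i

lemma measurable_walk : Measurable fun p : E d × (ℕ → E d) => walk p.1 p.2 := by
  refine measurable_pi_iff.2 fun n => measurable_fst.add ?_
  exact Finset.measurable_sum _ fun i _ => (measurable_pi_apply i).comp measurable_snd

lemma measurable_walk_right (x : E d) : Measurable (walk x) :=
  measurable_walk.comp measurable_prodMk_left

instance (β : ℝ≥0) (x : E d) : IsProbabilityMeasure (walkLaw β x) :=
  Measure.isProbabilityMeasure_map (measurable_walk_right x).aemeasurable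

lemma measurableSet_box (r : ℝ) : MeasurableSet (box d r) := by
  have : box d r = ⋂ i, {y : E d | |y i| ≤ r} := by
    ext y; simp [box]
  rw [this]
  exact MeasurableSet.iInter fun i => measurableSet_le (by fun_prop) measurable_const

lemma isBounded_box (r : ℝ) : Bornology.IsBounded (box d r) := by
  refine (Metric.isBounded_closedBall (x := (0 : E d)) (r := √(d * r ^ 2))).subset fun x hx => ?_
  rw [mem_closedBall_zero_iff, EuclideanSpace.norm_eq]
  refine Real.sqrt_le_sqrt ?_
  calc ∑ i, ‖x i‖ ^ 2 ≤ ∑ _i : Fin d, r ^ 2 :=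
        Finset.sum_le_sum fun i _ => pow_le_pow_left₀ (norm_nonneg _) (hx i) 2
    _ = d * r ^ 2 := by simp

lemma exists_subset_box {W : Set (E d)} (hW : Bornology.IsBounded W) :
    ∃ N : ℕ, W ⊆ box d (N + 1) := by
  obtain ⟨R, hR⟩ := hW.subset_closedBall 0
  obtain ⟨N, hN⟩ := exists_nat_ge R
  refine ⟨N, fun x hx i => ?_⟩
  have h1 : ‖x‖ ≤ R := by simpa using hR hx
  have h2 : |x i| ≤ ‖x‖ := PiLp.norm_apply_le x i
  linarith

/-- This is `map_concatLegs` evaluated at the final time `n β`, where every leg has reached its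
endpoint. -/
lemma infinitePi_sum_gaussianStep {P₀ : Measure C(ℝ≥0, E d)} (h : IsBrownianLaw P₀) {β : ℝ≥0}
    (hβ : β ≠ 0) {n : ℕ} (hn : n ≠ 0) :
    (Measure.infinitePi fun _ : ℕ => gaussianStep d β).map (fun ξ => ∑ i ∈ Finset.range n, ξ i) =
      gaussianStep d (n * β) := by
  have := h.isProbabilityMeasure
  have hβ' : (β : ℝ) ≠ 0 := by simpa using hβ
  have key := congrArg (Measure.map fun f : ℝ≥0 → E d => f (n * β)) (h.map_concatLegs hβ hn)
  have hm1 : Measurable fun (p : E d × C(ℝ≥0, E d)) s => leg (n * β) s p :=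
    measurable_pi_iff.2 fun s => measurable_leg _ _
  have hm2 : Measurable fun (ω : ℕ → E d × C(ℝ≥0, E d)) s => concatLegs β n s ω :=
    measurable_pi_iff.2 fun s => Finset.measurable_sum _ fun i _ =>
      (measurable_leg _ _).comp (measurable_pi_apply i)
  rw [Measure.map_map (measurable_pi_apply _) hm1, Measure.map_map (measurable_pi_apply _) hm2] at key
  have e1 : ∀ (T : ℝ≥0), T ≠ 0 → ∀ (s : ℝ≥0), T ≤ s → ∀ p : E d × C(ℝ≥0, E d), leg T s p = p.1 := by
    intro T hT s hs p
    have hT' : (T : ℝ) ≠ 0 := by simpa using hT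
    simp [leg, bridgePath, min_eq_right hs, div_self hT']
  have e2 : (fun f : ℝ≥0 → E d => f (n * β)) ∘ (fun p s => leg (n * β) s p) = Prod.fst := by
    funext p
    exact e1 _ (by simp [hβ, hn]) _ le_rfl p
  have e3 : (fun f : ℝ≥0 → E d => f (n * β)) ∘ (fun ω s => concatLegs β n s ω) =
      (fun ξ : ℕ → E d => ∑ i ∈ Finset.range n, ξ i) ∘ fun ω i => (ω i).1 := by
    funext ω
    simp only [Function.comp, concatLegs]
    refine Finset.sum_congr rfl fun i hi => e1 _ hβ _ ?_ _
    rw [← tsub_mul]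
    refine le_mul_of_one_le_left (zero_le) ?_
    have : i + 1 ≤ n := Finset.mem_range.1 hi
    exact_mod_cast (Nat.le_sub_of_add_le' this)
  have hfst : ∀ T : ℝ≥0, (stepLaw P₀ T).map Prod.fst = gaussianStep d T := fun T => by
    rw [stepLaw, ← Measure.fst, Measure.fst_prod]
  rw [e2, e3, ← Measure.map_map, hfst] at key
  · have hs : (Measure.infinitePi fun _ : ℕ => stepLaw P₀ β).map (fun ω i => (ω i).1) =
        Measure.infinitePi fun _ : ℕ => gaussianStep d β := by
      have : IsProbabilityMeasure (stepLaw P₀ β) := by unfold stepLaw; infer_instance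
      rw [Measure.infinitePi_map_pi (μ := fun _ : ℕ => stepLaw P₀ β) (f := fun _ => Prod.fst)
        (fun _ => measurable_fst)]
      simp only [hfst]
    rw [← hs]
    exact key
  · exact Finset.measurable_sum _ fun i _ => measurable_pi_apply i
  · exact measurable_pi_iff.2 fun i => measurable_fst.comp (measurable_pi_apply i)

lemma walkLaw_box_le {P₀ : Measure C(ℝ≥0, E d)} (h : IsBrownianLaw P₀) {β : ℝ≥0} (hβ : β ≠ 0)
    (x : E d) (r : ℝ) {n : ℕ} (hn : n ≠ 0) :
    walkLaw β x {X | X n ∈ box d r} ≤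
      ENNReal.ofReal ((√(2 * Real.pi * (2 * (n * β))))⁻¹ * (2 * r)) ^ d := by
  have hset : MeasurableSet {X : ℕ → E d | X n ∈ box d r} :=
    (measurable_pi_apply n) (measurableSet_box r)
  have hset' : MeasurableSet {y : E d | x + y ∈ box d r} :=
    (measurable_const_add x) (measurableSet_box r)
  have e := gaussianStep_box_le (t := n * β) (by simp [hβ, hn]) x r
  rw [← infinitePi_sum_gaussianStep h hβ hn, Measure.map_apply
    (Finset.measurable_sum _ fun i _ => measurable_pi_apply i) hset'] at e
  push_cast at e
  refine le_trans (le_of_eq ?_) e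
  exact Measure.map_apply (measurable_walk_right x) hset

/-- In dimension at least three the walk is transient. -/
lemma walkLaw_transient {P₀ : Measure C(ℝ≥0, E d)} (h : IsBrownianLaw P₀) {β : ℝ≥0} (hβ : β ≠ 0)
    (hd : 3 ≤ d) (x : E d) :
    ∀ᵐ X ∂(walkLaw β x), ∀ N : ℕ, ∀ᶠ n in atTop, X n ∉ box d N := by
  refine ae_all_iff.2 fun N => ?_
  -- Borel–Cantelli: it suffices that the probabilities of being in the cube are summable.
  refine ae_eventually_notMem (s := fun n => {X : ℕ → E d | X n ∈ box d N}) ?_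
  have hb : (0 : ℝ) < β := by positivity
  set c : ℝ := (√(2 * Real.pi * (2 * β)))⁻¹ * (2 * N) with hc
  have hc0 : 0 ≤ c := by positivity
  have hle : ∀ n : ℕ, walkLaw β x {X | X (n + 1) ∈ box d N} ≤
      ENNReal.ofReal (c ^ d * ((n + 1 : ℕ) : ℝ) ^ (-(d / 2 : ℝ))) := by
    intro n
    refine (walkLaw_box_le h hβ x N n.succ_ne_zero).trans (le_of_eq ?_)
    rw [← ENNReal.ofReal_pow (by positivity)]
    congr 1
    have hn : (0 : ℝ) < ((n + 1 : ℕ) : ℝ) := by positivity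
    have e : √(2 * Real.pi * (2 * (((n + 1 : ℕ) : ℝ) * β))) =
        √((n + 1 : ℕ) : ℝ) * √(2 * Real.pi * (2 * β)) := by
      rw [← Real.sqrt_mul hn.le]
      congr 1
      ring
    rw [e, mul_inv, mul_assoc, ← hc, mul_pow, mul_comm, Real.sqrt_eq_rpow, ← Real.rpow_neg hn.le,
      ← Real.rpow_mul_natCast hn.le]
    congr 2
    ring
  -- The exponent `d / 2` exceeds `1`, which is where `3 ≤ d` is needed.
  have hs : Summable fun n : ℕ => c ^ d * ((n + 1 : ℕ) : ℝ) ^ (-(d / 2 : ℝ)) := by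
    refine Summable.mul_left _ ((summable_nat_add_iff 1).2 (Real.summable_nat_rpow.2 ?_))
    have : (3 : ℝ) ≤ d := by exact_mod_cast hd
    linarith
  -- The Gaussian bound does not cover time `0`, whose term is split off.
  rw [tsum_eq_zero_add' ENNReal.summable]
  refine ENNReal.add_ne_top.2 ⟨measure_ne_top _ _, ?_⟩
  refine ne_top_of_le_ne_top ?_ (ENNReal.tsum_le_tsum hle)
  rw [← ENNReal.ofReal_tsum_of_nonneg (fun n => by positivity) hs]
  exact ENNReal.ofReal_ne_top

end Walk

/-! ### The two-sided walk started from Lebesgue measure -/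

section TwoSided

variable {d : ℕ}

/-- The two-sided walk with increments `ζ` that is at `x` at time `0`. -/
def twoSided (x : E d) (ζ : ℤ → E d) : ℤ → E d :=
  glue (walk x fun i : ℕ => -ζ (-1 - i), walk x fun i : ℕ => ζ i)

@[simp] lemma twoSided_zero (x : E d) (ζ : ℤ → E d) : twoSided x ζ 0 = x := by
  simp [twoSided, glue, walk]

@[simp] lemma twoSided_natCast (x : E d) (ζ : ℤ → E d) (n : ℕ) :
    twoSided x ζ n = walk x (fun i : ℕ => ζ i) n := by
  simp [twoSided, glue]

@[simp] lemma twoSided_neg_natCast (x : E d) (ζ : ℤ → E d) (n : ℕ) :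
    twoSided x ζ (-n) = walk x (fun i : ℕ => -ζ (-1 - i)) n := by
  rcases n.eq_zero_or_pos with rfl | hn
  · simp [walk]
  · simp [twoSided, glue, hn.ne']

lemma twoSided_succ (x : E d) (ζ : ℤ → E d) (n : ℤ) :
    twoSided x ζ (n + 1) = twoSided x ζ n + ζ n := by
  obtain ⟨k, rfl | rfl⟩ := n.eq_nat_or_neg
  · have : ((k : ℤ) + 1) = ((k + 1 : ℕ) : ℤ) := by simp
    rw [this, twoSided_natCast, twoSided_natCast, walk, walk, Finset.sum_range_succ, add_assoc]
  · rcases k with _ | k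
    · have := twoSided_natCast x ζ 1
      simp only [Nat.cast_one] at this
      simp [this, walk]
    · have e : (-((k + 1 : ℕ) : ℤ) + 1) = -(k : ℤ) := by push_cast; ring
      have e' : (-((k + 1 : ℕ) : ℤ)) = -1 - (k : ℤ) := by push_cast; ring
      rw [e, twoSided_neg_natCast, twoSided_neg_natCast, walk, walk, Finset.sum_range_succ, e']
      abel

/-- A two-sided sequence is determined by its value at `0` and its increments. Identities for
`twoSided` then follow from the recursion alone, without cases on the sign of the time. -/
lemma eq_twoSided {X ζ : ℤ → E d} (h : ∀ n, X (n + 1) = X n + ζ n) : X = twoSided (X 0) ζ := by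
  funext n
  induction n using Int.induction_on with
  | zero => simp
  | succ i ih => rw [h, twoSided_succ, ih]
  | pred i ih =>
    have h1 := h (-i - 1)
    have h2 := twoSided_succ (X 0) ζ (-i - 1)
    rw [sub_add_cancel] at h1 h2
    rw [h1, h2] at ih
    exact add_right_cancel ih

lemma twoSided_add (x y : E d) (ζ : ℤ → E d) (n : ℤ) :
    twoSided (x + y) ζ n = x + twoSided y ζ n := by
  have := eq_twoSided (X := fun n => x + twoSided y ζ n) (ζ := ζ)
    fun n => by rw [twoSided_succ, add_assoc]
  have := congrFun this n
  simpa using this.symm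

/-- A time shift reindexes the increments and translates the starting point by a vector that depends
on the increments only; translation invariance of Lebesgue measure will absorb the latter. -/
lemma twoSided_shift (x : E d) (ζ : ℤ → E d) (m : ℤ) :
    (fun n => twoSided x ζ (n + m)) = twoSided (x + twoSided 0 ζ m) fun n => ζ (n + m) := by
  have := eq_twoSided (X := fun n => twoSided x ζ (n + m)) (ζ := fun n => ζ (n + m))
    fun n => by rw [← twoSided_succ]; congr 1; ring
  rw [this, zero_add, ← twoSided_add, add_zero]

lemma measurable_glue : Measurable (glue (d := d)) := by
  refine measurable_pi_iff.2 fun n => ?_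
  simp only [glue]
  split_ifs
  · exact (measurable_pi_apply _).comp measurable_snd
  · exact (measurable_pi_apply _).comp measurable_fst

lemma measurable_twoSided : Measurable fun p : E d × (ℤ → E d) => twoSided p.1 p.2 := by
  have h1 : Measurable fun p : E d × (ℤ → E d) => (p.1, fun i : ℕ => -p.2 (-1 - i)) :=
    measurable_fst.prodMk (measurable_pi_iff.2 fun i =>
      ((measurable_pi_apply _).comp measurable_snd).neg)
  have h2 : Measurable fun p : E d × (ℤ → E d) => (p.1, fun i : ℕ => p.2 i) :=
    measurable_fst.prodMk (measurable_pi_iff.2 fun i => (measurable_pi_apply _).comp measurable_snd)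
  exact measurable_glue.comp ((measurable_walk.comp h1).prodMk (measurable_walk.comp h2))

lemma measurable_twoSided_right (x : E d) : Measurable (twoSided x) :=
  measurable_twoSided.comp measurable_prodMk_left

lemma walkLaw_eq_map_neg (β : ℝ≥0) (x : E d) :
    walkLaw β x = (Measure.infinitePi fun _ : ℕ => gaussianStep d β).map
      fun ξ => walk x fun i => -ξ i := by
  have h := Measure.infinitePi_map_pi (μ := fun _ : ℕ => gaussianStep d β)
    (f := fun _ (y : E d) => -y) (fun _ => measurable_neg)
  simp only [map_neg_gaussianStep] at h
  change (Measure.infinitePi fun _ : ℕ => gaussianStep d β).map (walk x) = _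
  conv_lhs => rw [← h]
  rw [Measure.map_map (measurable_walk_right x)]
  · rfl
  · exact measurable_pi_iff.2 fun i => (measurable_pi_apply i).neg

/-- Past and future use disjoint sets of increments and are therefore independent; the past uses
them with reversed sign, which the symmetry of the step law undoes. -/
lemma map_twoSided (β : ℝ≥0) (x : E d) :
    (Measure.infinitePi fun _ : ℤ => gaussianStep d β).map (twoSided x) =
      ((walkLaw β x).prod (walkLaw β x)).map glue := by
  -- The increment from time `n` to `n + 1` is step `n` of the future if `0 ≤ n`, and step `-1 - n`
  -- of the past otherwise.
  let e : ℤ → ℕ ⊕ ℕ := fun n => if 0 ≤ n then Sum.inr n.toNat else Sum.inl (-1 - n).toNat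
  have he : Function.Injective e := by
    intro m n h
    simp only [e] at h
    split_ifs at h with h1 h2 h2
    · have := Sum.inr_injective h
      omega
    · have := Sum.inl_injective h
      omega
  have hm : Measurable fun (p : (ℕ → E d) × (ℕ → E d)) (i : ℤ) =>
      (Sum.elim p.1 p.2 (e i) : E d) := by
    refine measurable_pi_iff.2 fun i => ?_
    rcases e i with j | j
    · exact (measurable_pi_apply j).comp measurable_fst
    · exact (measurable_pi_apply j).comp measurable_snd
  have hneg : Measurable fun (ξ : ℕ → E d) => walk x fun i => -ξ i :=
    (measurable_walk_right x).comp (measurable_pi_iff.2 fun i => (measurable_pi_apply i).neg)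
  rw [← map_sumElim_comp_infinitePi (gaussianStep d β) he,
    Measure.map_map (measurable_twoSided_right x) hm]
  conv_rhs => rw [walkLaw_eq_map_neg]
  have : ((Measure.infinitePi fun _ : ℕ => gaussianStep d β).map
      fun ξ n => x + ∑ i ∈ Finset.range n, ξ i) = walkLaw β x := rfl
  rw [← walkLaw_eq_map_neg β x]
  conv_rhs => rw [show (walkLaw β x).prod (walkLaw β x) =
    ((Measure.infinitePi fun _ : ℕ => gaussianStep d β).map fun ξ => walk x fun i => -ξ i).prod
      ((Measure.infinitePi fun _ : ℕ => gaussianStep d β).map (walk x)) by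
        rw [← walkLaw_eq_map_neg]; rfl]
  rw [Measure.map_prod_map _ _ hneg (measurable_walk_right x), Measure.map_map measurable_glue
    (hneg.prodMap (measurable_walk_right x))]
  congr 1
  funext p
  simp only [Function.comp, twoSided, Prod.map, e]
  have h1 : ∀ i : ℕ, ¬ (i : ℤ) ≤ -1 := fun i => by omega
  simp [h1]

/-- The law of the two-sided walk whose position at time `0` is distributed according to Lebesgue
measure. -/
noncomputable def twoSidedLaw (d : ℕ) (β : ℝ≥0) : Measure (ℤ → E d) :=
  ((volume : Measure (E d)).prod (Measure.infinitePi fun _ : ℤ => gaussianStep d β)).map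
    fun p => twoSided p.1 p.2

lemma lintegral_twoSidedLaw (β : ℝ≥0) {H : (ℤ → E d) → ℝ≥0∞} (hH : Measurable H) :
    ∫⁻ X, H X ∂(twoSidedLaw d β) =
      ∫⁻ x, ∫⁻ p, H (glue p) ∂((walkLaw β x).prod (walkLaw β x)) := by
  have hc : Measurable fun p : E d × (ℤ → E d) => H (twoSided p.1 p.2) := hH.comp measurable_twoSided
  rw [twoSidedLaw, lintegral_map hH measurable_twoSided, lintegral_prod _ hc.aemeasurable]
  refine lintegral_congr fun x => ?_
  rw [← lintegral_map hH measurable_glue, ← map_twoSided,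
    lintegral_map hH (measurable_twoSided_right x)]

/-- Stationarity. For fixed increments the translation of the starting point does not change
Lebesgue measure; afterwards, for a fixed starting point, shifting i.i.d. increments does not change
their law. -/
lemma lintegral_twoSidedLaw_shift (β : ℝ≥0) {H : (ℤ → E d) → ℝ≥0∞} (hH : Measurable H) (m : ℤ) :
    ∫⁻ X, H (fun n => X (n + m)) ∂(twoSidedLaw d β) = ∫⁻ X, H X ∂(twoSidedLaw d β) := by
  have hs : Measurable fun (X : ℤ → E d) n => X (n + m) :=
    measurable_pi_iff.2 fun n => measurable_pi_apply _
  have h1 : Measurable fun p : E d × (ℤ → E d) => H (twoSided p.1 fun n => p.2 (n + m)) :=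
    hH.comp (measurable_twoSided.comp (measurable_fst.prodMk (hs.comp measurable_snd)))
  have h2 : Measurable fun p : E d × (ℤ → E d) =>
      H (twoSided (p.1 + twoSided 0 p.2 m) fun n => p.2 (n + m)) :=
    h1.comp ((measurable_fst.add ((measurable_pi_apply m).comp
      ((measurable_twoSided_right 0).comp measurable_snd))).prodMk measurable_snd)
  have hc : Measurable fun p : E d × (ℤ → E d) => H (twoSided p.1 p.2) := hH.comp measurable_twoSided
  have hc' : Measurable fun X : ℤ → E d => H fun n => X (n + m) := hH.comp hs
  rw [twoSidedLaw, lintegral_map hc' measurable_twoSided,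
    lintegral_map hH measurable_twoSided]
  simp only [twoSided_shift]
  rw [lintegral_prod_symm _ h2.aemeasurable, lintegral_prod _ hc.aemeasurable]
  have h3 : ∀ ζ : ℤ → E d, ∫⁻ x : E d, H (twoSided (x + twoSided 0 ζ m) fun n => ζ (n + m)) =
      ∫⁻ x : E d, H (twoSided x fun n => ζ (n + m)) := fun ζ =>
    lintegral_add_right_eq_self (fun x => H (twoSided x fun n => ζ (n + m))) (twoSided 0 ζ m)
  simp only [h3]
  rw [lintegral_lintegral_swap (f := fun (ζ : ℤ → E d) (x : E d) =>
    H (twoSided x fun n => ζ (n + m))) (h1.comp measurable_swap).aemeasurable]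
  refine lintegral_congr fun x => ?_
  have hx : Measurable fun ζ : ℤ → E d => H (twoSided x ζ) := hH.comp (measurable_twoSided_right x)
  rw [← lintegral_map hx hs, map_comp_infinitePi _ (add_left_injective m)]

/-- The trajectories that visit `V` for the first time at time `0`. -/
def firstVisit (V : Set (E d)) : Set (ℤ → E d) := {X | X 0 ∈ V ∧ ∀ n : ℕ, 1 ≤ n → X (-n) ∉ V}

lemma measurableSet_neverReturns {V : Set (E d)} (hV : MeasurableSet V) :
    MeasurableSet (neverReturns V) := by
  have : neverReturns V = ⋂ n : ℕ, ⋂ _ : 1 ≤ n, {X : ℕ → E d | X n ∈ Vᶜ} := by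
    ext X; simp [neverReturns]
  rw [this]
  exact MeasurableSet.iInter fun n => MeasurableSet.iInter fun _ =>
    (measurable_pi_apply n) hV.compl

lemma measurableSet_firstVisit {V : Set (E d)} (hV : MeasurableSet V) :
    MeasurableSet (firstVisit V) := by
  have : firstVisit V = {X : ℤ → E d | X 0 ∈ V} ∩
      ⋂ n : ℕ, ⋂ _ : 1 ≤ n, {X : ℤ → E d | X (-n) ∈ Vᶜ} := by
    ext X; simp [firstVisit]
  rw [this]
  exact ((measurable_pi_apply 0) hV).inter (MeasurableSet.iInter fun n =>
    MeasurableSet.iInter fun _ => (measurable_pi_apply _) hV.compl)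

lemma measurable_map_prodMk {α γ δ : Type*} [MeasurableSpace α] [MeasurableSpace γ]
    [MeasurableSpace δ] {f : α × γ → δ} (hf : Measurable f) (μ : Measure γ) [SFinite μ] :
    Measurable fun a => μ.map fun c => f (a, c) := by
  refine Measure.measurable_of_measurable_coe _ fun s hs => ?_
  have : ∀ a, (μ.map fun c => f (a, c)) s = μ (Prod.mk a ⁻¹' (f ⁻¹' s)) := fun a =>
    Measure.map_apply (hf.comp measurable_prodMk_left) hs
  simp only [this]
  exact measurable_measure_prodMk_left (hf hs)

lemma measurable_walkLaw (β : ℝ≥0) : Measurable (walkLaw (d := d) β) :=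
  measurable_map_prodMk measurable_walk _

lemma measurable_cond {α γ : Type*} [MeasurableSpace α] [MeasurableSpace γ] {κ : α → Measure γ}
    (hκ : Measurable κ) {s : Set γ} (hs : MeasurableSet s) : Measurable fun a => (κ a)[|s] := by
  refine Measure.measurable_of_measurable_coe _ fun t ht => ?_
  simp only [cond_apply hs]
  exact (((Measure.measurable_coe hs).comp hκ).inv).mul
    ((Measure.measurable_coe (hs.inter ht)).comp hκ)

lemma measurable_prod_measure {α γ δ : Type*} [MeasurableSpace α] [MeasurableSpace γ]
    [MeasurableSpace δ] {κ : α → Measure γ} {η : α → Measure δ} (hκ : Measurable κ)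
    (hη : Measurable η) (hκ1 : ∀ a, κ a univ ≤ 1) (hη1 : ∀ a, η a univ ≤ 1) :
    Measurable fun a => (κ a).prod (η a) := by
  let κ' : Kernel α γ := ⟨κ, hκ⟩
  let η' : Kernel α δ := ⟨η, hη⟩
  have : IsFiniteKernel κ' := ⟨1, ENNReal.one_lt_top, hκ1⟩
  have : IsFiniteKernel η' := ⟨1, ENNReal.one_lt_top, hη1⟩
  have e : (fun a => (κ a).prod (η a)) = κ' ×ₖ η' := by
    funext a
    rw [Kernel.prod_apply]
    rfl
  rw [e]
  exact Kernel.measurable _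

lemma cond_univ_le_one {α : Type*} [MeasurableSpace α] (μ : Measure α) (s : Set α) :
    μ[|s] univ ≤ 1 := by
  rw [ProbabilityTheory.cond, Measure.smul_apply, Measure.restrict_apply_univ, smul_eq_mul]
  exact ENNReal.inv_mul_le_one _

/-- The density `e_V(x)` is exactly the normalising constant of the conditioned backward walk, so
the two cancel and an unconditioned two-sided walk restricted to an event remains. All the measures
`Q_V` thus come from one stationary measure. -/
theorem Q_eq_restrict (β : ℝ≥0) {V : Set (E d)} (hV : MeasurableSet V) :
    Q β V = (twoSidedLaw d β).restrict (firstVisit V) := by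
  have hn := measurableSet_neverReturns hV
  have hw := measurable_walkLaw (d := d) β
  have hk : Measurable fun x : E d =>
      (((walkLaw β x)[|neverReturns V]).prod (walkLaw β x)).map glue :=
    (Measure.measurable_map _ measurable_glue).comp (measurable_prod_measure (measurable_cond hw hn)
      hw (fun a => cond_univ_le_one _ _) (fun a => by simp))
  have he : Measurable (equilibriumDensity (d := d) β V) :=
    ((Measure.measurable_coe hn).comp hw).indicator hV
  ext s hs
  have hks : Measurable fun x : E d =>
      (((walkLaw β x)[|neverReturns V]).prod (walkLaw β x)).map glue s :=
    (Measure.measurable_coe hs).comp hk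
  rw [Measure.restrict_apply hs, Q, Measure.bind_apply hs hk.aemeasurable,
    lintegral_withDensity_eq_lintegral_mul _ he hks,
    ← lintegral_indicator_one (hs.inter (measurableSet_firstVisit hV)),
    lintegral_twoSidedLaw β (measurable_one.indicator (hs.inter (measurableSet_firstVisit hV)))]
  refine lintegral_congr fun x => ?_
  simp only [Pi.mul_apply]
  have hgl : ∀ p : (ℕ → E d) × (ℕ → E d), p.2 0 = x → (glue p ∈ firstVisit V ↔
      x ∈ V ∧ p.1 ∈ neverReturns V) := by
    intro p hp
    simp only [firstVisit, mem_ofPred_eq, glue, neverReturns, le_refl, if_true, Int.toNat_zero, hp]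
    refine and_congr_right fun _ => forall₂_congr fun n hn => ?_
    have : ¬ (0 : ℤ) ≤ -n := by omega
    simp [show n ≠ 0 by omega]
  -- `glue` takes the position at time `0` from the forward walk, which starts at `x` only almost
  -- surely.
  have hx0 : ∀ᵐ p ∂((walkLaw β x).prod (walkLaw β x)), p.2 0 = x := by
    have h1 : ∀ᵐ X ∂(walkLaw β x), X 0 = x := by
      have hms : MeasurableSet {X : ℕ → E d | X 0 = x} :=
        measurableSet_eq_fun (measurable_pi_apply 0) measurable_const
      change ∀ᵐ X ∂((Measure.infinitePi fun _ : ℕ => gaussianStep d β).map (walk x)), X 0 = x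
      rw [ae_map_iff (measurable_walk_right x).aemeasurable hms]
      exact ae_of_all _ fun ξ => by simp [walk]
    exact Measure.quasiMeasurePreserving_snd.ae h1
  have hmap : (((walkLaw β x)[|neverReturns V]).prod (walkLaw β x)).map glue s =
      (walkLaw β x (neverReturns V))⁻¹ *
        ((walkLaw β x).prod (walkLaw β x)) ((neverReturns V ×ˢ univ) ∩ glue ⁻¹' s) := by
    rw [Measure.map_apply measurable_glue hs, ProbabilityTheory.cond, Measure.prod_smul_left,
      Measure.smul_apply, smul_eq_mul]
    congr 1
    have : ((walkLaw β x).restrict (neverReturns V)).prod (walkLaw β x) =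
        ((walkLaw β x).prod (walkLaw β x)).restrict (neverReturns V ×ˢ univ) := by
      rw [← Measure.prod_restrict, Measure.restrict_univ]
    rw [this, Measure.restrict_apply (measurable_glue hs), inter_comm]
  have hrhs : ∫⁻ p, (s ∩ firstVisit V).indicator 1 (glue p) ∂((walkLaw β x).prod (walkLaw β x)) =
      V.indicator (fun _ => ((walkLaw β x).prod (walkLaw β x))
        ((neverReturns V ×ˢ univ) ∩ glue ⁻¹' s)) x := by
    by_cases hxV : x ∈ V
    · rw [indicator_of_mem hxV, ← lintegral_indicator_one
        ((hn.prod MeasurableSet.univ).inter (measurable_glue hs))]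
      refine lintegral_congr_ae (hx0.mono fun p hp => ?_)
      have : glue p ∈ s ∩ firstVisit V ↔ p ∈ neverReturns V ×ˢ univ ∩ glue ⁻¹' s := by
        rw [mem_inter_iff, hgl p hp, mem_inter_iff, mem_prod, mem_preimage]
        simp [hxV, and_comm]
      change (s ∩ firstVisit V).indicator 1 (glue p) = _
      by_cases hq : p ∈ neverReturns V ×ˢ univ ∩ glue ⁻¹' s
      · rw [indicator_of_mem (this.2 hq), indicator_of_mem hq]
        rfl
      · rw [indicator_of_notMem (mt this.1 hq), indicator_of_notMem hq]
    · rw [indicator_of_notMem hxV]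
      refine (lintegral_congr_ae (hx0.mono fun p hp => ?_)).trans lintegral_zero
      simp [indicator, hgl p hp, hxV]
  rw [hmap, hrhs, equilibriumDensity]
  by_cases hxV : x ∈ V
  · simp only [indicator_of_mem hxV]
    -- If the walk returns almost surely, the conditioning is degenerate, but both sides vanish.
    by_cases h0 : walkLaw β x (neverReturns V) = 0
    · rw [h0, zero_mul]
      refine (measure_mono_null inter_subset_left ?_).symm
      rw [Measure.prod_prod, h0, zero_mul]
    · rw [← mul_assoc, ENNReal.mul_inv_cancel h0 (measure_ne_top _ _), one_mul]
  · simp [indicator_of_notMem hxV]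

end TwoSided

/-! ### Consistency of the local descriptions of the intensity measure -/

section Consistency

variable {d : ℕ}

/-- The trajectory `X` leaves every bounded set in both time directions. -/
def IsTransient (X : ℤ → E d) : Prop :=
  ∀ N : ℕ, (∀ᶠ n : ℕ in atTop, X n ∉ box d N) ∧ ∀ᶠ n : ℕ in atTop, X (-n) ∉ box d N

lemma measurableSet_isTransient : MeasurableSet {X : ℤ → E d | IsTransient X} := by
  have : {X : ℤ → E d | IsTransient X} = ⋂ N : ℕ,
      ((⋃ m : ℕ, ⋂ n : ℕ, ⋂ _ : m ≤ n, {X | X n ∈ (box d N)ᶜ}) ∩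
        (⋃ m : ℕ, ⋂ n : ℕ, ⋂ _ : m ≤ n, {X | X (-n) ∈ (box d N)ᶜ})) := by
    ext X
    simp [IsTransient, eventually_atTop]
  rw [this]
  have h : ∀ (N : ℕ) (k : ℤ), MeasurableSet {X : ℤ → E d | X k ∈ (box d N)ᶜ} := fun N k =>
    (measurable_pi_apply k) (measurableSet_box _).compl
  exact MeasurableSet.iInter fun N => (MeasurableSet.iUnion fun m => MeasurableSet.iInter fun n =>
    MeasurableSet.iInter fun _ => h N _).inter (MeasurableSet.iUnion fun m =>
    MeasurableSet.iInter fun n => MeasurableSet.iInter fun _ => h N _)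

lemma ae_isTransient {P₀ : Measure C(ℝ≥0, E d)} (h : IsBrownianLaw P₀) {β : ℝ≥0} (hβ : β ≠ 0)
    (hd : 3 ≤ d) : ∀ᵐ X ∂(twoSidedLaw d β), IsTransient X := by
  have hm := measurableSet_isTransient (d := d)
  rw [ae_iff, ← compl_ofPred, ← lintegral_indicator_one hm.compl,
    lintegral_twoSidedLaw β (measurable_one.indicator hm.compl)]
  refine (lintegral_congr fun x => ?_).trans lintegral_zero
  refine (lintegral_congr_ae ?_).trans lintegral_zero
  have ht := walkLaw_transient h hβ hd x
  have h1 := Measure.quasiMeasurePreserving_fst (μ := walkLaw β x) (ν := walkLaw β x) |>.ae ht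
  have h2 := Measure.quasiMeasurePreserving_snd (μ := walkLaw β x) (ν := walkLaw β x) |>.ae ht
  filter_upwards [h1, h2] with p hp1 hp2
  suffices hT : IsTransient (glue p) by
    have hp : glue p ∉ {X : ℤ → E d | IsTransient X}ᶜ := fun hp => hp hT
    exact indicator_of_notMem hp _
  refine fun N => ⟨?_, ?_⟩
  · filter_upwards [hp2 N] with n hn
    simpa [glue] using hn
  · filter_upwards [hp1 N, eventually_ge_atTop 1] with n hn hn1
    have : ¬ n = 0 := by omega
    simpa [glue, this] using hn

/-- A transient trajectory that visits `V` has exactly one shift that visits `V` first at time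
`0`. -/
lemma tsum_firstVisit {V : Set (E d)} {N : ℕ} (hV : V ⊆ box d N) {X : ℤ → E d}
    (hX : IsTransient X) (hv : ∃ n, X n ∈ V) :
    ∑' k : ℤ, (firstVisit V).indicator (1 : (ℤ → E d) → ℝ≥0∞) (fun n => X (n + k)) = 1 := by
  obtain ⟨m, hm⟩ := hv
  obtain ⟨K, hK⟩ := eventually_atTop.1 (hX N).2
  -- Transience in the past bounds the visit times from below, so that there is a first one.
  have hbdd : ∀ z : ℤ, X z ∈ V → -(K : ℤ) ≤ z := by
    intro z hz
    by_contra hlt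
    have := hK (-z).toNat (by omega)
    rw [show -((-z).toNat : ℤ) = z by omega] at this
    exact this (hV hz)
  obtain ⟨k, hk, hmin⟩ := Int.exists_least_of_bdd ⟨-(K : ℤ), hbdd⟩ ⟨m, hm⟩
  have huniq : ∀ j : ℤ, (fun n => X (n + j)) ∈ firstVisit V ↔ j = k := by
    intro j
    constructor
    · rintro ⟨h0, h1⟩
      have hj : k ≤ j := hmin j (by simpa using h0)
      by_contra hne
      refine h1 (j - k).toNat (by omega) ?_
      simp only
      rwa [show -(((j - k).toNat : ℕ) : ℤ) + j = k by omega]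
    · rintro rfl
      refine ⟨by simpa using hk, fun n hn hmem => ?_⟩
      have := hmin _ hmem
      omega
  rw [tsum_eq_single k fun j hj => indicator_of_notMem (mt (huniq j).1 hj) _,
    indicator_of_mem ((huniq k).2 rfl)]
  rfl

/-- A mass transport argument. Where `G` does not vanish, almost surely exactly one shift of the
trajectory visits `V'` first at time `0`; inserting this sum over shifts and moving each shift to
the other factor by stationarity exchanges `V` and `V'`, and the sum over shifts that remains again
equals `1`. -/
lemma setLIntegral_firstVisit_congr {P₀ : Measure C(ℝ≥0, E d)} (h : IsBrownianLaw P₀) {β : ℝ≥0}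
    (hβ : β ≠ 0) (hd : 3 ≤ d) {V V' : Set (E d)} (hVm : MeasurableSet V)
    (hVm' : MeasurableSet V') {N N' : ℕ} (hV : V ⊆ box d N) (hV' : V' ⊆ box d N')
    {G : (ℤ → E d) → ℝ≥0∞} (hG : Measurable G) (hinv : ∀ X (m : ℤ), G (fun n => X (n + m)) = G X)
    (hG0 : ∀ X, (∀ n, X n ∉ V) → G X = 0) (hG0' : ∀ X, (∀ n, X n ∉ V') → G X = 0) :
    ∫⁻ X in firstVisit V, G X ∂(twoSidedLaw d β) = ∫⁻ X in firstVisit V', G X ∂(twoSidedLaw d β) := by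
  have hA := measurableSet_firstVisit hVm
  have hA' := measurableSet_firstVisit hVm'
  have hi : Measurable ((firstVisit V).indicator (1 : (ℤ → E d) → ℝ≥0∞)) := measurable_one.indicator hA
  have hi' : Measurable ((firstVisit V').indicator (1 : (ℤ → E d) → ℝ≥0∞)) :=
    measurable_one.indicator hA'
  have hs : ∀ m : ℤ, Measurable fun (X : ℤ → E d) n => X (n + m) := fun m =>
    measurable_pi_iff.2 fun n => measurable_pi_apply _
  have key : ∀ {U : Set (E d)} {K : ℕ}, U ⊆ box d K → (∀ X, (∀ n, X n ∉ U) → G X = 0) →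
      ∀ᵐ X ∂(twoSidedLaw d β), G X = G X *
        ∑' k : ℤ, (firstVisit U).indicator (1 : (ℤ → E d) → ℝ≥0∞) (fun n => X (n + k)) := by
    intro U K hU h0
    filter_upwards [ae_isTransient h hβ hd] with X hX
    by_cases hv : ∃ n, X n ∈ U
    · rw [tsum_firstVisit hU hX hv, mul_one]
    · push Not at hv
      rw [h0 X hv, zero_mul]
  calc ∫⁻ X in firstVisit V, G X ∂(twoSidedLaw d β)
      = ∫⁻ X, (firstVisit V).indicator 1 X * G X ∂(twoSidedLaw d β) := by
        rw [← lintegral_indicator hA]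
        refine lintegral_congr fun X => ?_
        by_cases hX : X ∈ firstVisit V <;> simp [hX]
    _ = ∫⁻ X, ∑' k : ℤ, (firstVisit V).indicator 1 X * (G X *
          (firstVisit V').indicator 1 fun n => X (n + k)) ∂(twoSidedLaw d β) := by
        refine lintegral_congr_ae ?_
        filter_upwards [key hV' hG0'] with X hX
        rw [ENNReal.tsum_mul_left, ENNReal.tsum_mul_left, ← hX]
    _ = ∑' k : ℤ, ∫⁻ X, (firstVisit V).indicator 1 X * (G X *
          (firstVisit V').indicator 1 fun n => X (n + k)) ∂(twoSidedLaw d β) :=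
        lintegral_tsum fun k => (hi.mul (hG.mul (hi'.comp (hs k)))).aemeasurable
    _ = ∑' k : ℤ, ∫⁻ X, (firstVisit V').indicator 1 X * (G X *
          (firstVisit V).indicator 1 fun n => X (n + -k)) ∂(twoSidedLaw d β) := by
        refine tsum_congr fun k => ?_
        have hH : Measurable fun X : ℤ → E d => (firstVisit V').indicator (1 : (ℤ → E d) → ℝ≥0∞) X * (G X *
            (firstVisit V).indicator 1 fun n => X (n + -k)) :=
          hi'.mul (hG.mul (hi.comp (hs (-k))))
        -- Stationarity for the right-hand side: shifting by `k` turns the shift by `-k` into the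
        -- identity.
        rw [← lintegral_twoSidedLaw_shift β hH k]
        refine lintegral_congr fun X => ?_
        simp only [hinv, neg_add_cancel_right]
        ring
    _ = ∑' k : ℤ, ∫⁻ X, (firstVisit V').indicator 1 X * (G X *
          (firstVisit V).indicator 1 fun n => X (n + k)) ∂(twoSidedLaw d β) :=
        (Equiv.neg ℤ).tsum_eq fun k : ℤ => ∫⁻ X, (firstVisit V').indicator 1 X * (G X *
          (firstVisit V).indicator 1 fun n => X (n + k)) ∂(twoSidedLaw d β)
    _ = ∫⁻ X, ∑' k : ℤ, (firstVisit V').indicator 1 X * (G X *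
          (firstVisit V).indicator 1 fun n => X (n + k)) ∂(twoSidedLaw d β) :=
        (lintegral_tsum fun k => (hi'.mul (hG.mul (hi.comp (hs k)))).aemeasurable).symm
    _ = ∫⁻ X, (firstVisit V').indicator 1 X * G X ∂(twoSidedLaw d β) := by
        refine lintegral_congr_ae ?_
        filter_upwards [key hV hG0] with X hX
        rw [ENNReal.tsum_mul_left, ENNReal.tsum_mul_left, ← hX]
    _ = ∫⁻ X in firstVisit V', G X ∂(twoSidedLaw d β) := by
        rw [← lintegral_indicator hA']
        refine lintegral_congr fun X => ?_
        by_cases hX : X ∈ firstVisit V' <;> simp [hX]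

lemma measurable_mk_traj : Measurable (Quotient.mk (trajSetoid d)) := measurable_quotient_mk''

lemma mk_mem_visiting {W : Set (E d)} {X : ℤ → E d} :
    Quotient.mk (trajSetoid d) X ∈ visiting W ↔ ∃ n, X n ∈ W := by
  constructor
  · rintro ⟨Y, ⟨n, hn⟩, hYX⟩
    obtain ⟨m, hm⟩ := Quotient.exact hYX
    exact ⟨n - m, by rw [hm]; simpa using hn⟩
  · exact fun hX => ⟨X, hX, rfl⟩

lemma measurableSet_visiting {W : Set (E d)} (hW : MeasurableSet W) :
    MeasurableSet (visiting W) := by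
  refine measurableSet_quotient.2 ?_
  have : (Quotient.mk'' : (ℤ → E d) → Traj d) ⁻¹' visiting W = ⋃ n : ℤ, {X | X n ∈ W} := by
    ext X
    rw [mem_iUnion]
    exact mk_mem_visiting
  rw [this]
  exact MeasurableSet.iUnion fun n => (measurable_pi_apply n) hW

/-- The intensity measure of the Gaussian interlacements, integrated against functions that vanish
on trajectories that do not visit a given cube. -/
theorem lintegral_Upsilon {P₀ : Measure C(ℝ≥0, E d)} (h : IsBrownianLaw P₀) {β : ℝ≥0}
    (hβ : β ≠ 0) (hd : 3 ≤ d) (N : ℕ) {F : Traj d → ℝ≥0∞} (hF : Measurable F)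
    (hF0 : ∀ X ∉ visiting (box d (N + 1)), F X = 0) :
    ∫⁻ X, F X ∂(Upsilon d β) =
      ∫⁻ X in firstVisit (box d (N + 1)), F (Quotient.mk _ X) ∂(twoSidedLaw d β) := by
  have hD : ∀ n : ℕ, MeasurableSet (disjointed (fun k : ℕ => visiting (box d (k + 1))) n) := fun n =>
    MeasurableSet.disjointed (fun k => measurableSet_visiting (measurableSet_box _)) n
  have hmk := measurable_mk_traj (d := d)
  have hFm : ∀ n : ℕ, Measurable
      ((disjointed (fun k : ℕ => visiting (box d (k + 1))) n).indicator F) := fun n =>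
    hF.indicator (hD n)
  rw [Upsilon, lintegral_sum_measure]
  have hterm : ∀ n : ℕ, ∫⁻ X, F X ∂(((Q β (box d (n + 1))).map (Quotient.mk (trajSetoid d))).restrict
      (disjointed (fun k : ℕ => visiting (box d (k + 1))) n)) =
      ∫⁻ X in firstVisit (box d (N + 1)),
        (disjointed (fun k : ℕ => visiting (box d (k + 1))) n).indicator F (Quotient.mk _ X)
          ∂(twoSidedLaw d β) := by
    intro n
    rw [← lintegral_indicator (hD n), lintegral_map (hFm n) hmk, Q_eq_restrict β (measurableSet_box _)]
    -- The `n`-th piece of `Upsilon` is described through its own cube. The integrand, cut off to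
    -- that piece, vanishes unless both cubes are visited, so the fixed cube may be used instead.
    refine setLIntegral_firstVisit_congr h hβ hd (N := n + 1) (N' := N + 1) (measurableSet_box _)
      (measurableSet_box _) (by push_cast; rfl) (by push_cast; rfl) ((hFm n).comp hmk) ?_ ?_ ?_
    · intro X m
      congr 1
      exact Quotient.sound ⟨-m, fun k => by simp⟩
    · intro X hX
      refine indicator_of_notMem (fun hmem => ?_) _
      obtain ⟨k, hk⟩ := mk_mem_visiting.1 (disjointed_subset (fun k : ℕ => visiting (box d (k + 1))) n hmem)
      exact hX k hk
    · intro X hX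
      have : F (Quotient.mk _ X) = 0 := hF0 _ fun hmem => by
        obtain ⟨k, hk⟩ := mk_mem_visiting.1 hmem
        exact hX k hk
      simp [indicator, this]
  simp only [hterm]
  have hFc : ∀ n : ℕ, Measurable fun X : ℤ → E d =>
      (disjointed (fun k : ℕ => visiting (box d (k + 1))) n).indicator F (Quotient.mk _ X) :=
    fun n => (hFm n).comp hmk
  rw [← lintegral_tsum fun n => (hFc n).aemeasurable]
  refine setLIntegral_congr_fun (measurableSet_firstVisit (measurableSet_box _)) fun X hX => ?_
  have hmem : Quotient.mk (trajSetoid d) X ∈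
      ⋃ n, disjointed (fun k : ℕ => visiting (box d (k + 1))) n := by
    rw [iUnion_disjointed]
    exact mem_iUnion.2 ⟨N, mk_mem_visiting.2 ⟨0, hX.1⟩⟩
  obtain ⟨n, hn⟩ := mem_iUnion.1 hmem
  rw [tsum_eq_single n, indicator_of_mem hn]
  intro m hm
  refine indicator_of_notMem (fun hm' => ?_) _
  exact disjoint_left.1 (disjoint_disjointed _ hm) hm' hn

end Consistency

/-! ### Interpolation and the intensity measure of the interlacements -/

section Interpolation

variable {d : ℕ} {β : ℝ≥0}

lemma measurable_mk_interlacement : Measurable (Quotient.mk (pathSetoid d β)) :=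
  measurable_quotient_mk''

lemma measurable_bridgePath_apply {Ω : Type*} [MeasurableSpace Ω] (T s : ℝ≥0) {x y : Ω → E d}
    {w : Ω → C(ℝ≥0, E d)} (hx : Measurable x) (hy : Measurable y) (hw : Measurable w) :
    Measurable fun ω => bridgePath T (x ω) (y ω) (w ω) s := by
  have h : ∀ t : ℝ≥0, Measurable fun ω => w ω t := fun t => (measurable_eval_path t).comp hw
  exact (hx.add ((h s).sub (h 0))).sub
    ((measurable_const_smul _).comp ((hx.add ((h T).sub (h 0))).sub hy))

lemma measurable_interpolate :
    Measurable fun p : (ℤ → E d) × (ℤ → C(ℝ≥0, E d)) => interpolate β p.1 p.2 := by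
  refine measurable_path_iff.2 fun t => ?_
  exact measurable_bridgePath_apply _ _ ((measurable_pi_apply _).comp measurable_fst)
    ((measurable_pi_apply _).comp measurable_fst) ((measurable_pi_apply _).comp measurable_snd)

lemma interpolate_shift (hβ : β ≠ 0) (X : ℤ → E d) (w : ℤ → C(ℝ≥0, E d)) (m : ℤ) (t : ℝ) :
    interpolate β (fun n => X (n + m)) (fun n => w (n + m)) t = interpolate β X w (t + m * β) := by
  have hb : (β : ℝ) ≠ 0 := by simpa using hβ
  have e : ⌊(t + m * β) / (β : ℝ)⌋ = ⌊t / (β : ℝ)⌋ + m := by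
    rw [add_div, mul_div_assoc, div_self hb, mul_one, Int.floor_add_intCast]
  simp only [interpolate, ContinuousMap.coe_mk, interpolateFun, e]
  rw [show ⌊t / (β : ℝ)⌋ + 1 + m = ⌊t / (β : ℝ)⌋ + m + 1 by ring,
    show t + m * β - ((⌊t / (β : ℝ)⌋ + m : ℤ) : ℝ) * β = t - ⌊t / (β : ℝ)⌋ * β by push_cast; ring]

lemma mk_interpolate_shift (hβ : β ≠ 0) (X : ℤ → E d) (w : ℤ → C(ℝ≥0, E d)) (m : ℤ) :
    Quotient.mk (pathSetoid d β) (interpolate β (fun n => X (n + m)) fun n => w (n + m)) =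
      Quotient.mk (pathSetoid d β) (interpolate β X w) := by
  have : pathSetoid d β |>.r (interpolate β X w)
      (interpolate β (fun n => X (n + m)) fun n => w (n + m)) :=
    ⟨m, fun t => interpolate_shift hβ X w m t⟩
  exact (Quotient.sound this).symm

lemma interpolate_int_mul (hβ : β ≠ 0) (X : ℤ → E d) (w : ℤ → C(ℝ≥0, E d)) (k : ℤ) :
    interpolate β X w (k * β) = X k := by
  have hb : (β : ℝ) ≠ 0 := by simpa using hβ
  simp [interpolate, interpolateFun, bridgePath, mul_div_assoc, div_self hb]

/-- The law of the interlacement obtained by interpolating the trajectory `X`. -/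
noncomputable def interpolationLaw (P₀ : Measure C(ℝ≥0, E d)) (β : ℝ≥0) (X : ℤ → E d) :
    Measure (Interlacement d β) :=
  (Measure.infinitePi fun _ : ℤ => P₀).map
    fun w => Quotient.mk (pathSetoid d β) (interpolate β X w)

lemma measurable_interpolationLaw (P₀ : Measure C(ℝ≥0, E d)) [IsProbabilityMeasure P₀] (β : ℝ≥0) :
    Measurable (interpolationLaw P₀ β) :=
  measurable_map_prodMk (measurable_mk_interlacement.comp measurable_interpolate) _

lemma interpolationLaw_shift (P₀ : Measure C(ℝ≥0, E d)) [IsProbabilityMeasure P₀] (hβ : β ≠ 0)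
    (X : ℤ → E d) (m : ℤ) :
    interpolationLaw P₀ β (fun n => X (n + m)) = interpolationLaw P₀ β X := by
  have hs : Measurable fun (w : ℤ → C(ℝ≥0, E d)) n => w (n + m) :=
    measurable_pi_iff.2 fun n => measurable_pi_apply _
  have hm : ∀ Y : ℤ → E d, Measurable fun w : ℤ → C(ℝ≥0, E d) =>
      Quotient.mk (pathSetoid d β) (interpolate β Y w) := fun Y =>
    (measurable_mk_interlacement.comp measurable_interpolate).comp measurable_prodMk_left
  rw [interpolationLaw, ← map_comp_infinitePi P₀ (add_left_injective m), Measure.map_map (hm _) hs,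
    interpolationLaw]
  congr 1
  · funext w
    exact mk_interpolate_shift hβ X w m

/-- The kernel interpolates the representative chosen by `Quotient.out`. Passing to another one
shifts the family of bridges, which is i.i.d., and the resulting path is the same modulo time shift.
-/
lemma bridgeKernel_mk (P₀ : Measure C(ℝ≥0, E d)) [IsProbabilityMeasure P₀] (hβ : β ≠ 0)
    (X : ℤ → E d) : bridgeKernel P₀ β (Quotient.mk _ X) = interpolationLaw P₀ β X := by
  obtain ⟨m, hm⟩ : ∃ m : ℤ, ∀ n, X n = (Quotient.mk (trajSetoid d) X).out (n + m) :=
    Quotient.exact (Quotient.out_eq (Quotient.mk (trajSetoid d) X))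
  conv_rhs => rw [show X = fun n => (Quotient.mk (trajSetoid d) X).out (n + m) from funext hm]
  rw [interpolationLaw_shift P₀ hβ]
  rfl

lemma measurable_bridgeKernel (P₀ : Measure C(ℝ≥0, E d)) [IsProbabilityMeasure P₀] (hβ : β ≠ 0) :
    Measurable (bridgeKernel P₀ β) := by
  refine measurable_from_quotient.2 ?_
  have : bridgeKernel P₀ β ∘ Quotient.mk'' = interpolationLaw P₀ β :=
    funext fun X => bridgeKernel_mk P₀ hβ X
  rw [this]
  exact measurable_interpolationLaw P₀ β

/-- The interlacements with a particle in `W`. -/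
def hasParticleIn (W : Set (E d)) : Set (Interlacement d β) :=
  Quotient.mk (pathSetoid d β) '' {g | ∃ k : ℤ, g (k * β) ∈ W}

lemma mk_mem_hasParticleIn {W : Set (E d)} {g : C(ℝ, E d)} :
    Quotient.mk (pathSetoid d β) g ∈ hasParticleIn W ↔ ∃ k : ℤ, g (k * β) ∈ W := by
  constructor
  · rintro ⟨f, ⟨k, hk⟩, hfg⟩
    obtain ⟨m, hm⟩ := Quotient.exact hfg
    refine ⟨k - m, ?_⟩
    rw [hm]
    convert hk using 2
    push_cast
    ring
  · exact fun hg => ⟨g, hg, rfl⟩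

lemma measurableSet_hasParticleIn {W : Set (E d)} (hW : MeasurableSet W) :
    MeasurableSet (hasParticleIn (β := β) W) := by
  refine measurableSet_quotient.2 ?_
  have : (Quotient.mk'' : C(ℝ, E d) → Interlacement d β) ⁻¹' hasParticleIn W =
      ⋃ k : ℤ, {g | g (k * β) ∈ W} := by
    ext g
    rw [mem_iUnion]
    exact mk_mem_hasParticleIn
  rw [this]
  exact MeasurableSet.iUnion fun k => (measurable_eval_path _) hW

lemma mk_interpolate_mem_hasParticleIn (hβ : β ≠ 0) {W : Set (E d)} {X : ℤ → E d}
    {w : ℤ → C(ℝ≥0, E d)} :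
    Quotient.mk (pathSetoid d β) (interpolate β X w) ∈ hasParticleIn W ↔ ∃ k, X k ∈ W := by
  simp only [mk_mem_hasParticleIn, interpolate_int_mul hβ]

/-- The intensity measure of the Brownian interlacements, integrated against functions that vanish
on interlacements without particles in a given cube. -/
theorem lintegral_pathIntensity {P₀ : Measure C(ℝ≥0, E d)} (h : IsBrownianLaw P₀)
    (hβ : β ≠ 0) (hd : 3 ≤ d) (N : ℕ) {F : Interlacement d β → ℝ≥0∞} (hF : Measurable F)
    (hF0 : ∀ g ∉ hasParticleIn (box d (N + 1)), F g = 0) :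
    ∫⁻ g, F g ∂(pathIntensity P₀ β) = ∫⁻ X in firstVisit (box d (N + 1)),
      ∫⁻ w, F (Quotient.mk _ (interpolate β X w)) ∂(Measure.infinitePi fun _ : ℤ => P₀)
        ∂(twoSidedLaw d β) := by
  have := h.isProbabilityMeasure
  have hk := measurable_bridgeKernel P₀ hβ
  have hm : ∀ Y : ℤ → E d, Measurable fun w : ℤ → C(ℝ≥0, E d) =>
      Quotient.mk (pathSetoid d β) (interpolate β Y w) := fun Y =>
    (measurable_mk_interlacement.comp measurable_interpolate).comp measurable_prodMk_left
  have hmk : ∀ X : ℤ → E d, ∫⁻ g, F g ∂(bridgeKernel P₀ β (Quotient.mk _ X)) =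
      ∫⁻ w, F (Quotient.mk _ (interpolate β X w)) ∂(Measure.infinitePi fun _ : ℤ => P₀) := by
    intro X
    rw [bridgeKernel_mk P₀ hβ, interpolationLaw, lintegral_map hF (hm X)]
  have hFk : Measurable fun X : Traj d => ∫⁻ g, F g ∂(bridgeKernel P₀ β X) :=
    (Measure.measurable_lintegral hF).comp hk
  rw [pathIntensity, Measure.lintegral_bind hk.aemeasurable hF.aemeasurable,
    lintegral_Upsilon h hβ hd N hFk]
  · simp only [hmk]
  · intro X hX
    induction X using Quotient.inductionOn with
    | h X =>
      rw [hmk]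
      refine (lintegral_congr fun w => hF0 _ ?_).trans lintegral_zero
      rw [mk_interpolate_mem_hasParticleIn hβ]
      exact mt mk_mem_visiting.2 hX

/-- A trajectory that first visits the cube at time `0` is in the cube at time `0`, and its position
at that time is distributed according to Lebesgue measure; the volume of the cube is an upper bound.
-/
lemma pathIntensity_hasParticleIn_lt_top {P₀ : Measure C(ℝ≥0, E d)} (h : IsBrownianLaw P₀)
    (hβ : β ≠ 0) (hd : 3 ≤ d) (N : ℕ) :
    pathIntensity P₀ β (hasParticleIn (box d (N + 1))) < ∞ := by
  have := h.isProbabilityMeasure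
  have hm := measurableSet_hasParticleIn (β := β) (measurableSet_box (d := d) (N + 1))
  rw [← lintegral_indicator_one hm, lintegral_pathIntensity h hβ hd N (measurable_one.indicator hm)
    fun g hg => indicator_of_notMem hg _]
  calc _ ≤ ∫⁻ X in firstVisit (box d (N + 1)), 1 ∂(twoSidedLaw d β) := by
        refine lintegral_mono fun X => ?_
        have h1 : ∀ g : Interlacement d β,
            (hasParticleIn (box d (N + 1))).indicator (1 : Interlacement d β → ℝ≥0∞) g ≤ 1 := fun g =>
          indicator_apply_le' (fun _ => le_rfl) fun _ => zero_le_one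
        refine (lintegral_mono (g := 1) fun w => h1 _).trans ?_
        simp
    _ ≤ ∫⁻ X, (box d (N + 1)).indicator 1 (X 0) ∂(twoSidedLaw d β) := by
        rw [← lintegral_indicator (measurableSet_firstVisit (measurableSet_box _))]
        refine lintegral_mono fun X => ?_
        refine indicator_apply_le' (fun hX => ?_) fun _ => zero_le
        rw [indicator_of_mem hX.1]
        rfl
    _ = ∫⁻ x : E d, (box d (N + 1)).indicator 1 x := by
        have hc : Measurable fun X : ℤ → E d =>
            (box d (N + 1)).indicator (1 : E d → ℝ≥0∞) (X 0) :=
          (measurable_one.indicator (measurableSet_box _)).comp (measurable_pi_apply 0)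
        rw [twoSidedLaw, lintegral_map hc measurable_twoSided]
        simp only [twoSided_zero]
        have hc' : Measurable fun p : E d × (ℤ → E d) =>
            (box d (N + 1)).indicator (1 : E d → ℝ≥0∞) p.1 :=
          (measurable_one.indicator (measurableSet_box _)).comp measurable_fst
        rw [lintegral_prod _ hc'.aemeasurable]
        simp
    _ < ∞ := by
        rw [lintegral_indicator_one (measurableSet_box _)]
        exact (isBounded_box _).measure_lt_top

end Interpolation

/-! ### The law of a concatenation of legs, given its boundary data -/

section Legs

variable {d : ℕ} {β : ℝ≥0}

lemma measurable_finPath_mk (l : ℕ) :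
    Measurable fun c : C(Icc (0 : ℝ≥0) (l * β), E d) => (⟨l, c⟩ : FinPath d β) := fun _ hs =>
  MeasurableSpace.measurableSet_iInf.1 hs l

lemma measurable_finPath_iff {α : Type*} [MeasurableSpace α] {F : FinPath d β → α} :
    Measurable F ↔ ∀ l : ℕ, Measurable fun c : C(Icc (0 : ℝ≥0) (l * β), E d) => F ⟨l, c⟩ := by
  refine ⟨fun h l => h.comp (measurable_finPath_mk l), fun h s hs => ?_⟩
  exact MeasurableSpace.measurableSet_iInf.2 fun l => h l hs

lemma measurableSet_finPath_iff {s : Set (FinPath d β)} :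
    MeasurableSet s ↔
      ∀ l : ℕ, MeasurableSet {c : C(Icc (0 : ℝ≥0) (l * β), E d) | (⟨l, c⟩ : FinPath d β) ∈ s} :=
  MeasurableSpace.measurableSet_iInf

lemma measurable_endpoints : Measurable (endpoints (d := d) (β := β)) := by
  refine measurable_finPath_iff.2 fun l => ?_
  have h : ∀ s : Icc (0 : ℝ≥0) (l * β), Measurable fun c : C(Icc (0 : ℝ≥0) (l * β), E d) => c s :=
    fun s => measurable_eval_path s
  exact (h ⟨0, by simp⟩).prodMk (measurable_const.prodMk (h ⟨l * β, by simp⟩))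

/-- The finite paths whose inner particles are in `W`. -/
def innerIn (W : Set (E d)) : Set (FinPath d β) :=
  {f | ∀ j : ℕ, 1 ≤ j → j < f.1 → f.2 (projIcc 0 (f.1 * β) zero_le (j * β)) ∈ W}

lemma measurableSet_innerIn {W : Set (E d)} (hW : MeasurableSet W) :
    MeasurableSet (innerIn (β := β) W) := by
  refine measurableSet_finPath_iff.2 fun l => ?_
  have : {c : C(Icc (0 : ℝ≥0) (l * β), E d) | (⟨l, c⟩ : FinPath d β) ∈ innerIn W} =
      ⋂ j : ℕ, ⋂ _ : 1 ≤ j, ⋂ _ : j < l,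
        {c | c (projIcc 0 (l * β) zero_le (j * β)) ∈ W} := by
    ext c; simp [innerIn]
  rw [this]
  exact MeasurableSet.iInter fun j => MeasurableSet.iInter fun _ => MeasurableSet.iInter fun _ =>
    (measurable_eval_path _) hW

/-- The projection in `innerIn` only serves to make `j β` a point of the domain; for `j < l` it
changes nothing. -/
lemma mk_mem_innerIn {W : Set (E d)} {l : ℕ} {c : C(Icc (0 : ℝ≥0) (l * β), E d)}
    {γ : ℝ≥0 → E d} (hc : ∀ s, c s = γ s) :
    (⟨l, c⟩ : FinPath d β) ∈ innerIn W ↔ ∀ j : ℕ, 1 ≤ j → j < l → γ (j * β) ∈ W := by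
  have : (⟨l, c⟩ : FinPath d β) ∈ innerIn W ↔
    ∀ j : ℕ, 1 ≤ j → j < l → c (projIcc 0 (l * β) zero_le (j * β)) ∈ W := Iff.rfl
  rw [this]
  refine forall_congr' fun j => imp_congr_right fun _ => imp_congr_right fun hj => ?_
  have hj' : (j : ℝ≥0) * β ∈ Icc 0 ((l : ℝ≥0) * β) :=
    ⟨zero_le, by gcongr⟩
  rw [projIcc_of_mem _ hj', hc]

/-- The event in the definition of `shredLaw`. -/
def bridgeStays (β : ℝ≥0) (W : Set (E d)) (t : E d × ℕ × E d) : Set C(ℝ≥0, E d) :=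
  {w | ∀ j : ℕ, 1 ≤ j → j < t.2.1 → bridgePath (t.2.1 * β) t.1 t.2.2 w (j * β) ∈ W}

lemma measurableSet_setOf_bridgeStays {Ω : Type*} [MeasurableSpace Ω] {W : Set (E d)}
    (hW : MeasurableSet W) (l : ℕ) {x y : Ω → E d} {w : Ω → C(ℝ≥0, E d)} (hx : Measurable x)
    (hy : Measurable y) (hw : Measurable w) :
    MeasurableSet {ω | w ω ∈ bridgeStays β W (x ω, l, y ω)} := by
  have : {ω | w ω ∈ bridgeStays β W (x ω, l, y ω)} = ⋂ j : ℕ, ⋂ _ : 1 ≤ j, ⋂ _ : j < l,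
      {ω | bridgePath (l * β) (x ω) (y ω) (w ω) (j * β) ∈ W} := by
    ext c; simp [bridgeStays]
  rw [this]
  exact MeasurableSet.iInter fun j => MeasurableSet.iInter fun _ => MeasurableSet.iInter fun _ =>
    (measurable_bridgePath_apply _ _ hx hy hw) hW

/-- The bridge with `l` legs from `x` to `y` built from `w`, as a finite path. -/
noncomputable def finBridge (β : ℝ≥0) (l : ℕ) (x y : E d) (w : C(ℝ≥0, E d)) : FinPath d β :=
  ⟨l, (bridgePath (l * β) x y w).restrict (Icc 0 (l * β))⟩

lemma measurable_finBridge {Ω : Type*} [MeasurableSpace Ω] (l : ℕ) {x y : Ω → E d}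
    {w : Ω → C(ℝ≥0, E d)} (hx : Measurable x) (hy : Measurable y) (hw : Measurable w) :
    Measurable fun ω => finBridge β l (x ω) (y ω) (w ω) :=
  (measurable_finPath_mk l).comp
    (measurable_path_iff.2 fun _ => measurable_bridgePath_apply _ _ hx hy hw)

lemma endpoints_finBridge (hβ : β ≠ 0) {l : ℕ} (hl : l ≠ 0) (x y : E d) (w : C(ℝ≥0, E d)) :
    endpoints (finBridge β l x y w) = (x, l, y) := by
  have h : ((l : ℝ) * (β : ℝ)) ≠ 0 := by positivity
  have h0 : bridgePath (l * β) x y w 0 = x := by simp [bridgePath]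
  have h1 : bridgePath (l * β) x y w (l * β) = y := by simp [bridgePath, div_self h]
  exact Prod.ext h0 (Prod.ext rfl h1)

lemma finBridge_mem_innerIn {W : Set (E d)} {l : ℕ} {x y : E d} {w : C(ℝ≥0, E d)} :
    finBridge β l x y w ∈ innerIn W ↔ w ∈ bridgeStays β W (x, l, y) :=
  mk_mem_innerIn fun _ => rfl

lemma measurable_finBridge_right (l : ℕ) (x y : E d) : Measurable (finBridge β l x y) :=
  measurable_finBridge l measurable_const measurable_const measurable_id

variable {P₀ : Measure C(ℝ≥0, E d)} {W : Set (E d)}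

lemma shredLaw_mk (P₀ : Measure C(ℝ≥0, E d)) (W : Set (E d)) (x y : E d) (l : ℕ) :
    shredLaw P₀ β W (x, l, y) =
      (P₀[|bridgeStays β W (x, l, y)]).map (finBridge β l x y) := rfl

lemma measurable_boundary_iff {α : Type*} [MeasurableSpace α] {F : E d × ℕ × E d → α}
    (h : ∀ l : ℕ, Measurable fun q : E d × E d => F (q.1, l, q.2)) : Measurable F := by
  have h1 : Measurable fun p : ℕ × (E d × E d) => F (p.2.1, p.1, p.2.2) :=
    measurable_from_prod_countable_right h
  exact h1.comp ((measurable_fst.comp measurable_snd).prodMk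
    (measurable_fst.prodMk (measurable_snd.comp measurable_snd)))

lemma measurable_shredLaw (P₀ : Measure C(ℝ≥0, E d)) [IsProbabilityMeasure P₀]
    (hW : MeasurableSet W) : Measurable (shredLaw P₀ β W) := by
  refine measurable_boundary_iff fun l => Measure.measurable_of_measurable_coe _ fun s hs => ?_
  have hb := measurable_finBridge (β := β) l
    (measurable_fst.comp measurable_fst : Measurable fun p : (E d × E d) × C(ℝ≥0, E d) => p.1.1)
    (measurable_snd.comp measurable_fst) measurable_snd
  have hd := measurableSet_setOf_bridgeStays (β := β) hW l
    (measurable_fst.comp measurable_fst : Measurable fun p : (E d × E d) × C(ℝ≥0, E d) => p.1.1)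
    (measurable_snd.comp measurable_fst) measurable_snd
  have h1 : ∀ q : E d × E d, shredLaw P₀ β W (q.1, l, q.2) s =
      (P₀ (bridgeStays β W (q.1, l, q.2)))⁻¹ *
        P₀ (bridgeStays β W (q.1, l, q.2) ∩ finBridge β l q.1 q.2 ⁻¹' s) := fun q => by
    rw [shredLaw_mk, Measure.map_apply (measurable_finBridge_right l _ _) hs,
      cond_apply (s := bridgeStays β W (q.1, l, q.2)) (measurable_prodMk_left (x := q) hd)]
  simp only [h1]
  exact (measurable_measure_prodMk_left hd).inv.mul
    (measurable_measure_prodMk_left (hd.inter (hb hs)))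

lemma shredLaw_univ_le_one (P₀ : Measure C(ℝ≥0, E d)) (W : Set (E d)) (t : E d × ℕ × E d) :
    shredLaw P₀ β W t univ ≤ 1 := by
  obtain ⟨x, l, y⟩ := t
  rw [shredLaw_mk, Measure.map_apply (measurable_finBridge_right l _ _) MeasurableSet.univ]
  exact (measure_mono (subset_univ _)).trans (cond_univ_le_one _ _)

/-- Undoes the normalisation in the conditioning. If the event is null, both sides are zero. -/
lemma setLIntegral_bridgeStays [IsProbabilityMeasure P₀] (x y : E d) (l : ℕ)
    {φ : FinPath d β → ℝ≥0∞} (hφ : Measurable φ) :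
    ∫⁻ w in bridgeStays β W (x, l, y), φ (finBridge β l x y w) ∂P₀ =
      P₀ (bridgeStays β W (x, l, y)) * ∫⁻ f, φ f ∂(shredLaw P₀ β W (x, l, y)) := by
  rw [shredLaw_mk, lintegral_map hφ (measurable_finBridge_right l _ _), ProbabilityTheory.cond, lintegral_smul_measure, smul_eq_mul, ← mul_assoc]
  by_cases h0 : P₀ (bridgeStays β W (x, l, y)) = 0
  · rw [Measure.restrict_eq_zero.2 h0]
    simp
  · rw [ENNReal.mul_inv_cancel h0 (measure_ne_top _ _), one_mul]

/-- The path with `l` legs that starts at `y` and has increments `ω`. -/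
noncomputable def legPath (β : ℝ≥0) (l : ℕ) (y : E d) (ω : ℕ → E d × C(ℝ≥0, E d)) :
    FinPath d β :=
  ⟨l, ⟨fun s => y + concatLegs β l s ω, by
    unfold concatLegs leg
    refine continuous_const.add (continuous_finsetSum _ fun i _ => (map_continuous _).comp ?_)
    exact (continuous_subtype_val.sub continuous_const).min continuous_const⟩⟩

lemma measurable_concatLegs (l : ℕ) (s : ℝ≥0) : Measurable (concatLegs (d := d) β l s) :=
  Finset.measurable_sum _ fun i _ => (measurable_leg _ _).comp (measurable_pi_apply i)

lemma measurable_legPath {Ω : Type*} [MeasurableSpace Ω] (l : ℕ) {y : Ω → E d}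
    {ω : Ω → ℕ → E d × C(ℝ≥0, E d)} (hy : Measurable y) (hω : Measurable ω) :
    Measurable fun a => legPath β l (y a) (ω a) :=
  (measurable_finPath_mk l).comp
    (measurable_path_iff.2 fun _ => hy.add ((measurable_concatLegs l _).comp hω))

lemma leg_zero (T : ℝ≥0) (p : E d × C(ℝ≥0, E d)) : leg T 0 p = 0 := by
  simp [leg, bridgePath]

lemma leg_of_le {T s : ℝ≥0} (hT : T ≠ 0) (h : T ≤ s) (p : E d × C(ℝ≥0, E d)) :
    leg T s p = p.1 := by
  have hT' : (T : ℝ) ≠ 0 := by simpa using hT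
  simp [leg, bridgePath, min_eq_right h, div_self hT']

/-- At the grid time `j β` the legs before the `j`-th are complete and the others have not started.
-/
lemma add_concatLegs_natCast_mul (hβ : β ≠ 0) {l j : ℕ} (hj : j ≤ l) (y : E d)
    (ω : ℕ → E d × C(ℝ≥0, E d)) :
    y + concatLegs β l (j * β) ω = walk y (fun i => (ω i).1) j := by
  rw [concatLegs, walk, ← Finset.sum_range_add_sum_Ico _ hj]
  have h2 : ∑ i ∈ Finset.Ico j l, leg β ((j : ℝ≥0) * β - i * β) (ω i) = 0 := by
    refine Finset.sum_eq_zero fun i hi => ?_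
    have : (j : ℝ≥0) * β ≤ i * β := by
      gcongr; exact_mod_cast (Finset.mem_Ico.1 hi).1
    rw [tsub_eq_zero_of_le this, leg_zero]
  rw [h2, add_zero]
  congr 1
  refine Finset.sum_congr rfl fun i hi => leg_of_le hβ ?_ _
  have h1 : ((i : ℝ≥0) + 1) ≤ j := by exact_mod_cast Finset.mem_range.1 hi
  refine le_tsub_of_add_le_right ?_
  calc β + i * β = (i + 1) * β := by ring
    _ ≤ j * β := by gcongr

lemma endpoints_legPath (hβ : β ≠ 0) (l : ℕ) (y : E d) (ω : ℕ → E d × C(ℝ≥0, E d)) :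
    endpoints (legPath β l y ω) = (y, l, walk y (fun i => (ω i).1) l) := by
  have h0 := add_concatLegs_natCast_mul hβ (zero_le (a := l)) y ω
  have h1 := add_concatLegs_natCast_mul hβ (le_refl l) y ω
  simp only [Nat.cast_zero, zero_mul] at h0
  exact Prod.ext (h0.trans (by simp [walk])) (Prod.ext rfl h1)

lemma legPath_mem_innerIn (hβ : β ≠ 0) {l : ℕ} {y : E d} {ω : ℕ → E d × C(ℝ≥0, E d)} :
    legPath β l y ω ∈ innerIn W ↔
      ∀ j : ℕ, 1 ≤ j → j < l → walk y (fun i => (ω i).1) j ∈ W := by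
  refine (mk_mem_innerIn (γ := fun s => y + concatLegs β l s ω) fun _ => rfl).trans ?_
  refine forall_congr' fun j => imp_congr_right fun _ => imp_congr_right fun hj => ?_
  rw [add_concatLegs_natCast_mul hβ hj.le]

lemma ext_path {X : Type*} [TopologicalSpace X] {μ ν : Measure C(X, E d)}
    (h : μ.map (fun f t => f t) = ν.map fun f t => f t) : μ = ν := by
  have hm : Measurable fun (f : C(X, E d)) (t : X) => f t := comap_measurable _
  ext s hs
  obtain ⟨t, ht, rfl⟩ := hs
  rw [← Measure.map_apply hm ht, h, Measure.map_apply hm ht]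

/-- `map_concatLegs`, translated by `x` and restricted to `[0, l β]`. The path `σ`-algebra is
generated by the evaluations, so equality of the laws of all evaluations is enough. -/
lemma IsBrownianLaw.map_legPath (h : IsBrownianLaw P₀) (hβ : β ≠ 0) {l : ℕ} (hl : l ≠ 0)
    (x : E d) :
    (Measure.infinitePi fun _ : ℕ => stepLaw P₀ β).map (legPath β l x) =
      (stepLaw P₀ (l * β)).map fun p => finBridge β l x (x + p.1) p.2 := by
  let F : (ℕ → E d × C(ℝ≥0, E d)) → C(Icc (0 : ℝ≥0) (l * β), E d) := fun ω => (legPath β l x ω).2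
  let G : E d × C(ℝ≥0, E d) → C(Icc (0 : ℝ≥0) (l * β), E d) := fun p =>
    (bridgePath (l * β) x (x + p.1) p.2).restrict (Icc 0 (l * β))
  have hF : Measurable F := measurable_path_iff.2 fun t =>
    measurable_const.add (measurable_concatLegs l _)
  have hG : Measurable G := measurable_path_iff.2 fun t =>
    measurable_bridgePath_apply _ _ measurable_const (measurable_const.add measurable_fst)
      measurable_snd
  have hm : Measurable fun (f : C(Icc (0 : ℝ≥0) (l * β), E d)) t => f t := comap_measurable _
  have key : (Measure.infinitePi fun _ : ℕ => stepLaw P₀ β).map F = (stepLaw P₀ (l * β)).map G := by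
    refine ext_path ?_
    rw [Measure.map_map hm hF, Measure.map_map hm hG]
    have hr : Measurable fun (q : ℝ≥0 → E d) (t : Icc (0 : ℝ≥0) (l * β)) => x + q t :=
      measurable_pi_iff.2 fun t => measurable_const.add (measurable_pi_apply _)
    have h1 := congrArg (Measure.map fun (q : ℝ≥0 → E d) (t : Icc (0 : ℝ≥0) (l * β)) => x + q t)
      (h.map_concatLegs hβ hl)
    rw [Measure.map_map hr (measurable_pi_iff.2 fun s => measurable_concatLegs l s),
      Measure.map_map hr (measurable_pi_iff.2 fun s => measurable_leg _ s)] at h1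
    have hGe : (fun (f : C(Icc (0 : ℝ≥0) (l * β), E d)) t => f t) ∘ G =
        (fun (q : ℝ≥0 → E d) (t : Icc (0 : ℝ≥0) (l * β)) => x + q t) ∘
          fun p s => leg (l * β) s p := by
      funext p t
      have ht : min (t : ℝ≥0) (l * β) = t := min_eq_left t.2.2
      simp only [Function.comp, leg, ht, G, ContinuousMap.restrict_apply, bridgePath,
        ContinuousMap.coe_mk]
      rw [show x + (p.2 (l * β) - p.2 0) - (x + p.1) = 0 + (p.2 (l * β) - p.2 0) - p.1 by abel,
        zero_add, zero_add, add_sub_assoc]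
    rw [hGe]
    exact h1
  have h2 := congrArg (Measure.map fun c => (⟨l, c⟩ : FinPath d β)) key
  rwa [Measure.map_map (measurable_finPath_mk l) hF,
    Measure.map_map (measurable_finPath_mk l) hG] at h2

/-- Given its endpoints, and given that its inner particles are in `W`, the concatenation of `l`
legs has the law `shredLaw`. -/
theorem IsBrownianLaw.setLIntegral_innerIn_legPath (h : IsBrownianLaw P₀) (hβ : β ≠ 0) {l : ℕ}
    (hl : l ≠ 0) (x : E d) (hW : MeasurableSet W) {φ : FinPath d β → ℝ≥0∞} (hφ : Measurable φ)
    {ψ : E d × ℕ × E d → ℝ≥0∞} (hψ : Measurable ψ) :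
    ∫⁻ f in innerIn W, φ f * ψ (endpoints f)
        ∂((Measure.infinitePi fun _ : ℕ => stepLaw P₀ β).map (legPath β l x)) =
      ∫⁻ f in innerIn W, (∫⁻ f', φ f' ∂(shredLaw P₀ β W (endpoints f))) * ψ (endpoints f)
        ∂((Measure.infinitePi fun _ : ℕ => stepLaw P₀ β).map (legPath β l x)) := by
  have := h.isProbabilityMeasure
  have hi := measurableSet_innerIn (β := β) hW
  have hB : Measurable fun p : E d × C(ℝ≥0, E d) => finBridge β l x (x + p.1) p.2 :=
    measurable_finBridge l measurable_const (measurable_const.add measurable_fst) measurable_snd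
  have hΦ : Measurable fun f : FinPath d β => ∫⁻ f', φ f' ∂(shredLaw P₀ β W (endpoints f)) :=
    (Measure.measurable_lintegral hφ).comp ((measurable_shredLaw P₀ hW).comp measurable_endpoints)
  -- After replacing the chain of legs by one bridge, the integral is disintegrated over the total
  -- displacement `η`. For fixed `η` the boundary data are constant and `ψ` factors out.
  have key : ∀ χ : FinPath d β → ℝ≥0∞, Measurable χ → ∫⁻ f in innerIn W, χ f * ψ (endpoints f)
      ∂((Measure.infinitePi fun _ : ℕ => stepLaw P₀ β).map (legPath β l x)) =
      ∫⁻ η, (∫⁻ w in bridgeStays β W (x, l, x + η), χ (finBridge β l x (x + η) w) ∂P₀) *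
        ψ (x, l, x + η) ∂(gaussianStep d (l * β)) := by
    intro χ hχ
    have hχψ : Measurable fun f => χ f * ψ (endpoints f) := hχ.mul (hψ.comp measurable_endpoints)
    have hc : Measurable fun p : E d × C(ℝ≥0, E d) =>
        (innerIn W).indicator (fun f => χ f * ψ (endpoints f)) (finBridge β l x (x + p.1) p.2) :=
      (hχψ.indicator hi).comp hB
    rw [← lintegral_indicator hi, h.map_legPath hβ hl, lintegral_map (hχψ.indicator hi) hB, stepLaw,
      lintegral_prod _ hc.aemeasurable]
    refine lintegral_congr fun η => ?_
    have hb : Measurable fun w => χ (finBridge β l x (x + η) w) :=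
      hχ.comp (measurable_finBridge_right l _ _)
    have hD : MeasurableSet (bridgeStays β W (x, l, x + η)) :=
      measurableSet_setOf_bridgeStays (β := β) hW l measurable_const measurable_const measurable_id
    rw [← lintegral_mul_const _ hb, ← lintegral_indicator hD]
    refine lintegral_congr fun w => ?_
    by_cases hw : w ∈ bridgeStays β W (x, l, x + η)
    · rw [indicator_of_mem hw, indicator_of_mem (finBridge_mem_innerIn.2 hw),
        endpoints_finBridge hβ hl]
    · rw [indicator_of_notMem hw, indicator_of_notMem (mt finBridge_mem_innerIn.1 hw)]
  rw [key φ hφ, key _ hΦ]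
  refine lintegral_congr fun η => ?_
  congr 1
  -- Both sides become the probability of `bridgeStays` times the mean of `φ` under `shredLaw`: on
  -- the right the integrand depends only on the endpoints of the bridge and is constant in `w`.
  rw [setLIntegral_bridgeStays _ _ _ hφ]
  simp only [endpoints_finBridge hβ hl]
  rw [setLIntegral_const, mul_comm]

end Legs

/-! ### Resampling the shreds of a one-sided interpolated walk -/

section Forward

variable {d : ℕ} {β : ℝ≥0}

/-- An increment of the walk together with the Brownian path used for interpolation. -/
abbrev Incr (d : ℕ) : Type := E d × C(ℝ≥0, E d)

/-- Independent increments with their interpolating Brownian paths. -/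
noncomputable def incrLaw (P₀ : Measure C(ℝ≥0, E d)) (β : ℝ≥0) : Measure (ℕ → Incr d) :=
  Measure.infinitePi fun _ : ℕ => stepLaw P₀ β

/-- The position at time `n` of the walk with start `x` and increments `ω`. -/
def pos (x : E d) (ω : ℕ → Incr d) (n : ℕ) : E d := walk x (fun i => (ω i).1) n

/-- Forget the first `m` increments. -/
def shift (m : ℕ) (ω : ℕ → Incr d) : ℕ → Incr d := fun i => ω (i + m)

lemma measurable_shift (m : ℕ) : Measurable (shift (d := d) m) :=
  measurable_pi_iff.2 fun _ => measurable_pi_apply _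

@[simp] lemma pos_zero (x : E d) (ω : ℕ → Incr d) : pos x ω 0 = x := by simp [pos, walk]

lemma pos_shift (x : E d) (ω : ℕ → Incr d) (m n : ℕ) :
    pos (pos x ω m) (shift m ω) n = pos x ω (n + m) := by
  simp only [pos, walk, shift]
  rw [add_comm n m, Finset.sum_range_add, add_assoc]
  simp only [add_comm m]

lemma shift_shift (ω : ℕ → Incr d) (m k : ℕ) : shift k (shift m ω) = shift (k + m) ω := by
  funext i; simp [shift, add_assoc]

lemma pos_congr {x : E d} {ω ω' : ℕ → Incr d} {n : ℕ} (h : ∀ i < n, ω i = ω' i) :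
    pos x ω n = pos x ω' n := by
  simp only [pos, walk]
  congr 1
  exact Finset.sum_congr rfl fun i hi => by rw [h i (Finset.mem_range.1 hi)]

lemma legPath_congr {x : E d} {ω ω' : ℕ → Incr d} {n : ℕ} (h : ∀ i < n, ω i = ω' i) :
    legPath β n x ω = legPath β n x ω' := by
  simp only [legPath, concatLegs]
  congr 2
  funext s
  congr 1
  exact Finset.sum_congr rfl fun i hi => by rw [h i (Finset.mem_range.1 hi)]

lemma measurable_pos (n : ℕ) : Measurable fun p : E d × (ℕ → Incr d) => pos p.1 p.2 n :=
  (measurable_pi_apply n).comp (measurable_walk.comp (measurable_fst.prodMk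
    (measurable_pi_iff.2 fun i => measurable_fst.comp
      ((measurable_pi_apply i).comp measurable_snd))))

/-- The walk with start `x` and increments `ω` has a `W`-shred with `l` legs from time `k` on (where
a shred may start at time `0` without further condition). -/
def ShredAt (W : Set (E d)) (x : E d) (ω : ℕ → Incr d) (k l : ℕ) : Prop :=
  1 ≤ l ∧ (k = 0 ∨ pos x ω (k - 1) ∉ W) ∧ (∀ j < l, pos x ω (j + k) ∈ W) ∧ pos x ω (l + k) ∉ W

lemma measurableSet_shredAt {W : Set (E d)} (hW : MeasurableSet W) (k l : ℕ) :
    MeasurableSet {p : E d × (ℕ → Incr d) | ShredAt W p.1 p.2 k l} := by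
  have h : ∀ n, MeasurableSet {p : E d × (ℕ → Incr d) | pos p.1 p.2 n ∈ W} := fun n =>
    measurable_pos n hW
  refine (MeasurableSet.const _).inter (((MeasurableSet.const _).union (h _).compl).inter
    (MeasurableSet.inter ?_ (h _).compl))
  have : {p : E d × (ℕ → Incr d) | ∀ j < l, pos p.1 p.2 (j + k) ∈ W} =
      ⋂ j : ℕ, ⋂ _ : j < l, {p | pos p.1 p.2 (j + k) ∈ W} := by
    ext p; simp
  have h2 : MeasurableSet {p : E d × (ℕ → Incr d) | ∀ j < l, pos p.1 p.2 (j + k) ∈ W} := by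
    rw [this]
    exact MeasurableSet.iInter fun j => MeasurableSet.iInter fun _ => h _
  exact h2

open Classical in
/-- The value of `f` at the shred with `l` legs that starts at time `k` if there is one and if it
ends before time `n`. -/
noncomputable def shredTerm (β : ℝ≥0) (W : Set (E d)) (f : FinPath d β → ℝ≥0∞) (n : ℕ∞) (x : E d)
    (ω : ℕ → Incr d) (k l : ℕ) : ℝ≥0∞ :=
  if ShredAt W x ω k l ∧ ((l + k : ℕ) : ℕ∞) ≤ n then
    f (legPath β l (pos x ω k) (shift k ω)) else 0

/-- The sum of `f` over the shreds, up to the time `n`, of the interpolated walk. -/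
noncomputable def shredSum (β : ℝ≥0) (W : Set (E d)) (f : FinPath d β → ℝ≥0∞) (n : ℕ∞) (x : E d)
    (ω : ℕ → Incr d) : ℝ≥0∞ :=
  ∑' k : ℕ, ∑' l : ℕ, shredTerm β W f n x ω k l

variable {W : Set (E d)} {f : FinPath d β → ℝ≥0∞}

lemma measurable_shredSum (hW : MeasurableSet W) (hf : Measurable f) (n : ℕ∞) :
    Measurable fun p : E d × (ℕ → Incr d) => shredSum β W f n p.1 p.2 := by
  refine Measurable.tsum fun k => Measurable.tsum fun l => ?_
  refine Measurable.ite ((measurableSet_shredAt hW k l).inter (MeasurableSet.const _)) ?_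
    measurable_const
  exact hf.comp (measurable_legPath l (measurable_pos k) ((measurable_shift k).comp measurable_snd))

lemma natCast_add_le_add_iff (a m : ℕ) (n : ℕ∞) : ((a + m : ℕ) : ℕ∞) ≤ n + m ↔ (a : ℕ∞) ≤ n := by
  induction n using ENat.recTopCoe with
  | top => simp
  | coe n => norm_cast; omega

/-- A restart at time `m`. The hypothesis is there for shreds that start exactly at `m`: `ShredAt`
imposes no condition before time `0`, so the restarted walk would see a spurious shred if the walk
were in `W` at both `m - 1` and `m`. -/
lemma tsum_shredAt_add {m : ℕ} {x : E d} {ω : ℕ → Incr d}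
    (h : pos x ω (m - 1) ∉ W ∨ pos x ω m ∉ W) (n : ℕ∞) :
    ∑' k : ℕ, ∑' l : ℕ, shredTerm β W f (n + m) x ω (k + m) l =
      shredSum β W f n (pos x ω m) (shift m ω) := by
  refine tsum_congr fun k => tsum_congr fun l => ?_
  have h1 : ShredAt W x ω (k + m) l ↔ ShredAt W (pos x ω m) (shift m ω) k l := by
    simp only [ShredAt, pos_shift, add_assoc]
    rcases k with _ | k
    · simp only [zero_add, true_or, true_and]
      refine and_congr_right fun hl => ?_
      constructor
      · exact fun h => h.2
      · refine fun h' => ⟨?_, h'⟩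
        have := h'.1 0 (by omega)
        rw [zero_add] at this
        exact Or.inr (h.resolve_right (not_not.2 this))
    · rw [show k + 1 + m - 1 = k + 1 - 1 + m by omega]
      simp
  have h2 : ((l + (k + m) : ℕ) : ℕ∞) ≤ n + m ↔ ((l + k : ℕ) : ℕ∞) ≤ n := by
    rw [← add_assoc]; exact natCast_add_le_add_iff _ _ _
  have h3 := and_congr h1 h2
  rw [shredTerm, shredTerm, pos_shift, shift_shift]
  by_cases h4 : ShredAt W x ω (k + m) l ∧ ((l + (k + m) : ℕ) : ℕ∞) ≤ n + m
  · rw [if_pos h4, if_pos (h3.1 h4)]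
  · rw [if_neg h4, if_neg (mt h3.2 h4)]

lemma shredSum_of_notMem {x : E d} (hx : x ∉ W) (n : ℕ∞) (ω : ℕ → Incr d) :
    shredSum β W f (n + 1) x ω = shredSum β W f n (pos x ω 1) (shift 1 ω) := by
  have h0 : ∀ l, shredTerm β W f (n + 1) x ω 0 l = 0 := fun l =>
    if_neg fun hl => hx (by simpa using hl.1.2.2.1 0 hl.1.1)
  have h1 := tsum_shredAt_add (f := f) (Or.inl (by simpa using hx) :
    pos x ω (1 - 1) ∉ W ∨ pos x ω 1 ∉ W) n
  rw [← h1, shredSum, ← ENNReal.summable.sum_add_tsum_nat_add' (k := 1)]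
  simp [h0]

/-- Before the exit time `m` a shred can start only at time `0`, since later its predecessor is in
`W`, and it can only have `m` legs. The rest is seen by the walk restarted at the exit. -/
lemma shredSum_of_exit {x : E d} {m : ℕ} (hm : m ≠ 0) {ω : ℕ → Incr d}
    (hin : ∀ j < m, pos x ω j ∈ W) (hout : pos x ω m ∉ W) (n : ℕ∞) :
    shredSum β W f (n + m) x ω =
      f (legPath β m x ω) + shredSum β W f n (pos x ω m) (shift m ω) := by
  rw [← tsum_shredAt_add (Or.inr hout), shredSum,
    ← ENNReal.summable.sum_add_tsum_nat_add' (k := m)]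
  congr 1
  rw [Finset.sum_eq_single_of_mem 0 (Finset.mem_range.2 (by omega)), tsum_eq_single m]
  · have : ShredAt W x ω 0 m := ⟨by omega, Or.inl rfl, by simpa using hin, by simpa using hout⟩
    rw [shredTerm, if_pos ⟨this, by simp⟩, pos_zero]
    rfl
  · intro l hl
    refine if_neg fun h => ?_
    obtain ⟨h1, -, h2, h3⟩ := h.1
    rcases lt_or_gt_of_ne hl with h | h
    · exact h3 (by simpa using hin l h)
    · exact hout (by simpa using h2 m h)
  · intro k hk hk0
    refine ENNReal.tsum_eq_zero.2 fun l => if_neg fun h => ?_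
    rcases h.1.2.1 with h | h
    · exact hk0 h
    · exact h (hin _ (by have := Finset.mem_range.1 hk; omega))

/-- A shred counts only if it has ended by time `n`, and it ends outside `W` at a time at least `1`.
The starting point is irrelevant. -/
lemma shredSum_of_forall_mem {x : E d} {n : ℕ} {ω : ℕ → Incr d}
    (hin : ∀ j, 1 ≤ j → j ≤ n → pos x ω j ∈ W) : shredSum β W f n x ω = 0 := by
  refine ENNReal.tsum_eq_zero.2 fun k => ENNReal.tsum_eq_zero.2 fun l => if_neg fun h => ?_
  obtain ⟨⟨h1, -, -, h3⟩, h4⟩ := h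
  have h4 : l + k ≤ n := by exact_mod_cast h4
  exact h3 (hin _ (by omega) h4)

/-- Monotone convergence for the counting measure on pairs of start time and length: each term is
eventually constant in the horizon. -/
lemma tendsto_shredSum (x : E d) (ω : ℕ → Incr d) :
    Tendsto (fun n : ℕ => shredSum β W f n x ω) atTop (𝓝 (shredSum β W f ⊤ x ω)) := by
  have h : ∀ n : ℕ∞, shredSum β W f n x ω =
      ∫⁻ p : ℕ × ℕ, shredTerm β W f n x ω p.1 p.2 ∂Measure.count := fun n => by
    rw [lintegral_count, shredSum]
    exact ENNReal.tsum_prod.symm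
  simp only [h]
  refine lintegral_tendsto_of_tendsto_of_monotone (fun n => (Measurable.of_discrete).aemeasurable)
    (ae_of_all _ fun p m n hmn => ?_) (ae_of_all _ fun p => ?_)
  · dsimp only [shredTerm]
    split_ifs with h1 h2
    · exact le_rfl
    · exact absurd ⟨h1.1, h1.2.trans (by exact_mod_cast hmn)⟩ h2
    · exact zero_le
    · exact le_rfl
  · refine tendsto_const_nhds.congr' ?_
    filter_upwards [eventually_ge_atTop (p.2 + p.1)] with n hn
    have : ((p.2 + p.1 : ℕ) : ℕ∞) ≤ n := by exact_mod_cast hn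
    have h2 : ((p.2 + p.1 : ℕ) : ℕ∞) ≤ ⊤ := le_top
    unfold shredTerm
    by_cases h3 : ShredAt W x ω p.1 p.2
    · rw [if_pos ⟨h3, h2⟩, if_pos ⟨h3, this⟩]
    · rw [if_neg fun h => h3 h.1, if_neg fun h => h3 h.1]

variable {P₀ : Measure C(ℝ≥0, E d)}

lemma isProbabilityMeasure_stepLaw [IsProbabilityMeasure P₀] :
    IsProbabilityMeasure (stepLaw P₀ β) := by unfold stepLaw; infer_instance

lemma isProbabilityMeasure_incrLaw [IsProbabilityMeasure P₀] :
    IsProbabilityMeasure (incrLaw P₀ β) := by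
  have := isProbabilityMeasure_stepLaw (P₀ := P₀) (β := β)
  unfold incrLaw; infer_instance

/-- The Markov property at a deterministic time. -/
lemma lintegral_incrLaw_splice [IsProbabilityMeasure P₀] (l : ℕ)
    {H : (ℕ → Incr d) × (ℕ → Incr d) → ℝ≥0∞} (hH : Measurable H)
    (hdep : ∀ ω ω' η, (∀ i < l, ω i = ω' i) → H (ω, η) = H (ω', η)) :
    ∫⁻ ω, H (ω, shift l ω) ∂(incrLaw P₀ β) =
      ∫⁻ ω, ∫⁻ η, H (ω, η) ∂(incrLaw P₀ β) ∂(incrLaw P₀ β) := by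
  have := isProbabilityMeasure_stepLaw (P₀ := P₀) (β := β)
  have := isProbabilityMeasure_incrLaw (P₀ := P₀) (β := β)
  let e : ℕ → ℕ ⊕ ℕ := fun i => if i < l then Sum.inl i else Sum.inr (i - l)
  have he : Function.Injective e := by
    intro i j h
    simp only [e] at h
    split_ifs at h with h1 h2 h2
    · exact Sum.inl.inj h
    · have := Sum.inr.inj h
      omega
  have hm : Measurable fun (p : (ℕ → Incr d) × (ℕ → Incr d)) i => Sum.elim p.1 p.2 (e i) := by
    refine measurable_pi_iff.2 fun i => ?_
    simp only [e]
    split_ifs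
    · exact (measurable_pi_apply i).comp measurable_fst
    · exact (measurable_pi_apply (i - l)).comp measurable_snd
  have hc : Measurable fun ω : ℕ → Incr d => H (ω, shift l ω) :=
    hH.comp (measurable_id.prodMk (measurable_shift l))
  have hmap := map_sumElim_comp_infinitePi (stepLaw P₀ β) he
  conv_lhs => rw [incrLaw, ← hmap]
  rw [lintegral_map hc hm, ← lintegral_prod _ hH.aemeasurable]
  refine lintegral_congr fun p => ?_
  have h1 : shift l (fun i => Sum.elim p.1 p.2 (e i)) = p.2 := by
    funext i
    simp [shift, e]
  rw [h1]
  exact hdep _ _ _ fun i hi => by simp [e, hi]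

/-- The function of the boundary data with `expNeg (resample f t) = ∫ expNeg f ∂(shredLaw t)`. -/
noncomputable def resample (P₀ : Measure C(ℝ≥0, E d)) (W : Set (E d)) (f : FinPath d β → ℝ≥0∞)
    (t : E d × ℕ × E d) : ℝ≥0∞ :=
  negLog (∫⁻ γ, expNeg (f γ) ∂(shredLaw P₀ β W t))

lemma measurable_resample [IsProbabilityMeasure P₀] (hW : MeasurableSet W) (hf : Measurable f) :
    Measurable (resample P₀ W f) :=
  measurable_negLog.comp ((Measure.measurable_lintegral (measurable_expNeg.comp hf)).comp
    (measurable_shredLaw P₀ hW))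

lemma expNeg_resample (P₀ : Measure C(ℝ≥0, E d)) (W : Set (E d)) (f : FinPath d β → ℝ≥0∞)
    (t : E d × ℕ × E d) :
    expNeg (resample P₀ W f t) = ∫⁻ γ, expNeg (f γ) ∂(shredLaw P₀ β W t) := by
  refine expNeg_negLog ?_
  calc ∫⁻ γ, expNeg (f γ) ∂(shredLaw P₀ β W t) ≤ ∫⁻ _γ, 1 ∂(shredLaw P₀ β W t) :=
        lintegral_mono fun γ => expNeg_le_one _
    _ ≤ 1 := by rw [lintegral_one]; exact shredLaw_univ_le_one P₀ W t

/-- The Laplace functional of the shreds of the walk up to time `n`. -/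
noncomputable def shredLaplace (P₀ : Measure C(ℝ≥0, E d)) (W : Set (E d)) (f : FinPath d β → ℝ≥0∞)
    (n : ℕ∞) (x : E d) : ℝ≥0∞ :=
  ∫⁻ ω, expNeg (shredSum β W f n x ω) ∂(incrLaw P₀ β)

lemma measurable_expNeg_shredSum (hW : MeasurableSet W) (hf : Measurable f) (n : ℕ∞) :
    Measurable fun p : E d × (ℕ → Incr d) => expNeg (shredSum β W f n p.1 p.2) :=
  measurable_expNeg.comp (measurable_shredSum hW hf n)

lemma measurable_expNeg_shredSum_right (hW : MeasurableSet W) (hf : Measurable f) (n : ℕ∞)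
    (x : E d) : Measurable fun ω : ℕ → Incr d => expNeg (shredSum β W f n x ω) := by
  have hp : Measurable fun ω : ℕ → Incr d => (x, ω) := measurable_prodMk_left
  have h1 := (measurable_shredSum hW hf n).comp hp
  exact measurable_expNeg.comp h1

lemma measurable_shredLaplace [IsProbabilityMeasure P₀] (hW : MeasurableSet W) (hf : Measurable f)
    (n : ℕ∞) : Measurable (shredLaplace P₀ W f n) := by
  have := isProbabilityMeasure_incrLaw (P₀ := P₀) (β := β)
  exact (measurable_expNeg_shredSum hW hf n).lintegral_prod_right'

lemma shredLaplace_of_notMem [IsProbabilityMeasure P₀] (hW : MeasurableSet W) (hf : Measurable f)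
    (n : ℕ∞) {x : E d} (hx : x ∉ W) :
    shredLaplace P₀ W f (n + 1) x =
      ∫⁻ ω, shredLaplace P₀ W f n (pos x ω 1) ∂(incrLaw P₀ β) := by
  have hp : Measurable fun p : (ℕ → Incr d) × (ℕ → Incr d) => (pos x p.1 1, p.2) :=
    ((measurable_pos 1).comp (measurable_const.prodMk measurable_fst)).prodMk measurable_snd
  have hH : Measurable fun p : (ℕ → Incr d) × (ℕ → Incr d) =>
      expNeg (shredSum β W f n (pos x p.1 1) p.2) := by
    have h1 := (measurable_shredSum hW hf n).comp hp
    exact measurable_expNeg.comp h1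
  have h1 := lintegral_incrLaw_splice (P₀ := P₀) (β := β) 1 hH fun ω ω' η h => by
    simp only [pos_congr h]
  refine (lintegral_congr fun ω => ?_).trans h1
  rw [shredSum_of_notMem hx]

-- A decomposition by the time `m` of the first exit from `W`. At most one summand is non-zero, and
-- the last term covers the walks that do not exit by time `n`. The shift of the horizon to `n - m`
-- prepares the induction.
open Classical in
lemma expNeg_shredSum_of_mem (hβ : β ≠ 0) {x : E d} (hx : x ∈ W) (n : ℕ) (ω : ℕ → Incr d) :
    expNeg (shredSum β W f n x ω) =
      ∑ m ∈ Finset.Icc 1 n, (innerIn W).indicator (fun γ => expNeg (f γ)) (legPath β m x ω) *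
        Wᶜ.indicator (fun y => expNeg (shredSum β W f ((n - m : ℕ) : ℕ∞) y (shift m ω)))
          (pos x ω m) +
      {ω : ℕ → Incr d | ∀ j, 1 ≤ j → j ≤ n → pos x ω j ∈ W}.indicator 1 ω := by
  have hterm : ∀ m, (innerIn W).indicator (fun γ => expNeg (f γ)) (legPath β m x ω) *
        Wᶜ.indicator (fun y => expNeg (shredSum β W f ((n - m : ℕ) : ℕ∞) y (shift m ω)))
          (pos x ω m) =
      if (∀ j, 1 ≤ j → j < m → pos x ω j ∈ W) ∧ pos x ω m ∉ W then
        expNeg (f (legPath β m x ω)) *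
          expNeg (shredSum β W f ((n - m : ℕ) : ℕ∞) (pos x ω m) (shift m ω)) else 0 := by
    intro m
    have h1 : legPath β m x ω ∈ innerIn W ↔ ∀ j, 1 ≤ j → j < m → pos x ω j ∈ W :=
      legPath_mem_innerIn hβ
    by_cases ha : ∀ j, 1 ≤ j → j < m → pos x ω j ∈ W
    · by_cases hb : pos x ω m ∈ W
      · simp [hb]
      · rw [indicator_of_mem (h1.2 ha), indicator_of_mem (show pos x ω m ∈ Wᶜ from hb),
          if_pos ⟨ha, hb⟩]
    · rw [indicator_of_notMem (mt h1.1 ha), zero_mul, if_neg fun h => ha h.1]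
  simp only [hterm]
  by_cases hex : ∃ m, 1 ≤ m ∧ m ≤ n ∧ pos x ω m ∉ W
  · set m := Nat.find hex with hm
    obtain ⟨h1, h2, h3⟩ := Nat.find_spec hex
    rw [← hm] at h1 h2 h3
    have hmin : ∀ j, 1 ≤ j → j < m → pos x ω j ∈ W := fun j hj hjm => by
      by_contra hj'
      exact Nat.find_min hex hjm ⟨hj, by omega, hj'⟩
    have hnm : ω ∉ {ω : ℕ → Incr d | ∀ j, 1 ≤ j → j ≤ n → pos x ω j ∈ W} :=
      fun h => h3 (h m h1 h2)
    rw [indicator_of_notMem hnm, add_zero,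
      Finset.sum_eq_single_of_mem m (Finset.mem_Icc.2 ⟨h1, h2⟩), if_pos ⟨hmin, h3⟩, ← expNeg_add,
      ← shredSum_of_exit (by omega) _ h3]
    · congr 2
      norm_cast
      omega
    · intro j hj
      rcases Nat.eq_zero_or_pos j with rfl | hj0
      · simpa using hx
      · exact hmin j hj0 hj
    · intro j hj hjm
      refine if_neg fun h => ?_
      have hj1 := (Finset.mem_Icc.1 hj).1
      rcases lt_or_gt_of_ne hjm with hlt | hgt
      · exact h.2 (hmin j hj1 hlt)
      · exact h3 (h.1 m h1 hgt)
  · push Not at hex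
    have hmem : ω ∈ {ω : ℕ → Incr d | ∀ j, 1 ≤ j → j ≤ n → pos x ω j ∈ W} := hex
    rw [shredSum_of_forall_mem hex, indicator_of_mem hmem,
      Finset.sum_eq_zero]
    · simp
    · intro m hm
      have := Finset.mem_Icc.1 hm
      exact if_neg fun h => h.2 (hex m this.1 this.2)

/-- The renewal equation: the first-exit decomposition is integrated, and the Markov property at
time `m` averages the factor after the exit. What remains of it depends on the first shred through
its terminal site only. -/
lemma shredLaplace_of_mem [IsProbabilityMeasure P₀] (hβ : β ≠ 0) (hW : MeasurableSet W)
    (hf : Measurable f) (n : ℕ) {x : E d} (hx : x ∈ W) :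
    shredLaplace P₀ W f n x =
      ∑ m ∈ Finset.Icc 1 n, ∫⁻ γ in innerIn W, expNeg (f γ) *
        Wᶜ.indicator (shredLaplace P₀ W f ((n - m : ℕ) : ℕ∞)) (endpoints γ).2.2
          ∂((incrLaw P₀ β).map (legPath β m x)) +
      incrLaw P₀ β {ω : ℕ → Incr d | ∀ j, 1 ≤ j → j ≤ n → pos x ω j ∈ W} := by
  have := isProbabilityMeasure_incrLaw (P₀ := P₀) (β := β)
  have hset : MeasurableSet {ω : ℕ → Incr d | ∀ j, 1 ≤ j → j ≤ n → pos x ω j ∈ W} := by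
    have : {ω : ℕ → Incr d | ∀ j, 1 ≤ j → j ≤ n → pos x ω j ∈ W} =
        ⋂ j : ℕ, ⋂ _ : 1 ≤ j, ⋂ _ : j ≤ n, {ω | pos x ω j ∈ W} := by
      ext ω; simp
    rw [this]
    exact MeasurableSet.iInter fun j => MeasurableSet.iInter fun _ => MeasurableSet.iInter fun _ =>
      ((measurable_pos j).comp measurable_prodMk_left) hW
  have hi := measurableSet_innerIn (β := β) hW
  have hef : Measurable fun γ => expNeg (f γ) := measurable_expNeg.comp hf
  have hleg : ∀ m, Measurable (legPath (d := d) β m x) := fun m =>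
    measurable_legPath m measurable_const measurable_id
  have hpos : ∀ m, Measurable fun ω : ℕ → Incr d => pos x ω m := fun m =>
    (measurable_pos m).comp measurable_prodMk_left
  let H : ℕ → (ℕ → Incr d) × (ℕ → Incr d) → ℝ≥0∞ := fun m p =>
    (innerIn W).indicator (fun γ => expNeg (f γ)) (legPath β m x p.1) *
      Wᶜ.indicator (fun y => expNeg (shredSum β W f ((n - m : ℕ) : ℕ∞) y p.2)) (pos x p.1 m)
  have hH : ∀ m, Measurable (H m) := fun m => by
    refine ((hef.indicator hi).comp ((hleg m).comp measurable_fst)).mul ?_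
    have h1 : Measurable fun q : E d × (ℕ → Incr d) =>
        Wᶜ.indicator (fun y => expNeg (shredSum β W f ((n - m : ℕ) : ℕ∞) y q.2)) q.1 := by
      have : (fun q : E d × (ℕ → Incr d) =>
          Wᶜ.indicator (fun y => expNeg (shredSum β W f ((n - m : ℕ) : ℕ∞) y q.2)) q.1) =
          (Prod.fst ⁻¹' Wᶜ).indicator
            fun q => expNeg (shredSum β W f ((n - m : ℕ) : ℕ∞) q.1 q.2) := by
        funext q
        rfl
      rw [this]
      exact (measurable_expNeg_shredSum hW hf _).indicator (measurable_fst hW.compl)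
    exact h1.comp (((hpos m).comp measurable_fst).prodMk measurable_snd)
  have hHs : ∀ m, Measurable fun ω => H m (ω, shift m ω) := fun m =>
    (hH m).comp (measurable_id.prodMk (measurable_shift m))
  have h1 : shredLaplace P₀ W f n x = ∫⁻ ω, (∑ m ∈ Finset.Icc 1 n, H m (ω, shift m ω) +
      {ω : ℕ → Incr d | ∀ j, 1 ≤ j → j ≤ n → pos x ω j ∈ W}.indicator 1 ω) ∂(incrLaw P₀ β) :=
    lintegral_congr fun ω => expNeg_shredSum_of_mem hβ hx n ω
  rw [h1, lintegral_add_right _ (measurable_one.indicator hset), lintegral_indicator_one hset,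
    lintegral_finsetSum _ fun m _ => hHs m]
  congr 1
  refine Finset.sum_congr rfl fun m _ => ?_
  rw [lintegral_incrLaw_splice m (hH m) fun ω ω' η h => by
    simp only [H]; rw [legPath_congr h, pos_congr h]]
  have hψ : Measurable fun γ : FinPath d β =>
      expNeg (f γ) * Wᶜ.indicator (shredLaplace P₀ W f ((n - m : ℕ) : ℕ∞)) (endpoints γ).2.2 :=
    hef.mul (((measurable_shredLaplace hW hf _).indicator hW.compl).comp
      (measurable_snd.comp (measurable_snd.comp measurable_endpoints)))
  rw [← lintegral_indicator hi, lintegral_map (hψ.indicator hi) (hleg m)]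
  refine lintegral_congr fun ω => ?_
  simp only [H]
  by_cases hω : legPath β m x ω ∈ innerIn W
  · simp only [indicator_of_mem hω, endpoints_legPath hβ]
    rw [lintegral_const_mul' _ _ (expNeg_ne_top _)]
    congr 1
    change _ = Wᶜ.indicator (shredLaplace P₀ W f ((n - m : ℕ) : ℕ∞)) (pos x ω m)
    by_cases hp : pos x ω m ∈ Wᶜ
    · simp only [indicator_of_mem hp]
      rfl
    · simp only [indicator_of_notMem hp, lintegral_zero]
  · simp only [indicator_of_notMem hω, zero_mul, lintegral_zero]

/-- Strong induction on the horizon. Inside `W`, the renewal equation isolates the first shred,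
which is resampled given its boundary data by `setLIntegral_innerIn_legPath`. Outside `W`, one step
of the walk lowers the horizon by one. -/
lemma shredLaplace_resample_nat (h : IsBrownianLaw P₀) (hβ : β ≠ 0) (hW : MeasurableSet W)
    (hf : Measurable f) (n : ℕ) (x : E d) :
    shredLaplace P₀ W f n x = shredLaplace P₀ W (fun γ : FinPath d β => resample P₀ W f (endpoints γ)) n x := by
  have := h.isProbabilityMeasure
  have hf' : Measurable fun γ : FinPath d β => resample P₀ W f (endpoints γ) :=
    (measurable_resample hW hf).comp measurable_endpoints
  induction n using Nat.strong_induction_on generalizing x with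
  | _ n ih =>
  by_cases hx : x ∈ W
  · rw [shredLaplace_of_mem hβ hW hf n hx, shredLaplace_of_mem hβ hW hf' n hx]
    congr 1
    refine Finset.sum_congr rfl fun m hm => ?_
    have hm1 := (Finset.mem_Icc.1 hm).1
    have hm2 := (Finset.mem_Icc.1 hm).2
    -- As `m ≥ 1`, the horizon after the exit is strictly smaller.
    have hG : shredLaplace P₀ W f ((n - m : ℕ) : ℕ∞) =
        shredLaplace P₀ W (fun γ : FinPath d β => resample P₀ W f (endpoints γ)) ((n - m : ℕ) : ℕ∞) :=
      funext fun y => ih (n - m) (by omega) y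
    rw [← hG]
    have hψ : Measurable fun t : E d × ℕ × E d =>
        Wᶜ.indicator (shredLaplace P₀ W f ((n - m : ℕ) : ℕ∞)) t.2.2 :=
      ((measurable_shredLaplace hW hf _).indicator hW.compl).comp
        (measurable_snd.comp measurable_snd)
    have := h.setLIntegral_innerIn_legPath hβ (l := m) (by omega) x hW
      (measurable_expNeg.comp hf) hψ
    simp only [expNeg_resample]
    exact this
  · rcases n with _ | n
    · have h0 : ∀ g : FinPath d β → ℝ≥0∞, shredLaplace P₀ W g ((0 : ℕ) : ℕ∞) x =
          incrLaw P₀ β univ := fun g => by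
        have : ∀ ω, shredSum β W g ((0 : ℕ) : ℕ∞) x ω = 0 := fun ω =>
          shredSum_of_forall_mem fun j h1 h2 => by omega
        simp only [shredLaplace, this, expNeg_zero, lintegral_one]
      rw [h0, h0]
    · push_cast
      rw [shredLaplace_of_notMem hW hf _ hx, shredLaplace_of_notMem hW hf' _ hx]
      exact lintegral_congr fun ω => ih n (by omega) _

/-- Resampling the shreds given their boundary data does not change the Laplace functional. -/
theorem shredLaplace_resample (h : IsBrownianLaw P₀) (hβ : β ≠ 0) (hW : MeasurableSet W)
    (hf : Measurable f) (x : E d) :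
    shredLaplace P₀ W f ⊤ x = shredLaplace P₀ W (fun γ : FinPath d β => resample P₀ W f (endpoints γ)) ⊤ x := by
  have := h.isProbabilityMeasure
  have := isProbabilityMeasure_incrLaw (P₀ := P₀) (β := β)
  have hf' : Measurable fun γ : FinPath d β => resample P₀ W f (endpoints γ) :=
    (measurable_resample hW hf).comp measurable_endpoints
  have hlim : ∀ {g : FinPath d β → ℝ≥0∞}, Measurable g → Tendsto
      (fun n : ℕ => shredLaplace P₀ W g n x) atTop (𝓝 (shredLaplace P₀ W g ⊤ x)) := by
    intro g hg
    have ht : ∀ ω : ℕ → Incr d, Tendsto (fun n : ℕ => expNeg (shredSum β W g n x ω)) atTop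
        (𝓝 (expNeg (shredSum β W g ⊤ x ω))) := fun ω =>
      (continuous_expNeg.tendsto _).comp (tendsto_shredSum x ω)
    exact tendsto_lintegral_of_dominated_convergence (μ := incrLaw P₀ β) (fun _ => 1)
      (fun n => measurable_expNeg_shredSum_right hW hg n x)
      (fun n => ae_of_all _ fun ω => expNeg_le_one _) (by simp) (ae_of_all _ ht)
  refine tendsto_nhds_unique (hlim hf) ?_
  simp only [shredLaplace_resample_nat h hβ hW hf]
  exact hlim hf'

end Forward

/-! ### The shreds of an interlacement -/

section Shreds

variable {d : ℕ} {β : ℝ≥0}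

/-- The increments of the trajectory `X` from time `k` on, with interpolating paths `w`. -/
def incr (X : ℤ → E d) (w : ℤ → C(ℝ≥0, E d)) (k : ℤ) : ℕ → Incr d :=
  fun i => (X (k + i + 1) - X (k + i), w (k + i))

lemma pos_incr (X : ℤ → E d) (w : ℤ → C(ℝ≥0, E d)) (k : ℤ) (j : ℕ) :
    pos (X k) (incr X w k) j = X (k + j) := by
  induction j with
  | zero => simp
  | succ j ih =>
    have : pos (X k) (incr X w k) (j + 1) =
        pos (X k) (incr X w k) j + (X (k + j + 1) - X (k + j)) := by
      simp only [pos, walk, Finset.sum_range_succ]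
      rw [← add_assoc]
      rfl
    rw [this, ih, add_sub_cancel]
    push_cast
    rw [add_assoc]

lemma shift_incr (X : ℤ → E d) (w : ℤ → C(ℝ≥0, E d)) (k : ℤ) (m : ℕ) :
    shift m (incr X w k) = incr X w (k + m) := by
  funext i
  simp only [shift, incr]
  push_cast
  rw [show k + ((i : ℤ) + m) = k + m + i by ring]

lemma bridgePath_eq_add_leg {T s : ℝ≥0} (hs : s ≤ T) (x y : E d) (w : C(ℝ≥0, E d)) :
    bridgePath T x y w s = x + leg T s (y - x, w) := by
  simp only [leg, min_eq_left hs, bridgePath, ContinuousMap.coe_mk]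
  rw [show x + (w T - w 0) - y = 0 + (w T - w 0) - (y - x) by abel, zero_add, zero_add,
    add_sub_assoc]

/-- This matches the interpolation defined through integer parts with the sum of legs: if `s` is in
leg `j`, the earlier legs add up to the increment from `X k` to `X (k + j)` and the later legs
vanish. -/
lemma interpolate_add (hβ : β ≠ 0) (X : ℤ → E d) (w : ℤ → C(ℝ≥0, E d)) (k : ℤ) {l : ℕ} {s : ℝ≥0}
    (hs : s ≤ l * β) :
    interpolate β X w (k * β + s) = X k + concatLegs β l s (incr X w k) := by
  have hb : (0 : ℝ) < β := by positivity
  have hb' : (0 : ℝ≥0) < β := by positivity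
  set j := ⌊s / β⌋₊ with hj
  have hj1 : (j : ℝ≥0) * β ≤ s := by
    rw [← le_div_iff₀ hb']; exact Nat.floor_le zero_le
  have hj2 : s < (j + 1) * β := by
    rw [← div_lt_iff₀ hb']; exact Nat.lt_floor_add_one _
  rcases lt_or_ge j l with hjl | hjl
  · have hfloor : ⌊((k : ℝ) * β + s) / β⌋ = k + j := by
      rw [Int.floor_eq_iff]
      push_cast
      have h1 : (j : ℝ) * β ≤ s := by exact_mod_cast hj1
      have h2 : (s : ℝ) < (j + 1) * β := by exact_mod_cast hj2
      constructor
      · rw [le_div_iff₀ hb]; nlinarith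
      · rw [div_lt_iff₀ hb]; nlinarith
    have hr : ((k : ℝ) * β + s - ((k + j : ℤ) : ℝ) * β).toNNReal = s - j * β := by
      rw [← NNReal.coe_inj, NNReal.coe_sub hj1, Real.coe_toNNReal]
      · push_cast; ring
      · have h1 : (j : ℝ) * β ≤ s := by exact_mod_cast hj1
        push_cast
        linarith
    have hle : s - j * β ≤ β := by
      rw [tsub_le_iff_right]
      calc s ≤ (j + 1) * β := hj2.le
        _ = β + j * β := by ring
    simp only [interpolate, ContinuousMap.coe_mk, interpolateFun]
    rw [hfloor, hr, bridgePath_eq_add_leg hle, concatLegs, ← Finset.sum_range_add_sum_Ico _ hjl,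
      Finset.sum_range_succ]
    have h0 : ∑ i ∈ Finset.Ico (j + 1) l, leg β (s - i * β) (incr X w k i) = 0 := by
      refine Finset.sum_eq_zero fun i hi => ?_
      have h1 : ((j : ℝ≥0) + 1) ≤ i := by exact_mod_cast (Finset.mem_Ico.1 hi).1
      rw [tsub_eq_zero_of_le (hj2.le.trans (by gcongr)), leg_zero]
    have h1 : ∑ i ∈ Finset.range j, leg β (s - i * β) (incr X w k i) =
        ∑ i ∈ Finset.range j, (incr X w k i).1 := by
      refine Finset.sum_congr rfl fun i hi => leg_of_le hβ ?_ _
      have h1 : ((i : ℝ≥0) + 1) ≤ j := by exact_mod_cast Finset.mem_range.1 hi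
      refine le_tsub_of_add_le_right (le_trans ?_ hj1)
      calc β + i * β = (i + 1) * β := by ring
        _ ≤ j * β := by gcongr
    have h2 : X k + ∑ i ∈ Finset.range j, (incr X w k i).1 = X (k + j) := pos_incr X w k j
    rw [h0, h1, add_zero, ← add_assoc, h2]
    rfl
  -- At the right end of the interval the integer part points past the last leg; there both sides
  -- equal `X (k + l)`.
  · have hsl : s = l * β := by
      refine le_antisymm hs (le_trans ?_ hj1)
      gcongr
    have h1 := add_concatLegs_natCast_mul hβ (le_refl l) (X k) (incr X w k)
    have h2 : ((k : ℝ) * β + ((l * β : ℝ≥0) : ℝ)) = ((k + l : ℤ) : ℝ) * β := by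
      push_cast; ring
    rw [hsl, h1, h2, interpolate_int_mul hβ]
    exact (pos_incr X w k l).symm

lemma piece_interpolate (hβ : β ≠ 0) (X : ℤ → E d) (w : ℤ → C(ℝ≥0, E d)) (k : ℤ) (l : ℕ) :
    piece β (interpolate β X w) k l = legPath β l (X k) (incr X w k) := by
  unfold piece legPath
  congr 1
  ext1 s
  exact interpolate_add hβ X w k s.2.2

lemma isShred_interpolate_iff (hβ : β ≠ 0) {W : Set (E d)} {X : ℤ → E d} {w : ℤ → C(ℝ≥0, E d)}
    {k : ℤ} {l : ℕ} : IsShred β W (interpolate β X w) (k, l) ↔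
      1 ≤ l ∧ X (k - 1) ∉ W ∧ (∀ j : ℕ, j < l → X (k + j) ∈ W) ∧ X (k + l) ∉ W := by
  simp only [IsShred, interpolate_int_mul hβ]

/-- Time `0` is the first visit to `V ⊇ W`, so `X (-1)` is outside `W`. This is why `ShredAt` needs
no condition on the predecessor of time `0`. -/
lemma isShred_iff_shredAt (hβ : β ≠ 0) {W V : Set (E d)} (hWV : W ⊆ V) {X : ℤ → E d}
    (hX : X ∈ firstVisit V) (w : ℤ → C(ℝ≥0, E d)) (k l : ℕ) :
    IsShred β W (interpolate β X w) (k, l) ↔ ShredAt W (X 0) (incr X w 0) k l := by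
  have hp : ∀ j : ℕ, pos (X 0) (incr X w 0) j = X j := fun j => by rw [pos_incr, zero_add]
  rw [isShred_interpolate_iff hβ]
  simp only [ShredAt, hp]
  have h1 : X ((k : ℤ) - 1) ∉ W ↔ k = 0 ∨ X ((k - 1 : ℕ) : ℤ) ∉ W := by
    rcases k with _ | k
    · have h : X (-1) ∉ W := fun h => hX.2 1 le_rfl (by simpa using hWV h)
      simpa using h
    · simp
  rw [h1]
  push_cast
  simp only [add_comm (k : ℤ)]

lemma not_isShred_of_neg (hβ : β ≠ 0) {W V : Set (E d)} (hWV : W ⊆ V) {X : ℤ → E d}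
    (hX : X ∈ firstVisit V) (w : ℤ → C(ℝ≥0, E d)) {k : ℤ} (hk : k < 0) (l : ℕ) :
    ¬ IsShred β W (interpolate β X w) (k, l) := by
  rw [isShred_interpolate_iff hβ]
  rintro ⟨h1, -, h2, -⟩
  have h3 := h2 0 (by omega)
  refine hX.2 (-k).toNat (by omega) (hWV ?_)
  convert h3 using 2
  push_cast
  omega

open Classical in
lemma lintegral_shredsOf_mk (W : Set (E d)) (g : C(ℝ, E d)) {f : FinPath d β → ℝ≥0∞}
    (hf : Measurable f) : ∫⁻ γ, f γ ∂(shredsOf W (Quotient.mk (pathSetoid d β) g)) =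
      ∑' (k : ℤ) (l : ℕ), if IsShred β W g (k, l) then f (piece β g k l) else 0 := by
  change ∫⁻ γ, f γ ∂(Measure.sum fun p : ℤ × ℕ =>
    if IsShred β W g p then Measure.dirac (piece β g p.1 p.2) else 0) = _
  rw [lintegral_sum_measure, ENNReal.tsum_prod']
  refine tsum_congr fun k => tsum_congr fun l => ?_
  split_ifs
  · exact lintegral_dirac' _ hf
  · exact lintegral_zero_measure f

lemma lintegral_shredsOf (hβ : β ≠ 0) {W V : Set (E d)} (hWV : W ⊆ V) {X : ℤ → E d}
    (hX : X ∈ firstVisit V) (w : ℤ → C(ℝ≥0, E d)) {f : FinPath d β → ℝ≥0∞} (hf : Measurable f) :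
    ∫⁻ γ, f γ ∂(shredsOf W (Quotient.mk (pathSetoid d β) (interpolate β X w))) =
      shredSum β W f ⊤ (X 0) (incr X w 0) := by
  classical
  rw [lintegral_shredsOf_mk W _ hf, ← (Nat.cast_injective (R := ℤ)).tsum_eq]
  · refine tsum_congr fun k => tsum_congr fun l => ?_
    have h1 := isShred_iff_shredAt hβ hWV hX w k l
    have h2 : ((l + k : ℕ) : ℕ∞) ≤ ⊤ := le_top
    rw [shredTerm, piece_interpolate hβ, shift_incr, pos_incr, zero_add]
    by_cases h3 : ShredAt W (X 0) (incr X w 0) k l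
    · rw [if_pos (h1.2 h3), if_pos ⟨h3, h2⟩]
    · rw [if_neg (mt h1.1 h3), if_neg fun h => h3 h.1]
  · intro k hk
    rw [Function.mem_support] at hk
    by_contra hneg
    refine hk (ENNReal.tsum_eq_zero.2 fun l => if_neg (not_isShred_of_neg hβ hWV hX w ?_ l))
    by_contra hk0
    exact hneg ⟨k.toNat, by omega⟩

lemma measurable_piece (k : ℤ) (l : ℕ) :
    Measurable fun g : C(ℝ, E d) => piece β g k l :=
  (measurable_finPath_mk l).comp (measurable_path_iff.2 fun _ => measurable_eval_path _)

lemma measurableSet_isShred {W : Set (E d)} (hW : MeasurableSet W) (p : ℤ × ℕ) :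
    MeasurableSet {g : C(ℝ, E d) | IsShred β W g p} := by
  have h : ∀ t : ℝ, MeasurableSet {g : C(ℝ, E d) | g t ∈ W} := fun t => measurable_eval_path t hW
  have h2 : MeasurableSet {g : C(ℝ, E d) | ∀ j : ℕ, j < p.2 → g ((p.1 + j : ℤ) * β) ∈ W} := by
    have : {g : C(ℝ, E d) | ∀ j : ℕ, j < p.2 → g ((p.1 + j : ℤ) * β) ∈ W} =
        ⋂ j : ℕ, ⋂ _ : j < p.2, {g | g ((p.1 + j : ℤ) * β) ∈ W} := by
      ext g; simp
    rw [this]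
    exact MeasurableSet.iInter fun j => MeasurableSet.iInter fun _ => h _
  exact (MeasurableSet.const _).inter ((h _).compl.inter (h2.inter (h _).compl))

lemma measurable_shredsOf {W : Set (E d)} (hW : MeasurableSet W) :
    Measurable (shredsOf (β := β) W) := by
  classical
  refine measurable_from_quotient.2 ?_
  have : shredsOf (β := β) W ∘ Quotient.mk'' = fun g : C(ℝ, E d) => Measure.sum fun p : ℤ × ℕ =>
    if IsShred β W g p then Measure.dirac (piece β g p.1 p.2) else 0 := rfl
  rw [this]
  refine Measure.measurable_of_measurable_coe _ fun s hs => ?_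
  simp only [Measure.sum_apply _ hs]
  refine Measurable.tsum fun p => ?_
  refine (Measure.measurable_coe hs).comp (Measurable.ite (measurableSet_isShred hW p)
    (Measure.measurable_dirac.comp (measurable_piece p.1 p.2)) measurable_const)

lemma shredsOf_eq_zero {W V : Set (E d)} (hWV : W ⊆ V) {g : Interlacement d β}
    (hg : g ∉ hasParticleIn V) : shredsOf W g = 0 := by
  induction g using Quotient.inductionOn with
  | h g =>
    rw [mk_mem_hasParticleIn] at hg
    push Not at hg
    classical
    change (Measure.sum fun p : ℤ × ℕ =>
      if IsShred β W g p then Measure.dirac (piece β g p.1 p.2) else 0) = 0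
    refine Measure.sum_eq_zero.2 fun p => if_neg fun h => ?_
    exact hg _ (hWV (h.2.2.1 0 h.1))

/-- Given the position at the first visit to the cube, past and future are independent. A functional
of the future sees the past only through the probability of never returning, which is the
equilibrium density on the cube. -/
lemma lintegral_pathIntensity_forward {P₀ : Measure C(ℝ≥0, E d)} (h : IsBrownianLaw P₀)
    (hβ : β ≠ 0) (hd : 3 ≤ d) (N : ℕ) {F : Interlacement d β → ℝ≥0∞} (hF : Measurable F)
    (hF0 : ∀ g ∉ hasParticleIn (box d (N + 1)), F g = 0)
    {G : E d × (ℕ → Incr d) → ℝ≥0∞} (hG : Measurable G)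
    (hFG : ∀ X ∈ firstVisit (box d (N + 1)), ∀ w,
      F (Quotient.mk _ (interpolate β X w)) = G (X 0, incr X w 0)) :
    ∫⁻ g, F g ∂(pathIntensity P₀ β) =
      ∫⁻ x, walkLaw β x (neverReturns (box d (N + 1))) * ((box d (N + 1)).indicator 1 x *
        ∫⁻ ω, G (x, ω) ∂(incrLaw P₀ β)) := by
  have := h.isProbabilityMeasure
  set V := box d ((N : ℝ) + 1) with hV
  have hVm : MeasurableSet V := measurableSet_box _
  -- The interpolating paths are averaged out, so that `H` is a function of the forward positions.
  -- The indicator at time `0` is put here because `glue` reads this position from the forward walk.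
  let H : (ℕ → E d) → ℝ≥0∞ := fun b => V.indicator 1 (b 0) *
    ∫⁻ w, G (b 0, fun i => (b (i + 1) - b i, w i)) ∂(Measure.infinitePi fun _ : ℕ => P₀)
  have hpair : Measurable fun p : (ℕ → E d) × (ℕ → C(ℝ≥0, E d)) =>
      (p.1 0, fun i => (p.1 (i + 1) - p.1 i, p.2 i)) := by
    have h1 : ∀ i, Measurable fun p : (ℕ → E d) × (ℕ → C(ℝ≥0, E d)) => p.1 i := fun i =>
      (measurable_pi_apply i).comp measurable_fst
    exact (h1 0).prodMk (measurable_pi_iff.2 fun i => ((h1 _).sub (h1 _)).prodMk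
      ((measurable_pi_apply i).comp measurable_snd))
  have hH : Measurable H := by
    refine ((measurable_one.indicator hVm).comp (measurable_pi_apply 0)).mul ?_
    have h1 : Measurable fun p : (ℕ → E d) × (ℕ → C(ℝ≥0, E d)) =>
      G (p.1 0, fun i => (p.1 (i + 1) - p.1 i, p.2 i)) := hG.comp hpair
    exact h1.lintegral_prod_right'
  have hres : Measurable fun (X : ℤ → E d) (n : ℕ) => X n :=
    measurable_pi_iff.2 fun n => measurable_pi_apply _
  have hback : Measurable fun (X : ℤ → E d) (n : ℕ) => X (-n) :=
    measurable_pi_iff.2 fun n => measurable_pi_apply _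
  have hnr := measurableSet_neverReturns hVm
  have h1 : ∫⁻ g, F g ∂(pathIntensity P₀ β) = ∫⁻ X, (neverReturns V).indicator 1 (fun n : ℕ => X (-n)) *
      H (fun n : ℕ => X n) ∂(twoSidedLaw d β) := by
    rw [lintegral_pathIntensity h hβ hd N hF hF0, ← lintegral_indicator (measurableSet_firstVisit hVm)]
    refine lintegral_congr fun X => ?_
    have hiff : X ∈ firstVisit V ↔ X 0 ∈ V ∧ (fun n : ℕ => X (-n)) ∈ neverReturns V := Iff.rfl
    by_cases hX : X ∈ firstVisit V
    · obtain ⟨ha, hb⟩ := hiff.1 hX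
      simp only [H]
      rw [indicator_of_mem hX, indicator_of_mem hb, Nat.cast_zero, indicator_of_mem ha]
      simp only [Pi.one_apply, one_mul, hFG X hX]
      rw [← map_comp_infinitePi P₀ (Nat.cast_injective (R := ℤ))]
      have hGm : Measurable fun w : ℕ → C(ℝ≥0, E d) =>
          G (X 0, fun i : ℕ => (X ((i + 1 : ℕ) : ℤ) - X i, w i)) :=
        hG.comp (hpair.comp (measurable_prodMk_left (x := fun n : ℕ => X n)))
      rw [lintegral_map hGm (measurable_pi_iff.2 fun i => measurable_pi_apply _)]
      refine lintegral_congr fun w => ?_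
      congr 2
      funext i
      simp [incr]
    · rw [indicator_of_notMem hX]
      by_cases ha : X 0 ∈ V
      · have hb : (fun n : ℕ => X (-n)) ∉ neverReturns V := fun hb => hX (hiff.2 ⟨ha, hb⟩)
        rw [indicator_of_notMem hb, zero_mul]
      · simp [H, indicator_of_notMem ha]
  have hc : Measurable fun X : ℤ → E d => (neverReturns V).indicator (1 : (ℕ → E d) → ℝ≥0∞)
      (fun n : ℕ => X (-n)) * H (fun n : ℕ => X n) :=
    ((measurable_one.indicator hnr).comp hback).mul (hH.comp hres)
  rw [h1, lintegral_twoSidedLaw β hc]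
  refine lintegral_congr fun x => ?_
  have hg : ∀ p : (ℕ → E d) × (ℕ → E d), (neverReturns V).indicator (1 : (ℕ → E d) → ℝ≥0∞)
      (fun n : ℕ => glue p (-n)) * H (fun n : ℕ => glue p n) =
      (neverReturns V).indicator 1 p.1 * H p.2 := by
    intro p
    have ha : (fun n : ℕ => glue p n) = p.2 := by funext n; simp [glue]
    have hb : (fun n : ℕ => glue p (-n)) ∈ neverReturns V ↔ p.1 ∈ neverReturns V := by
      refine forall_congr' fun n => imp_congr_right fun hn => ?_
      have : ¬ n = 0 := by omega
      simp [glue, this]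
    rw [ha]
    congr 1
    by_cases hp : p.1 ∈ neverReturns V
    · rw [indicator_of_mem hp, indicator_of_mem (hb.2 hp)]; rfl
    · rw [indicator_of_notMem hp, indicator_of_notMem (mt hb.1 hp)]
  simp only [hg]
  rw [lintegral_prod_mul (measurable_one.indicator hnr).aemeasurable hH.aemeasurable,
    lintegral_indicator_one hnr]
  congr 1
  have hGx : Measurable fun ω : ℕ → Incr d => G (x, ω) := hG.comp measurable_prodMk_left
  have hz : Measurable fun (p : (ℕ → E d) × (ℕ → C(ℝ≥0, E d))) i => (p.1 i, p.2 i) :=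
    measurable_pi_iff.2 fun i => ((measurable_pi_apply i).comp measurable_fst).prodMk
      ((measurable_pi_apply i).comp measurable_snd)
  have hGz : Measurable fun p : (ℕ → E d) × (ℕ → C(ℝ≥0, E d)) => G (x, fun i => (p.1 i, p.2 i)) :=
    hGx.comp hz
  have hw0 : ∀ ξ : ℕ → E d, walk x ξ 0 = x := fun ξ => by simp [walk]
  have hw1 : ∀ (ξ : ℕ → E d) i, walk x ξ (i + 1) - walk x ξ i = ξ i := fun ξ i => by
    simp [walk, Finset.sum_range_succ]
  have hmw : walkLaw β x = (Measure.infinitePi fun _ : ℕ => gaussianStep d β).map (walk x) := rfl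
  -- The positions are expressed by the steps again; the independent families of steps and of
  -- interpolating paths are zipped into one i.i.d. family of pairs.
  rw [hmw, lintegral_map hH (measurable_walk_right x), incrLaw, stepLaw, ← map_zip_infinitePi,
    lintegral_map hGx hz, lintegral_prod _ hGz.aemeasurable]
  simp only [H, hw0, hw1]
  rw [lintegral_const_mul _ hGz.lintegral_prod_right']

/-- The integral of `f` over the shreds of an interlacement. -/
noncomputable def shredIntegral (W : Set (E d)) (f : FinPath d β → ℝ≥0∞) (g : Interlacement d β) :
    ℝ≥0∞ := ∫⁻ γ, f γ ∂(shredsOf W g)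

lemma measurable_shredIntegral {W : Set (E d)} (hW : MeasurableSet W) {f : FinPath d β → ℝ≥0∞}
    (hf : Measurable f) : Measurable (shredIntegral W f) :=
  (Measure.measurable_lintegral hf).comp (measurable_shredsOf hW)

lemma shredIntegral_eq_zero {W V : Set (E d)} (hWV : W ⊆ V) (f : FinPath d β → ℝ≥0∞)
    {g : Interlacement d β} (hg : g ∉ hasParticleIn V) : shredIntegral W f g = 0 := by
  rw [shredIntegral, shredsOf_eq_zero hWV hg, lintegral_zero_measure]

variable {P₀ : Measure C(ℝ≥0, E d)} {W : Set (E d)}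

/-- The weight in front does not involve `f`: the dependence on `f` is only through `shredLaplace`,
for which resampling has been proved pointwise in `x`. -/
lemma lintegral_one_sub_expNeg_shredIntegral (h : IsBrownianLaw P₀) (hβ : β ≠ 0) (hd : 3 ≤ d)
    {N : ℕ} (hW : MeasurableSet W) (hWN : W ⊆ box d (N + 1)) {f : FinPath d β → ℝ≥0∞}
    (hf : Measurable f) :
    ∫⁻ g, (1 - expNeg (shredIntegral W f g)) ∂(pathIntensity P₀ β) =
      ∫⁻ x, walkLaw β x (neverReturns (box d (N + 1))) * ((box d (N + 1)).indicator 1 x *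
        (1 - shredLaplace P₀ W f ⊤ x)) := by
  have := h.isProbabilityMeasure
  have := isProbabilityMeasure_incrLaw (P₀ := P₀) (β := β)
  have hF : Measurable fun g : Interlacement d β => 1 - expNeg (shredIntegral W f g) :=
    measurable_const.sub (measurable_expNeg.comp (measurable_shredIntegral hW hf))
  have hG : Measurable fun p : E d × (ℕ → Incr d) => 1 - expNeg (shredSum β W f ⊤ p.1 p.2) :=
    measurable_const.sub (measurable_expNeg_shredSum hW hf ⊤)
  rw [lintegral_pathIntensity_forward h hβ hd N hF (fun g hg => by
    rw [shredIntegral_eq_zero hWN f hg, expNeg_zero, tsub_self]) hG fun X hX w => by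
    rw [shredIntegral, lintegral_shredsOf hβ hWN hX w hf]]
  refine lintegral_congr fun x => ?_
  congr 2
  have hm := measurable_expNeg_shredSum_right hW hf ⊤ x
  have hle : ∀ ω : ℕ → Incr d, expNeg (shredSum β W f ⊤ x ω) ≤ 1 := fun ω => expNeg_le_one _
  rw [lintegral_sub hm _ (ae_of_all _ hle)]
  · simp [shredLaplace]
  · refine ne_top_of_le_ne_top ENNReal.one_ne_top ((lintegral_mono hle).trans ?_)
    simp

theorem lintegral_one_sub_expNeg_resample (h : IsBrownianLaw P₀) (hβ : β ≠ 0) (hd : 3 ≤ d)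
    (hW : MeasurableSet W) (hWb : Bornology.IsBounded W) {f : FinPath d β → ℝ≥0∞}
    (hf : Measurable f) :
    ∫⁻ g, (1 - expNeg (shredIntegral W f g)) ∂(pathIntensity P₀ β) =
      ∫⁻ g, (1 - expNeg (shredIntegral W
        (fun γ : FinPath d β => resample P₀ W f (endpoints γ)) g)) ∂(pathIntensity P₀ β) := by
  have := h.isProbabilityMeasure
  obtain ⟨N, hN⟩ := exists_subset_box hWb
  have hf' : Measurable fun γ : FinPath d β => resample P₀ W f (endpoints γ) :=
    (measurable_resample hW hf).comp measurable_endpoints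
  rw [lintegral_one_sub_expNeg_shredIntegral h hβ hd hW hN hf,
    lintegral_one_sub_expNeg_shredIntegral h hβ hd hW hN hf']
  simp only [shredLaplace_resample h hβ hW hf]

lemma map_pos_incrLaw [IsProbabilityMeasure P₀] (x : E d) :
    (incrLaw P₀ β).map (pos x) = walkLaw β x := by
  have := isProbabilityMeasure_stepLaw (P₀ := P₀) (β := β)
  have h1 : (incrLaw P₀ β).map (fun ω i => (ω i).1) =
      Measure.infinitePi fun _ : ℕ => gaussianStep d β := by
    have := Measure.infinitePi_map_pi (μ := fun _ : ℕ => stepLaw P₀ β)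
      (f := fun _ => Prod.fst) fun _ => measurable_fst
    rw [incrLaw, this]
    congr 1
    funext _
    exact measurePreserving_fst.map_eq
  have hm : Measurable fun (ω : ℕ → Incr d) i => (ω i).1 :=
    measurable_pi_iff.2 fun i => measurable_fst.comp (measurable_pi_apply i)
  have h2 : pos x = walk x ∘ fun (ω : ℕ → Incr d) i => (ω i).1 := rfl
  rw [h2, ← Measure.map_map (measurable_walk_right x) hm, h1]
  rfl

/-- No shred starts after the last visit to `W`, and from each start time at most one length is
possible, because the length is determined by the exit. -/
lemma shredSum_one_lt_top {x : E d} {ω : ℕ → Incr d} (h : ∀ᶠ n in atTop, pos x ω n ∉ W) :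
    shredSum β W 1 ⊤ x ω < ∞ := by
  obtain ⟨K, hK⟩ := eventually_atTop.1 h
  rw [shredSum, tsum_eq_sum (s := Finset.range K)]
  · refine ENNReal.sum_lt_top.2 fun k _ => ?_
    by_cases hex : ∃ l, ShredAt W x ω k l
    · obtain ⟨l, hl⟩ := hex
      rw [tsum_eq_single l]
      · unfold shredTerm
        split_ifs <;> simp
      · intro m hm
        refine if_neg fun hm' => ?_
        rcases lt_or_gt_of_ne hm with hlt | hgt
        · exact hm'.1.2.2.2 (hl.2.2.1 m hlt)
        · exact hl.2.2.2 (hm'.1.2.2.1 l hgt)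
    · push Not at hex
      have : ∀ l, shredTerm β W 1 ⊤ x ω k l = 0 := fun l => if_neg fun h => hex l h.1
      simp [this]
  · intro k hk
    refine ENNReal.tsum_eq_zero.2 fun l => if_neg fun hl => ?_
    have := hl.1.2.2.1 0 hl.1.1
    rw [zero_add] at this
    exact hK k (by simpa using hk) this

theorem ae_shredIntegral_one_lt_top (h : IsBrownianLaw P₀) (hβ : β ≠ 0) (hd : 3 ≤ d)
    (hW : MeasurableSet W) (hWb : Bornology.IsBounded W) :
    ∀ᵐ g ∂(pathIntensity P₀ β), shredIntegral W 1 g < ∞ := by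
  have := h.isProbabilityMeasure
  obtain ⟨N, hN⟩ := exists_subset_box hWb
  have hS := measurable_shredIntegral (β := β) hW measurable_one
  have htop : MeasurableSet ({∞} : Set ℝ≥0∞) := measurableSet_singleton _
  have hSi : Measurable fun g : Interlacement d β =>
      ({∞} : Set ℝ≥0∞).indicator (1 : ℝ≥0∞ → ℝ≥0∞) (shredIntegral W 1 g) :=
    (measurable_one.indicator htop).comp hS
  have hJi : Measurable fun p : E d × (ℕ → Incr d) =>
      ({∞} : Set ℝ≥0∞).indicator (1 : ℝ≥0∞ → ℝ≥0∞) (shredSum β W 1 ⊤ p.1 p.2) :=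
    (measurable_one.indicator htop).comp (measurable_shredSum (β := β) hW measurable_one ⊤)
  have h1 : ∫⁻ g, ({∞} : Set ℝ≥0∞).indicator 1 (shredIntegral W 1 g) ∂(pathIntensity P₀ β) = 0 := by
    rw [lintegral_pathIntensity_forward h hβ hd N hSi
      (fun g hg => by rw [shredIntegral_eq_zero hN 1 hg]; simp)
      hJi fun X hX w => by
        rw [shredIntegral, lintegral_shredsOf hβ hN hX w measurable_one]]
    refine (lintegral_congr fun x => ?_).trans lintegral_zero
    have : ∫⁻ ω, ({∞} : Set ℝ≥0∞).indicator (1 : ℝ≥0∞ → ℝ≥0∞) (shredSum β W 1 ⊤ x ω)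
        ∂(incrLaw P₀ β) = 0 := by
      refine (lintegral_congr_ae ?_).trans lintegral_zero
      have ht := walkLaw_transient h hβ hd x
      rw [← map_pos_incrLaw (P₀ := P₀)] at ht
      filter_upwards [ae_of_ae_map ((measurable_pi_iff.2 fun n =>
        (measurable_pos n).comp measurable_prodMk_left).aemeasurable) ht] with ω hω
      have hfin : shredSum β W 1 ⊤ x ω < ∞ := shredSum_one_lt_top <| by
        filter_upwards [hω (N + 1)] with n hn hmem
        refine hn ?_
        push_cast
        exact hN hmem
      simp [hfin.ne]
    rw [this, mul_zero, mul_zero]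
  rw [lintegral_eq_zero_iff hSi] at h1
  filter_upwards [h1] with g hg
  by_contra hlt
  simp [not_lt_top_iff.1 hlt] at hg

end Shreds

/-! ### Measurable enumeration of finite point measures -/

section Enumeration

variable {α : Type*} [MeasurableSpace α] [StandardBorelSpace α]

open Classical in
/-- The `k`-th order statistic of a measure, in terms of an embedding into the real line. -/
noncomputable def orderStat (μ : Measure α) (k : ℕ) : EReal :=
  ⨅ q : ℚ, if (k : ℝ≥0∞) + 1 ≤ μ (embeddingReal α ⁻¹' Iic (q : ℝ)) then ((q : ℝ) : EReal) else ⊤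

lemma measurable_orderStat (k : ℕ) : Measurable fun μ : Measure α => orderStat μ k := by
  refine Measurable.iInf fun q => Measurable.ite ?_ measurable_const measurable_const
  exact measurableSet_le measurable_const
    (Measure.measurable_coe (measurable_embeddingReal α measurableSet_Iic))

/-- The half-line up to `q` carries at least `k + 1` points exactly when the `k`-th smallest one,
counted from `0` and with multiplicity, is at most `q`. An infimum over rational `q` suffices, which
keeps the order statistic measurable. -/
lemma orderStat_sum_dirac {n : ℕ} (t : Fin n → α) {σ : Equiv.Perm (Fin n)}
    (hσ : Monotone fun i => embeddingReal α (t (σ i))) (k : Fin n) :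
    orderStat (∑ i, Measure.dirac (t i)) k = (embeddingReal α (t (σ k)) : EReal) := by
  have hcount : ∀ q : ℝ, (k : ℝ≥0∞) + 1 ≤ (∑ i, Measure.dirac (t i)) (embeddingReal α ⁻¹' Iic q) ↔
      embeddingReal α (t (σ k)) ≤ q := by
    intro q
    have hm : MeasurableSet (embeddingReal α ⁻¹' Iic q) :=
      measurable_embeddingReal α measurableSet_Iic
    have h1 : (∑ i, Measure.dirac (t i)) (embeddingReal α ⁻¹' Iic q) =
        ((Finset.univ.filter fun i => embeddingReal α (t (σ i)) ≤ q).card : ℝ≥0∞) := by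
      rw [Measure.finsetSum_apply, ← Equiv.sum_comp σ, Finset.card_filter]
      push_cast
      refine Finset.sum_congr rfl fun i _ => ?_
      rw [Measure.dirac_apply' _ hm]
      simp [indicator]
    rw [h1]
    have h2 : ∀ m : ℕ, (k : ℝ≥0∞) + 1 ≤ (m : ℝ≥0∞) ↔ (k : ℕ) + 1 ≤ m := fun m => by norm_cast
    rw [h2]
    constructor
    · intro hk
      by_contra! hlt
      have hsub : (Finset.univ.filter fun i => embeddingReal α (t (σ i)) ≤ q) ⊆ Finset.Iio k := by
        intro i hi
        rw [Finset.mem_Iio]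
        by_contra! hki
        exact absurd ((Finset.mem_filter.1 hi).2) (not_le.2 (hlt.trans_le (hσ hki)))
      have := Finset.card_le_card hsub
      rw [Fin.card_Iio] at this
      omega
    · intro hq
      have hsub : Finset.Iic k ⊆ Finset.univ.filter fun i => embeddingReal α (t (σ i)) ≤ q :=
        fun i hi => Finset.mem_filter.2
          ⟨Finset.mem_univ _, (hσ (Finset.mem_Iic.1 hi)).trans hq⟩
      have := Finset.card_le_card hsub
      rwa [Fin.card_Iic] at this
  refine le_antisymm (le_of_forall_gt_imp_ge_of_dense fun b hb => ?_) (le_iInf fun q => ?_)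
  · obtain ⟨q, hq1, hq2⟩ := EReal.lt_iff_exists_rat_btwn.1 hb
    refine (iInf_le _ q).trans ?_
    rw [if_pos ((hcount q).2 (by exact_mod_cast hq1.le))]
    exact hq2.le
  · by_cases hq : (k : ℝ≥0∞) + 1 ≤ (∑ i, Measure.dirac (t i)) (embeddingReal α ⁻¹' Iic (q : ℝ))
    · rw [if_pos hq]
      exact_mod_cast (hcount q).1 hq
    · rw [if_neg hq]
      exact le_top

/-- The `k`-th point of a finite point measure, in the order given by an embedding into the real
line. -/
noncomputable def nthPoint [Nonempty α] (μ : Measure α) (k : ℕ) : α :=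
  Function.extend (embeddingReal α) id (fun _ => Classical.arbitrary α) (orderStat μ k).toReal

lemma measurable_nthPoint [Nonempty α] (k : ℕ) : Measurable fun μ : Measure α => nthPoint μ k :=
  ((measurableEmbedding_embeddingReal α).measurable_extend measurable_id measurable_const).comp
    (measurable_ereal_toReal.comp (measurable_orderStat k))

/-- Indices rather than values are sorted, so repeated points are enumerated with their
multiplicity. -/
lemma exists_perm_nthPoint [Nonempty α] {n : ℕ} (t : Fin n → α) :
    ∃ σ : Equiv.Perm (Fin n), ∀ k : Fin n,
      nthPoint (∑ i, Measure.dirac (t i)) k = t (σ k) := by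
  refine ⟨Tuple.sort fun i => embeddingReal α (t i), fun k => ?_⟩
  rw [nthPoint, orderStat_sum_dirac t (Tuple.monotone_sort fun i => embeddingReal α (t i)) k,
    EReal.toReal_coe, (measurableEmbedding_embeddingReal α).injective.extend_apply]
  rfl

end Enumeration

/-! ### Superpositions of independent points -/

section Superposition

variable {α γ : Type*} [MeasurableSpace α] [MeasurableSpace γ]

lemma measurable_sum_dirac {n : ℕ} :
    Measurable fun g : Fin n → γ => ∑ i, Measure.dirac (g i) := by
  refine Measure.measurable_of_measurable_coe _ fun s hs => ?_
  simp only [Measure.finsetSum_apply]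
  exact Finset.measurable_sum _ fun i _ =>
    (Measure.measurable_coe hs).comp (Measure.measurable_dirac.comp (measurable_pi_apply i))

/-- The law of the point measure with independent points with laws `ρ i`. -/
noncomputable def superposition {n : ℕ} (ρ : Fin n → Measure γ) : Measure (Measure γ) :=
  (Measure.pi ρ).map fun g => ∑ i, Measure.dirac (g i)

lemma superposition_perm {n : ℕ} (ρ : Fin n → Measure γ) [∀ i, IsProbabilityMeasure (ρ i)]
    (σ : Equiv.Perm (Fin n)) : superposition (fun i => ρ (σ i)) = superposition ρ := by
  rw [superposition, superposition, ← Measure.pi_map_piCongrLeft σ ρ,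
    Measure.map_map measurable_sum_dirac (MeasurableEquiv.measurable _)]
  congr 1
  funext g
  refine (Finset.sum_congr rfl fun i _ => ?_).trans (Equiv.sum_comp σ fun i =>
    Measure.dirac (MeasurableEquiv.piCongrLeft (fun _ => γ) σ g i))
  congr 1
  exact (Equiv.piCongrLeft_apply_apply (fun _ : Fin n => γ) σ g i).symm

lemma measurable_pi_measure {n : ℕ} {κ : α → Measure γ} (hκ : Measurable κ)
    [∀ a, IsProbabilityMeasure (κ a)] :
    Measurable fun t : Fin n → α => Measure.pi fun i => κ (t i) := by
  refine Measurable.measure_of_isPiSystem_of_isProbabilityMeasure generateFrom_pi.symm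
    isPiSystem_pi ?_
  rintro _ ⟨s, hs, rfl⟩
  simp only [Measure.pi_pi]
  exact Finset.measurable_prod _ fun i _ => (Measure.measurable_coe (hs i (mem_univ i))).comp
    (hκ.comp (measurable_pi_apply i))

/-- The law of independent points whose laws are given by the points of a finite point measure. -/
noncomputable def superpositionKernel [StandardBorelSpace α] [Nonempty α] (κ : α → Measure γ)
    (μ : Measure α) : Measure (Measure γ) :=
  superposition fun i : Fin ⌊(μ univ).toReal⌋₊ => κ (nthPoint μ i)

lemma measurable_superpositionKernel [StandardBorelSpace α] [Nonempty α] {κ : α → Measure γ}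
    (hκ : Measurable κ) [∀ a, IsProbabilityMeasure (κ a)] :
    Measurable (superpositionKernel κ) := by
  have h1 : Measurable fun p : ℕ × Measure α =>
      superposition fun i : Fin p.1 => κ (nthPoint p.2 i) := by
    refine measurable_from_prod_countable_right fun n => ?_
    have h2 : Measurable fun (μ : Measure α) (i : Fin n) => nthPoint μ i :=
      measurable_pi_iff.2 fun i => measurable_nthPoint i
    exact (Measure.measurable_map _ measurable_sum_dirac).comp ((measurable_pi_measure hκ).comp h2)
  have h2 : Measurable fun μ : Measure α => (⌊(μ univ).toReal⌋₊, μ) :=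
    (Nat.measurable_floor.comp
      (Measure.measurable_coe MeasurableSet.univ).ennreal_toReal).prodMk measurable_id
  exact h1.comp h2

/-- The enumeration by `nthPoint` may differ from `t` by a permutation, but the law of a
superposition is symmetric in its points. -/
lemma superpositionKernel_sum_dirac [StandardBorelSpace α] [Nonempty α] (κ : α → Measure γ)
    [∀ a, IsProbabilityMeasure (κ a)] {n : ℕ} (t : Fin n → α) :
    superpositionKernel κ (∑ i, Measure.dirac (t i)) = superposition fun i => κ (t i) := by
  obtain ⟨σ, hσ⟩ := exists_perm_nthPoint t
  have hn : ⌊((∑ i, Measure.dirac (t i) : Measure α) univ).toReal⌋₊ = n := by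
    simp [Measure.finsetSum_apply]
  rw [superpositionKernel, hn]
  simp only [hσ]
  exact superposition_perm (fun i => κ (t i)) σ

instance [StandardBorelSpace α] [Nonempty α] (κ : α → Measure γ)
    [∀ a, IsProbabilityMeasure (κ a)] (μ : Measure α) :
    IsProbabilityMeasure (superpositionKernel κ μ) :=
  Measure.isProbabilityMeasure_map measurable_sum_dirac.aemeasurable

lemma lintegral_expNeg_superposition {n : ℕ} (ρ : Fin n → Measure γ)
    [∀ i, IsProbabilityMeasure (ρ i)] {f : γ → ℝ≥0∞} (hf : Measurable f) :
    ∫⁻ ν, expNeg (∫⁻ a, f a ∂ν) ∂(superposition ρ) = ∏ i, ∫⁻ a, expNeg (f a) ∂(ρ i) := by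
  have hef := measurable_expNeg.comp hf
  have hm : Measurable fun ν : Measure γ => expNeg (∫⁻ a, f a ∂ν) :=
    measurable_expNeg.comp (Measure.measurable_lintegral hf)
  have h1 : ∀ g : Fin n → γ, expNeg (∫⁻ a, f a ∂(∑ i, Measure.dirac (g i))) =
      ∏ i, expNeg (f (g i)) := fun g => by
    rw [lintegral_finsetSum_measure, expNeg_sum]
    simp only [lintegral_dirac' _ hf]
  rw [superposition, lintegral_map hm measurable_sum_dirac]
  simp only [h1]
  have hind := iIndepFun_pi (μ := ρ) (X := fun _ => expNeg ∘ f) fun i => hef.aemeasurable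
  have h2 := lintegral_prod_eq_prod_lintegral_of_indepFun Finset.univ _ hind
    fun i => hef.comp (measurable_pi_apply i)
  refine h2.trans (Finset.prod_congr rfl fun i _ => ?_)
  have h3 := (measurePreserving_eval ρ i).lintegral_comp hef
  exact h3

end Superposition

/-! ### The shred kernel -/

section ShredKernel

variable {d : ℕ} {β : ℝ≥0} {P₀ : Measure C(ℝ≥0, E d)} {W : Set (E d)}

lemma IsBrownianLaw.map_increments (h : IsBrownianLaw P₀) (β : ℝ≥0) (l : ℕ) :
    P₀.map (fun w (i : Fin l) => w ((i + 1 : ℕ) * β) - w ((i : ℕ) * β)) =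
      Measure.pi fun _ : Fin l => gaussianStep d β := by
  have := h.isProbabilityMeasure
  have hmono : Monotone fun i : Fin (l + 1) => ((i : ℕ) : ℝ≥0) * β := fun i j hij => by
    have : (i : ℕ) ≤ j := hij
    dsimp only
    gcongr
  have hind := h.indep l _ hmono
  simp only [Fin.val_succ, Fin.val_castSucc] at hind
  have hm : ∀ i : Fin l, Measurable fun w : C(ℝ≥0, E d) => w ((i + 1 : ℕ) * β) - w ((i : ℕ) * β) :=
    fun i => (measurable_eval_path _).sub (measurable_eval_path _)
  rw [(iIndepFun_iff_map_fun_eq_pi_map fun i => (hm i).aemeasurable).1 hind]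
  congr 1
  funext i
  rw [h.increment _ _ (by gcongr; omega)]
  congr 1
  push_cast
  rw [add_mul, one_mul, add_tsub_cancel_left]

/-- Partial sums of a finite sequence, as a linear map. -/
noncomputable def partialSum (d l j : ℕ) : (Fin l → E d) →ₗ[ℝ] E d :=
  ∑ i ∈ Finset.range j, if hi : i < l then LinearMap.proj ⟨i, hi⟩ else 0

lemma partialSum_apply {l j : ℕ} (hj : j ≤ l) (γ : ℕ → E d) :
    partialSum d l j (fun i => γ (i + 1) - γ i) = γ j - γ 0 := by
  rw [← Finset.sum_range_sub, partialSum, LinearMap.sum_apply]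
  refine Finset.sum_congr rfl fun i hi => ?_
  rw [dif_pos ((Finset.mem_range.1 hi).trans_le hj)]
  rfl

lemma partialSum_succ {l : ℕ} (i : Fin l) (η : Fin l → E d) :
    partialSum d l (i + 1) η = partialSum d l i η + η i := by
  simp only [partialSum, Finset.sum_range_succ, LinearMap.add_apply]
  simp

/-- The linear map that sends the increments `η` of a walk with `l` steps to the positions of the
bridge at the times `1, …, l - 1` and the endpoint of the walk. -/
noncomputable def bridgeMap (d l : ℕ) : (Fin l → E d) →ₗ[ℝ] (Fin l → E d) :=
  LinearMap.pi fun i => if (i : ℕ) + 1 = l then partialSum d l l else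
    partialSum d l (i + 1) - (((i + 1 : ℕ) : ℝ) / l) • partialSum d l l

/-- The kernel is trivial: the last coordinate forces the total sum to vanish, the others then force
all partial sums to vanish, and differences of partial sums give the increments. -/
lemma det_bridgeMap_ne_zero (l : ℕ) : LinearMap.det (bridgeMap d l) ≠ 0 := by
  intro h0
  refine (LinearMap.bot_lt_ker_of_det_eq_zero h0).ne' (LinearMap.ker_eq_bot'.2 fun η hη => ?_)
  have hi : ∀ i : Fin l, bridgeMap d l η i = 0 := fun i => by rw [hη]; rfl
  have hl : partialSum d l l η = 0 := by
    rcases l with _ | l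
    · simp [partialSum]
    · simpa [bridgeMap] using hi (Fin.last l)
  have hj : ∀ j ≤ l, partialSum d l j η = 0 := by
    intro j hj
    rcases j with _ | j
    · simp [partialSum]
    · rcases eq_or_ne (j + 1) l with h | h
      · rw [h, hl]
      · simpa [bridgeMap, h, hl] using hi ⟨j, by omega⟩
  funext i
  have := partialSum_succ i η
  rw [hj _ (by omega), hj _ (by omega), zero_add] at this
  exact this.symm

/-- The set is the preimage, under an invertible linear map, of a product of translates of `W` and
one unconstrained factor. -/
lemma volume_pos_bridgeMap {l : ℕ} (hW : 0 < volume W) (c : Fin l → E d) :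
    0 < volume {η : Fin l → E d | ∀ i : Fin l, (i : ℕ) + 1 < l → c i + bridgeMap d l η i ∈ W} := by
  have h1 : {η : Fin l → E d | ∀ i : Fin l, (i : ℕ) + 1 < l → c i + bridgeMap d l η i ∈ W} =
      bridgeMap d l ⁻¹' (univ.pi fun i : Fin l =>
        if (i : ℕ) + 1 < l then (fun y => c i + y) ⁻¹' W else univ) := by
    ext η
    simp only [Set.mem_ofPred_eq, mem_preimage, Set.mem_pi, mem_univ, true_imp_iff]
    refine forall_congr' fun i => ?_
    split_ifs with hi <;> simp [hi]
  rw [h1, Measure.addHaar_preimage_linearMap _ (det_bridgeMap_ne_zero l), volume_pi, Measure.pi_pi]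
  refine ENNReal.mul_pos ?_ (Finset.prod_ne_zero_iff.2 fun i _ => ?_)
  · simpa using det_bridgeMap_ne_zero l
  · split_ifs
    · rw [measure_preimage_add]; exact hW.ne'
    · exact (NeZero.ne (volume (univ : Set (E d))))

/-- The event depends only on the increments between grid times, which are i.i.d. Gaussian. Lebesgue
measure is absolutely continuous with respect to their law, and the event has positive Lebesgue
measure. Adding the free endpoint of the path as a last coordinate is what makes `bridgeMap`
invertible. -/
lemma bridgeStays_ne_zero (h : IsBrownianLaw P₀) (hβ : β ≠ 0) (hW : MeasurableSet W)
    (hW0 : 0 < volume W) (x y : E d) (l : ℕ) : P₀ (bridgeStays β W (x, l, y)) ≠ 0 := by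
  have := h.isProbabilityMeasure
  let A : Set (Fin l → E d) := {η | ∀ i : Fin l, (i : ℕ) + 1 < l →
    (x - (((i + 1 : ℕ) : ℝ) / l) • (x - y)) + bridgeMap d l η i ∈ W}
  have hA : MeasurableSet A := by
    have : A = ⋂ i : Fin l, ⋂ _ : (i : ℕ) + 1 < l,
        {η | (x - (((i + 1 : ℕ) : ℝ) / l) • (x - y)) + bridgeMap d l η i ∈ W} := by
      ext η; simp [A]
    rw [this]
    refine MeasurableSet.iInter fun i => MeasurableSet.iInter fun _ => ?_
    have hc : Measurable fun η : Fin l → E d =>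
        (x - (((i + 1 : ℕ) : ℝ) / l) • (x - y)) + bridgeMap d l η i :=
      measurable_const.add ((measurable_pi_apply i).comp
        (bridgeMap d l).continuous_of_finiteDimensional.measurable)
    exact hc hW
  have hm : Measurable fun (w : C(ℝ≥0, E d)) (i : Fin l) => w ((i + 1 : ℕ) * β) - w ((i : ℕ) * β) :=
    measurable_pi_iff.2 fun i => (measurable_eval_path _).sub (measurable_eval_path _)
  have hpos : P₀.map (fun w (i : Fin l) => w ((i + 1 : ℕ) * β) - w ((i : ℕ) * β)) A ≠ 0 := by
    rw [h.map_increments]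
    intro h0
    have := absolutelyContinuous_pi (volume_absolutelyContinuous_gaussianStep (d := d) hβ) l h0
    exact (volume_pos_bridgeMap hW0 _).ne' this
  rw [Measure.map_apply hm hA] at hpos
  refine fun h0 => hpos (measure_mono_null ?_ h0)
  intro w hw j hj1 hjl
  have hjl : j < l := hjl
  obtain ⟨i, rfl⟩ : ∃ i, j = i + 1 := ⟨j - 1, by omega⟩
  have h1 := hw ⟨i, by omega⟩ hjl
  have hne : i + 1 ≠ l := by omega
  have hb : (β : ℝ) ≠ 0 := by simpa using hβ
  simp only [bridgeMap, LinearMap.pi_apply, hne, if_false, LinearMap.sub_apply,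
    LinearMap.smul_apply] at h1
  rw [partialSum_apply hjl.le fun j : ℕ => w (j * β), partialSum_apply le_rfl fun j : ℕ => w (j * β)]
    at h1
  convert h1 using 1
  simp only [bridgePath, ContinuousMap.coe_mk, NNReal.coe_mul, NNReal.coe_natCast, Nat.cast_zero,
    zero_mul]
  rw [mul_div_mul_right _ _ hb]
  module

lemma isProbabilityMeasure_shredLaw (h : IsBrownianLaw P₀) (hβ : β ≠ 0) (hW : MeasurableSet W)
    (hW0 : 0 < volume W) (t : E d × ℕ × E d) : IsProbabilityMeasure (shredLaw P₀ β W t) := by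
  have := h.isProbabilityMeasure
  obtain ⟨x, l, y⟩ := t
  have := cond_isProbabilityMeasure (μ := P₀) (bridgeStays_ne_zero h hβ hW hW0 x y l)
  rw [shredLaw_mk]
  exact Measure.isProbabilityMeasure_map (measurable_finBridge_right l x y).aemeasurable

end ShredKernel

/-! ### Almost sure finiteness of the number of shreds -/

section Finiteness

lemma IsPoissonPointProcess.ae_lt_top {X : Type*} [MeasurableSpace X] {ℛ : Measure (Measure X)}
    {Λ : Measure X} (h : IsPoissonPointProcess ℛ Λ) {B : Set X} (hB : MeasurableSet B)
    (hΛ : Λ B ≠ ∞) : ∀ᵐ η ∂ℛ, η B < ∞ := by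
  have hm : MeasurableSet {x : ℝ≥0∞ | x < ∞} := measurableSet_Iio
  have h1 : ∀ᵐ x ∂(ℛ.map fun η => η B), x < ∞ := by
    rw [h.poisson B hB hΛ, ae_map_iff (Measurable.of_discrete).aemeasurable hm]
    exact ae_of_all _ fun n => ENNReal.natCast_lt_top n
  exact ae_of_ae_map (Measure.measurable_coe hB).aemeasurable h1

lemma IsPoissonPointProcess.ae_eq_zero {X : Type*} [MeasurableSpace X] {ℛ : Measure (Measure X)}
    {Λ : Measure X} (h : IsPoissonPointProcess ℛ Λ) {B : Set X} (hB : MeasurableSet B)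
    (hΛ : Λ B = 0) : ∀ᵐ η ∂ℛ, η B = 0 := by
  have hm : MeasurableSet {x : ℝ≥0∞ | x = 0} := measurableSet_singleton 0
  have h1 : ∀ᵐ x ∂(ℛ.map fun η => η B), x = 0 := by
    rw [h.poisson B hB (by simp [hΛ]), ae_map_iff (Measurable.of_discrete).aemeasurable hm, hΛ]
    have h2 : poissonMeasure (0 : ℝ≥0∞).toNNReal {0}ᶜ = 0 := by
      rw [prob_compl_eq_zero_iff (measurableSet_singleton 0), poissonMeasure_singleton]
      simp
    refine measure_mono_null (fun n hn => ?_) h2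
    simpa using hn
  exact ae_of_ae_map (Measure.measurable_coe hB).aemeasurable h1

/-- Only finitely many of the points are in `B`, the others contribute nothing, and no point has an
infinite contribution. -/
lemma lintegral_sum_dirac_lt_top {X I : Type*} [MeasurableSpace X] [Countable I] {g : I → X}
    {B : Set X} (hB : MeasurableSet B)
    (hfin : (Measure.sum fun i => Measure.dirac (g i)) B < ∞) {S : X → ℝ≥0∞} (hS : Measurable S)
    (hSB : ∀ x ∉ B, S x = 0) (hae : (Measure.sum fun i => Measure.dirac (g i)) {x | S x = ∞} = 0) :
    ∫⁻ x, S x ∂(Measure.sum fun i => Measure.dirac (g i)) < ∞ := by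
  have hZ : MeasurableSet {x | S x = ∞} := hS (measurableSet_singleton ∞)
  rw [Measure.sum_apply _ hB] at hfin
  rw [Measure.sum_apply _ hZ, ENNReal.tsum_eq_zero] at hae
  have h1 : {i | 1 ≤ Measure.dirac (g i) B}.Finite :=
    ENNReal.finite_const_le_of_tsum_ne_top hfin.ne one_ne_zero
  rw [lintegral_sum_measure]
  simp only [lintegral_dirac' _ hS]
  rw [tsum_eq_sum (s := h1.toFinset)]
  · refine ENNReal.sum_lt_top.2 fun i _ => ?_
    have h2 := hae i
    rw [Measure.dirac_apply' _ hZ] at h2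
    refine lt_top_iff_ne_top.2 fun h3 => ?_
    rw [indicator_of_mem (show g i ∈ {x | S x = ∞} from h3)] at h2
    simp at h2
  · intro i hi
    refine hSB _ fun hmem => hi ?_
    rw [Finite.mem_toFinset]
    show 1 ≤ Measure.dirac (g i) B
    rw [Measure.dirac_apply' _ hB, indicator_of_mem hmem]
    rfl

open Classical in
/-- A countable sum of Dirac measures with finite total mass is a finite sum. -/
lemma exists_fin_sum_dirac {X J : Type*} [MeasurableSpace X] (c : J → Prop) (a : J → X)
    (hfin : (Measure.sum fun j => if c j then Measure.dirac (a j) else 0) univ ≠ ∞) :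
    ∃ (n : ℕ) (t : Fin n → X), (∀ i, ∃ j, c j ∧ t i = a j) ∧
      (Measure.sum fun j => if c j then Measure.dirac (a j) else 0) = ∑ i, Measure.dirac (t i) := by
  rw [Measure.sum_apply _ MeasurableSet.univ] at hfin
  -- Each index with `c j` contributes mass `1` to a finite total, so there are finitely many.
  have h1 := ENNReal.finite_const_le_of_tsum_ne_top hfin one_ne_zero
  have h2 : ∀ j, j ∈ h1.toFinset ↔ c j := fun j => by
    rw [Finite.mem_toFinset, Set.mem_ofPred_eq]
    by_cases hj : c j <;> simp [hj]
  refine ⟨h1.toFinset.card, fun i => a (h1.toFinset.equivFin.symm i), fun i =>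
    ⟨_, (h2 _).1 (h1.toFinset.equivFin.symm i).2, rfl⟩, ?_⟩
  ext s hs
  rw [Measure.sum_apply _ hs, tsum_eq_sum (s := h1.toFinset), Measure.finsetSum_apply,
    Equiv.sum_comp h1.toFinset.equivFin.symm fun j : h1.toFinset => Measure.dirac (a j) s,
    ← Finset.sum_coe_sort]
  · refine Finset.sum_congr rfl fun j _ => ?_
    rw [if_pos ((h2 _).1 j.2)]
  · intro j hj
    rw [if_neg (mt (h2 j).2 hj)]
    rfl

lemma map_sum_dirac {X Y : Type*} [MeasurableSpace X] [MeasurableSpace Y] {F : X → Y}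
    (hF : Measurable F) {n : ℕ} (t : Fin n → X) :
    (∑ i, Measure.dirac (t i)).map F = ∑ i, Measure.dirac (F (t i)) := by
  ext s hs
  rw [Measure.map_apply hF hs, Measure.finsetSum_apply, Measure.finsetSum_apply]
  refine Finset.sum_congr rfl fun i _ => ?_
  rw [Measure.dirac_apply' _ hs, Measure.dirac_apply' _ (hF hs)]
  rfl

variable {d : ℕ} {β : ℝ≥0} {P₀ : Measure C(ℝ≥0, E d)} {W : Set (E d)}

lemma measurable_shredding (hW : MeasurableSet W) : Measurable (shredding (β := β) W) :=
  Measure.measurable_bind' (measurable_shredsOf hW)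

lemma measurable_boundaryShredding (hW : MeasurableSet W) :
    Measurable (boundaryShredding (β := β) W) :=
  (Measure.measurable_map _ measurable_endpoints).comp (measurable_shredding hW)

lemma lintegral_shredding (hW : MeasurableSet W) {f : FinPath d β → ℝ≥0∞} (hf : Measurable f)
    (ϖ : Measure (Interlacement d β)) :
    ∫⁻ γ, f γ ∂(shredding W ϖ) = ∫⁻ g, shredIntegral W f g ∂ϖ :=
  Measure.lintegral_bind (measurable_shredsOf hW).aemeasurable hf.aemeasurable

lemma endpoints_piece_mem_boundaryData {g : C(ℝ, E d)} {p : ℤ × ℕ} (h : IsShred β W g p) :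
    endpoints (piece β g p.1 p.2) ∈ boundaryData W := by
  obtain ⟨h1, -, h3, h4⟩ := h
  refine ⟨?_, h1, ?_⟩
  · have e : (endpoints (piece β g p.1 p.2)).1 = g (p.1 * β + ((0 : ℝ≥0) : ℝ)) := rfl
    rw [e]
    simpa using h3 0 h1
  · have e : endpoints (piece β g p.1 p.2) =
        (g (p.1 * β + ((0 : ℝ≥0) : ℝ)), p.2, g (p.1 * β + ((p.2 * β : ℝ≥0) : ℝ))) := rfl
    rw [e]
    have e2 : (p.1 : ℝ) * β + ((p.2 * β : ℝ≥0) : ℝ) = ((p.1 + p.2 : ℤ) : ℝ) * β := by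
      push_cast; ring
    rwa [e2]

lemma exists_shredding_eq (hW : MeasurableSet W) {I : Type*} [Countable I]
    (g : I → Interlacement d β)
    (hfin : shredding W (Measure.sum fun i => Measure.dirac (g i)) univ ≠ ∞) :
    ∃ (n : ℕ) (γ : Fin n → FinPath d β), (∀ i, endpoints (γ i) ∈ boundaryData W) ∧
      shredding W (Measure.sum fun i => Measure.dirac (g i)) = ∑ i, Measure.dirac (γ i) := by
  classical
  have h1 : ∀ i, shredsOf W (g i) = Measure.sum fun p : ℤ × ℕ =>
      if IsShred β W (g i).out p then Measure.dirac (piece β (g i).out p.1 p.2) else 0 := fun i => by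
    conv_lhs => rw [← Quotient.out_eq (g i)]
    rfl
  have h2 : shredding W (Measure.sum fun i => Measure.dirac (g i)) =
      Measure.sum fun q : I × (ℤ × ℕ) => if IsShred β W (g q.1).out q.2 then
        Measure.dirac (piece β (g q.1).out q.2.1 q.2.2) else 0 := by
    rw [shredding, Measure.bind_sum _ _ (measurable_shredsOf hW).aemeasurable]
    simp only [Measure.dirac_bind (measurable_shredsOf hW), h1]
    exact Measure.sum_sum _
  rw [h2] at hfin ⊢
  obtain ⟨n, t, ht, h3⟩ := exists_fin_sum_dirac _ _ hfin
  refine ⟨n, t, fun i => ?_, h3⟩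
  obtain ⟨q, hq, hti⟩ := ht i
  rw [hti]
  exact endpoints_piece_mem_boundaryData hq

variable {v : ℝ≥0} {ℛ : Measure (Measure (Interlacement d β))}

/-- The cube around `W` has finite intensity and thus meets finitely many interlacements;
interlacements with infinitely many shreds form a null set of the intensity and do not occur. -/
theorem ae_exists_shredding_eq (h : IsBrownianLaw P₀) (hβ : β ≠ 0) (hd : 3 ≤ d)
    (hW : MeasurableSet W) (hWb : Bornology.IsBounded W)
    (hℛ : IsPoissonPointProcess ℛ (v • pathIntensity P₀ β)) :
    ∀ᵐ ϖ ∂ℛ, ∃ (n : ℕ) (γ : Fin n → FinPath d β), (∀ i, endpoints (γ i) ∈ boundaryData W) ∧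
      shredding W ϖ = ∑ i, Measure.dirac (γ i) := by
  obtain ⟨N, hN⟩ := exists_subset_box hWb
  have hB := measurableSet_hasParticleIn (β := β) (measurableSet_box (d := d) (N + 1))
  have hS := measurable_shredIntegral (β := β) hW measurable_one
  have hZ : MeasurableSet {g : Interlacement d β | shredIntegral W 1 g = ∞} :=
    hS (measurableSet_singleton ∞)
  have hBfin : (v • pathIntensity P₀ β) (hasParticleIn (box d (N + 1))) ≠ ∞ :=
    (ENNReal.mul_lt_top ENNReal.coe_lt_top (pathIntensity_hasParticleIn_lt_top h hβ hd N)).ne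
  have hZ0 : (v • pathIntensity P₀ β) {g | shredIntegral W 1 g = ∞} = 0 := by
    have h1 : pathIntensity P₀ β {g | shredIntegral W 1 g = ∞} = 0 := by
      have := ae_shredIntegral_one_lt_top h hβ hd hW hWb
      rw [ae_iff] at this
      simpa using this
    rw [Measure.smul_apply, h1, smul_zero]
  filter_upwards [hℛ.points, hℛ.ae_lt_top hB hBfin, hℛ.ae_eq_zero hZ hZ0] with ϖ h1 h2 h3
  obtain ⟨I, g, rfl⟩ := h1
  refine exists_shredding_eq hW g ?_
  have h4 := lintegral_sum_dirac_lt_top hB h2 hS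
    (fun x hx => shredIntegral_eq_zero hN 1 hx) h3
  rw [← lintegral_shredding hW measurable_one] at h4
  simpa using h4.ne

end Finiteness

/-! ### The conditional law of the shreds -/

section CondLaw

variable {d : ℕ} {β : ℝ≥0} {P₀ : Measure C(ℝ≥0, E d)} {W : Set (E d)} {v : ℝ≥0}
  {ℛ : Measure (Measure (Interlacement d β))}

/-- Membership in `boundaryData` is used only for `l ≥ 1`; a bridge without legs cannot have two
prescribed endpoints. -/
lemma ae_endpoints_shredLaw (hβ : β ≠ 0) {t : E d × ℕ × E d} (ht : t ∈ boundaryData W) :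
    ∀ᵐ γ ∂(shredLaw P₀ β W t), endpoints γ = t := by
  obtain ⟨x, l, y⟩ := t
  have hl : l ≠ 0 := by have := ht.2.1; dsimp only at this; omega
  have hm : MeasurableSet {γ : FinPath d β | endpoints γ = (x, l, y)} :=
    measurable_endpoints (measurableSet_singleton _)
  rw [shredLaw_mk, ae_map_iff (measurable_finBridge_right l x y).aemeasurable hm]
  exact ae_of_all _ fun w => endpoints_finBridge hβ hl x y w

/-- Resampled shreds keep their boundary data almost surely, so these can be read off from the
resampled configuration. -/
lemma ae_map_endpoints_superposition (hβ : β ≠ 0) {n : ℕ} {t : Fin n → E d × ℕ × E d}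
    (ht : ∀ i, t i ∈ boundaryData W) [∀ t, IsProbabilityMeasure (shredLaw P₀ β W t)]
    {p : Measure (FinPath d β) → Measure (E d × ℕ × E d) → ℝ≥0∞}
    (hp : Measurable fun ν => p ν (ν.map endpoints))
    (hp' : Measurable fun ν => p ν (∑ i, Measure.dirac (t i))) :
    ∫⁻ ν, p ν (ν.map endpoints) ∂(superposition fun i => shredLaw P₀ β W (t i)) =
      ∫⁻ ν, p ν (∑ i, Measure.dirac (t i)) ∂(superposition fun i => shredLaw P₀ β W (t i)) := by
  rw [superposition, lintegral_map hp measurable_sum_dirac, lintegral_map hp' measurable_sum_dirac]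
  have hae : ∀ᵐ g ∂(Measure.pi fun i => shredLaw P₀ β W (t i)), ∀ i, endpoints (g i) = t i :=
    ae_all_iff.2 fun i =>
      (Measure.quasiMeasurePreserving_eval (fun j => shredLaw P₀ β W (t j)) i).ae
        (p := fun γ => endpoints γ = t i) (ae_endpoints_shredLaw hβ (ht i))
  refine lintegral_congr_ae ?_
  filter_upwards [hae] with g hg
  simp only [map_sum_dirac measurable_endpoints, hg]

/-- Conditionally on the boundary data, the Laplace functional of the shreds is that of independent
Brownian shreds. -/
theorem laplace_shredding (h : IsBrownianLaw P₀) (hβ : β ≠ 0) (hd : 3 ≤ d)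
    (hW : MeasurableSet W) (hWb : Bornology.IsBounded W)
    (hℛ : IsPoissonPointProcess ℛ (v • pathIntensity P₀ β)) {f : FinPath d β → ℝ≥0∞}
    (hf : Measurable f) :
    ∫⁻ ϖ, expNeg (∫⁻ γ, f γ ∂(shredding W ϖ)) ∂ℛ =
      ∫⁻ ϖ, expNeg (∫⁻ t, resample P₀ W f t ∂(boundaryShredding W ϖ)) ∂ℛ := by
  have := h.isProbabilityMeasure
  obtain ⟨N, hN⟩ := exists_subset_box hWb
  have hBfin : (v • pathIntensity P₀ β) (hasParticleIn (box d (N + 1))) ≠ ∞ :=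
    (ENNReal.mul_lt_top ENNReal.coe_lt_top (pathIntensity_hasParticleIn_lt_top h hβ hd N)).ne
  have hr := measurable_resample (P₀ := P₀) (β := β) hW hf
  have hf' : Measurable fun γ : FinPath d β => resample P₀ W f (endpoints γ) :=
    hr.comp measurable_endpoints
  -- The Poisson formula, for the function that sums `f` over the shreds of one interlacement; it
  -- vanishes off a set of finite intensity.
  have key : ∀ {f : FinPath d β → ℝ≥0∞}, Measurable f →
      ∫⁻ ϖ, expNeg (∫⁻ γ, f γ ∂(shredding W ϖ)) ∂ℛ =
        expNeg (v * ∫⁻ g, (1 - expNeg (shredIntegral W f g)) ∂(pathIntensity P₀ β)) := by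
    intro f hf
    simp only [lintegral_shredding hW hf]
    rw [hℛ.laplace (measurable_shredIntegral hW hf) hBfin
      fun g hg => shredIntegral_eq_zero hN f hg]
    rw [lintegral_smul_measure]
    rfl
  have h2 : ∀ ϖ : Measure (Interlacement d β), ∫⁻ t, resample P₀ W f t ∂(boundaryShredding W ϖ) =
      ∫⁻ γ, resample P₀ W f (endpoints γ) ∂(shredding W ϖ) := fun ϖ =>
    lintegral_map hr measurable_endpoints
  simp only [h2]
  rw [key hf, key hf', lintegral_one_sub_expNeg_resample h hβ hd hW hWb hf]

instance : Nonempty (E d × ℕ × E d) := ⟨(0, 0, 0)⟩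

/-- Both sides have the same Laplace functional: on the right, independence of the points gives a
product of factors `exp(-resample)` over the boundary data. -/
lemma map_shredding_eq_bind (h : IsBrownianLaw P₀) (hβ : β ≠ 0) (hd : 3 ≤ d)
    (hW : MeasurableSet W) (hWb : Bornology.IsBounded W)
    (hℛ : IsPoissonPointProcess ℛ (v • pathIntensity P₀ β))
    [∀ t, IsProbabilityMeasure (shredLaw P₀ β W t)] :
    ℛ.map (shredding W) =
      (ℛ.map (boundaryShredding W)).bind (superpositionKernel (shredLaw P₀ β W)) := by
  have := h.isProbabilityMeasure
  have := hℛ.isProbabilityMeasure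
  have hs := measurable_shredding (β := β) hW
  have hb := measurable_boundaryShredding (β := β) hW
  have hk := measurable_superpositionKernel (measurable_shredLaw (β := β) P₀ hW)
  have : IsProbabilityMeasure (ℛ.map (shredding W)) :=
    Measure.isProbabilityMeasure_map hs.aemeasurable
  have : IsProbabilityMeasure (ℛ.map (boundaryShredding W)) :=
    Measure.isProbabilityMeasure_map hb.aemeasurable
  have : IsProbabilityMeasure
      ((ℛ.map (boundaryShredding W)).bind (superpositionKernel (shredLaw P₀ β W))) :=
    isProbabilityMeasure_bind hk.aemeasurable (ae_of_all _ fun μ => inferInstance)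
  refine ext_of_laplace _ _ fun f hf => ?_
  have hm : Measurable fun ν : Measure (FinPath d β) => expNeg (∫⁻ γ, f γ ∂ν) :=
    measurable_expNeg.comp (Measure.measurable_lintegral hf)
  have hmk : Measurable fun μ : Measure (E d × ℕ × E d) =>
      ∫⁻ ν, expNeg (∫⁻ γ, f γ ∂ν) ∂(superpositionKernel (shredLaw P₀ β W) μ) :=
    (Measure.measurable_lintegral hm).comp hk
  rw [lintegral_map hm hs, Measure.lintegral_bind hk.aemeasurable hm.aemeasurable,
    lintegral_map hmk hb, laplace_shredding h hβ hd hW hWb hℛ hf]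
  refine lintegral_congr_ae ?_
  filter_upwards [ae_exists_shredding_eq h hβ hd hW hWb hℛ] with ϖ hϖ
  obtain ⟨n, γ, -, hγ⟩ := hϖ
  have hr := measurable_resample (P₀ := P₀) (β := β) hW hf
  rw [boundaryShredding, hγ, map_sum_dirac measurable_endpoints, superpositionKernel_sum_dirac,
    lintegral_expNeg_superposition _ hf, lintegral_finsetSum_measure, expNeg_sum]
  simp only [lintegral_dirac' _ hr, expNeg_resample]

/-- The joint law of the boundary data and the shreds. -/
theorem map_boundaryShredding_shredding (h : IsBrownianLaw P₀) (hβ : β ≠ 0) (hd : 3 ≤ d)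
    (hW : MeasurableSet W) (hWb : Bornology.IsBounded W)
    (hℛ : IsPoissonPointProcess ℛ (v • pathIntensity P₀ β))
    [∀ t, IsProbabilityMeasure (shredLaw P₀ β W t)]
    (K : Kernel (Measure (E d × ℕ × E d)) (Measure (FinPath d β))) [IsMarkovKernel K]
    (hK : ∀ μ, K μ = superpositionKernel (shredLaw P₀ β W) μ) :
    ℛ.map (fun ϖ => (boundaryShredding W ϖ, shredding W ϖ)) =
      (ℛ.map (boundaryShredding W)) ⊗ₘ K := by
  have := h.isProbabilityMeasure
  have := hℛ.isProbabilityMeasure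
  have hs := measurable_shredding (β := β) hW
  have hb := measurable_boundaryShredding (β := β) hW
  have hk := measurable_superpositionKernel (measurable_shredLaw (β := β) P₀ hW)
  have : IsProbabilityMeasure (ℛ.map (boundaryShredding W)) :=
    Measure.isProbabilityMeasure_map hb.aemeasurable
  have hme : Measurable fun ν : Measure (FinPath d β) => ν.map endpoints :=
    Measure.measurable_map _ measurable_endpoints
  refine Measure.ext_of_lintegral _ fun H hH => ?_
  have hH1 : Measurable fun ν : Measure (FinPath d β) => H (ν.map endpoints, ν) :=
    hH.comp (hme.prodMk measurable_id)
  have hH2 : Measurable fun μ : Measure (E d × ℕ × E d) =>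
      ∫⁻ ν, H (ν.map endpoints, ν) ∂(superpositionKernel (shredLaw P₀ β W) μ) :=
    (Measure.measurable_lintegral hH1).comp hk
  have hH3 : Measurable fun μ : Measure (E d × ℕ × E d) => ∫⁻ ν, H (μ, ν) ∂(K μ) :=
    hH.lintegral_kernel_prod_right'
  calc ∫⁻ q, H q ∂(ℛ.map fun ϖ => (boundaryShredding W ϖ, shredding W ϖ))
      = ∫⁻ ν, H (ν.map endpoints, ν) ∂(ℛ.map (shredding W)) := by
        -- The boundary data are the image of the shreds under `endpoints`, so the joint law is a
        -- function of the law of the shreds alone.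
        rw [lintegral_map hH (hb.prodMk hs), lintegral_map hH1 hs]
        rfl
    _ = ∫⁻ ϖ, ∫⁻ ν, H (ν.map endpoints, ν)
          ∂(superpositionKernel (shredLaw P₀ β W) (boundaryShredding W ϖ)) ∂ℛ := by
        rw [map_shredding_eq_bind h hβ hd hW hWb hℛ,
          Measure.lintegral_bind hk.aemeasurable hH1.aemeasurable, lintegral_map hH2 hb]
    _ = ∫⁻ ϖ, ∫⁻ ν, H (boundaryShredding W ϖ, ν) ∂(K (boundaryShredding W ϖ)) ∂ℛ := by
        -- The boundary data recomputed from the resampled shreds are replaced by the original ones,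
        -- which is legitimate for finite sums of points of `boundaryData`.
        refine lintegral_congr_ae ?_
        filter_upwards [ae_exists_shredding_eq h hβ hd hW hWb hℛ] with ϖ hϖ
        obtain ⟨n, γ, hγ, hϖ⟩ := hϖ
        rw [hK, boundaryShredding, hϖ, map_sum_dirac measurable_endpoints,
          superpositionKernel_sum_dirac]
        exact ae_map_endpoints_superposition hβ hγ (p := fun ν μ => H (μ, ν)) hH1
          (hH.comp measurable_prodMk_left)
    _ = ∫⁻ q, H q ∂((ℛ.map (boundaryShredding W)) ⊗ₘ K) := by
        rw [Measure.lintegral_compProd hH, lintegral_map hH3 hb]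

end CondLaw

end BrownianShreds

theorem lemmaA2 (d : ℕ) (hd : 3 ≤ d) (β : ℝ≥0) (hβ : 0 < β) (u : ℝ≥0) (hu : 0 < u)
    (P₀ : Measure C(ℝ≥0, BrownianShreds.E d)) (hP₀ : BrownianShreds.IsBrownianLaw P₀)
    (ℛ : Measure (Measure (BrownianShreds.Interlacement d β)))
    (hℛ : BrownianShreds.IsBrownianInterlacementLaw P₀ β u ℛ)
    (W : Set (BrownianShreds.E d)) (hW : MeasurableSet W) (hWb : Bornology.IsBounded W)
    (hW0 : 0 < volume W) :
    (∀ᵐ ϖ ∂ℛ, ∃ (n : ℕ) (t : Fin n → BrownianShreds.E d × ℕ × BrownianShreds.E d),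
      (∀ i, t i ∈ BrownianShreds.boundaryData W) ∧
        BrownianShreds.boundaryShredding W ϖ = ∑ i, Measure.dirac (t i)) ∧
    ∃ K : Kernel (Measure (BrownianShreds.E d × ℕ × BrownianShreds.E d))
        (Measure (BrownianShreds.FinPath d β)),
      IsMarkovKernel K ∧
      (∀ (n : ℕ) (t : Fin n → BrownianShreds.E d × ℕ × BrownianShreds.E d),
        (∀ i, t i ∈ BrownianShreds.boundaryData W) →
          K (∑ i, Measure.dirac (t i)) = BrownianShreds.shredKernel P₀ β W t) ∧
      HasCondDistrib (BrownianShreds.shredding W) (BrownianShreds.boundaryShredding W) K ℛ := by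
  have := hP₀.isProbabilityMeasure
  obtain ⟨v, hv⟩ := hℛ.poisson
  have := BrownianShreds.isProbabilityMeasure_shredLaw hP₀ hβ.ne' hW hW0
  -- The kernel is Markov on all measures, since the enumeration is total and `shredLaw` is a
  -- probability measure for every triple, also outside `boundaryData`.
  refine ⟨?_, ⟨BrownianShreds.superpositionKernel (BrownianShreds.shredLaw P₀ β W),
    BrownianShreds.measurable_superpositionKernel (BrownianShreds.measurable_shredLaw P₀ hW)⟩,
    ⟨fun μ => ?_⟩, fun n t _ => BrownianShreds.superpositionKernel_sum_dirac _ t, ?_, ?_⟩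
  · filter_upwards [BrownianShreds.ae_exists_shredding_eq hP₀ hβ.ne' hd hW hWb hv] with ϖ hϖ
    obtain ⟨n, γ, hγ, h⟩ := hϖ
    refine ⟨n, fun i => BrownianShreds.endpoints (γ i), hγ, ?_⟩
    rw [BrownianShreds.boundaryShredding, h,
      BrownianShreds.map_sum_dirac BrownianShreds.measurable_endpoints]
  · exact inferInstanceAs
      (IsProbabilityMeasure (BrownianShreds.superpositionKernel (BrownianShreds.shredLaw P₀ β W) μ))
  · exact ((BrownianShreds.measurable_boundaryShredding hW).prodMk
      (BrownianShreds.measurable_shredding hW)).aemeasurable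
  · refine @BrownianShreds.map_boundaryShredding_shredding d β P₀ W v ℛ hP₀ hβ.ne' hd hW hWb hv _ _
      ⟨fun μ => ?_⟩ fun μ => rfl
    exact inferInstanceAs
      (IsProbabilityMeasure (BrownianShreds.superpositionKernel (BrownianShreds.shredLaw P₀ β W) μ))
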